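/- All functions are real- or complex-valued on $[0,1]$ with Lebesgue measure $\mu$, and functions equal a.e. are identified. For measurable $f$ put $f^*(t)=\inf\{s\ge 0:\mu(|f|>s)\le t\}$. For $1\le p<\infty$ and a non-increasing $w:(0,1)\to(0,\infty)$, the Lorentz space $L_{w,p}$ is the space of all measurable $f$ with $\|f\|_{w,p}=\left(\int_0^1 w(t)f^*(t)^p\,dt\right)^{1/p}<\infty$, normed by $\|\cdot\|_{w,p}$. For $p,q\in(1,\infty)$, $L_{p,q}$ is the linear space of all measurable $f$ with $\|f\|_{p,q}=\left(\int_0^1 \frac qp\,t^{q/p-1}f^*(t)^q\,dt\right)^{1/q}<\infty$; the functional $\|\cdot\|_{p,q}$ is in general a quasi-norm. A projection onto a subspace $Y$ of a normed space is a bounded linear operator $P$ with range contained in $Y$ and $Py=y$ for all $y\in Y$. (1) For every $p>2$ there is a constant $k_p>1$, depending only on $p$, such that for every non-increasing weight $w:(0,1)\to(0,\infty)$ and every projection $P$ from the dual space $(L_{w,p})^*$ onto a proper subspace of finite codimension, $\|P\|\ge k_p$. (2) For every $q$ with $1<q<2$ there is a constant $k_q>1$, depending only on $q$, such that for every $p\in(1,\infty)$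 there is a norm $|\!|\!|\cdot|\!|\!|$ on $L_{p,q}$, equivalent to $\|\cdot\|_{p,q}$ (that is, $c\|f\|_{p,q}\le|\!|\!|f|\!|\!|\le C\|f\|_{p,q}$ for all $f$, with constants $c,C>0$), such that every projection $P$ from $L_{p,q}$ onto a proper subspace of finite codimension satisfies $|\!|\!|P|\!|\!|\ge k_q$. -/

import Mathlib

open MeasureTheory Set
open scoped ENNReal

namespace Lorentz

/-- The non-increasing rearrangement `G*(t) = inf {s : μ {G > s} ≤ t}` of a nonnegative function
`G`; the rearrangement of a scalar function `f` is that of `|f|`. -/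
noncomputable def rearr {α : Type*} [MeasurableSpace α] (μ : Measure α) (G : α → ℝ≥0∞) (t : ℝ) :
    ℝ≥0∞ :=
  sInf {s : ℝ≥0∞ | μ {x | s < G x} ≤ ENNReal.ofReal t}

section Rearrangement

variable {α : Type*} [MeasurableSpace α] {μ : Measure α} {F G H : α → ℝ≥0∞}

theorem exists_gt_of_lt_measure {a : ℝ≥0∞} {s : ℝ≥0∞} (h : a < μ {x | s < G x}) :
    ∃ r, s < r ∧ a < μ {x | r < G x} := by
  rcases eq_or_ne s ⊤ with rfl | hs
  · simp at h
  obtain ⟨u, hu, hu1, hu2⟩ := exists_seq_strictAnti_tendsto' (lt_top_iff_ne_top.2 hs)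
  have hU : {x | s < G x} = ⋃ n, {x | u n < G x} := by
    ext x
    simp only [mem_ofPred_eq, mem_iUnion]
    constructor
    · intro hx
      exact ((hu2.eventually (gt_mem_nhds hx))).exists
    · rintro ⟨n, hn⟩
      exact (hu1 n).1.trans hn
  have hmono : Monotone fun n => {x | u n < G x} :=
    fun m n hmn x hx => lt_of_le_of_lt (hu.antitone hmn) hx
  rw [hU, hmono.measure_iUnion] at h
  obtain ⟨n, hn⟩ := lt_iSup_iff.1 h
  exact ⟨u n, (hu1 n).1, hn⟩

theorem lt_rearr_iff {s : ℝ≥0∞} {t : ℝ} :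
    s < rearr μ G t ↔ ENNReal.ofReal t < μ {x | s < G x} := by
  constructor
  · intro h
    by_contra! h'
    exact absurd (sInf_le h' : rearr μ G t ≤ s) (not_le.2 h)
  · intro h
    obtain ⟨r, hr, hr'⟩ := exists_gt_of_lt_measure h
    refine hr.trans_le (le_sInf fun y hy => ?_)
    by_contra! hlt
    have : μ {x | r < G x} ≤ μ {x | y < G x} := measure_mono fun x hx => hlt.trans hx
    exact absurd (hr'.trans_le (this.trans hy)) (lt_irrefl _)

theorem rearr_le_iff {s : ℝ≥0∞} {t : ℝ} :
    rearr μ G t ≤ s ↔ μ {x | s < G x} ≤ ENNReal.ofReal t := by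
  simpa using (lt_rearr_iff (μ := μ) (G := G) (s := s) (t := t)).not

theorem rearr_antitone : Antitone (rearr μ G) := fun _ _ h =>
  rearr_le_iff.2 ((rearr_le_iff.1 le_rfl).trans (ENNReal.ofReal_le_ofReal h))

theorem rearr_mono (h : F ≤ᵐ[μ] G) (t : ℝ) : rearr μ F t ≤ rearr μ G t :=
  rearr_le_iff.2 ((measure_mono_ae (h.mono fun _ hx hx' => lt_of_lt_of_le hx' hx)).trans
    (rearr_le_iff.1 le_rfl))

theorem rearr_congr (h : F =ᵐ[μ] G) : rearr μ F = rearr μ G :=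
  funext fun t => le_antisymm (rearr_mono h.le t) (rearr_mono h.symm.le t)

theorem rearr_add_le (t : ℝ) (ht : 0 ≤ t) :
    rearr μ (fun x => F x + G x) t ≤ rearr μ F (t / 2) + rearr μ G (t / 2) := by
  rw [rearr_le_iff]
  calc μ {x | rearr μ F (t / 2) + rearr μ G (t / 2) < F x + G x}
      ≤ μ ({x | rearr μ F (t / 2) < F x} ∪ {x | rearr μ G (t / 2) < G x}) := by
        refine measure_mono fun x hx => ?_
        by_contra hc
        simp only [mem_union, mem_ofPred_eq, not_or, not_lt] at hc
        exact absurd hx (not_lt.2 (add_le_add hc.1 hc.2))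
    _ ≤ _ := measure_union_le _ _
    _ ≤ ENNReal.ofReal (t / 2) + ENNReal.ofReal (t / 2) :=
        add_le_add (rearr_le_iff.1 le_rfl) (rearr_le_iff.1 le_rfl)
    _ = ENNReal.ofReal t := by
        rw [← ENNReal.ofReal_add (by positivity) (by positivity), add_halves]

theorem rearr_const_mul {c : ℝ≥0∞} (h0 : c ≠ 0) (hc : c ≠ ⊤) (t : ℝ) :
    rearr μ (fun x => c * G x) t = c * rearr μ G t := by
  refine eq_of_forall_lt_iff fun s => ?_
  have key : ∀ y : ℝ≥0∞, s < c * y ↔ s / c < y := fun y => by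
    rw [mul_comm, ENNReal.div_lt_iff (Or.inl h0) (Or.inl hc)]
  simp only [lt_rearr_iff, key]

theorem lintegral_eq_lintegral_meas_lt [SFinite μ] (hG : AEMeasurable G μ) :
    ∫⁻ x, G x ∂μ = ∫⁻ s in Ioi (0 : ℝ), μ {x | ENNReal.ofReal s < G x} := by
  have h1 : ∀ a : ℝ≥0∞, a = ∫⁻ s in Ioi (0 : ℝ),
      ({s : ℝ | ENNReal.ofReal s < a}.indicator (fun _ => (1 : ℝ≥0∞)) s) := by
    intro a
    have hm : MeasurableSet {s : ℝ | ENNReal.ofReal s < a} :=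
      measurableSet_lt ENNReal.measurable_ofReal measurable_const
    rw [lintegral_indicator hm, Measure.restrict_restrict hm, setLIntegral_const, one_mul]
    rcases eq_or_ne a ⊤ with rfl | ha
    · simp
    · have : {s : ℝ | ENNReal.ofReal s < a} ∩ Ioi 0 = Ioo 0 a.toReal := by
        ext s
        simp only [mem_inter_iff, mem_ofPred_eq, mem_Ioi, mem_Ioo]
        constructor
        · rintro ⟨h, hs⟩
          exact ⟨hs, (ENNReal.ofReal_lt_iff_lt_toReal hs.le ha).1 h⟩
        · rintro ⟨hs, h⟩
          exact ⟨(ENNReal.ofReal_lt_iff_lt_toReal hs.le ha).2 h, hs⟩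
      rw [this, Real.volume_Ioo, sub_zero, ENNReal.ofReal_toReal ha]
  have hset : MeasurableSet {p : ℝ≥0∞ × ℝ | ENNReal.ofReal p.2 < p.1} :=
    measurableSet_lt (ENNReal.measurable_ofReal.comp measurable_snd) measurable_fst
  have hmeas : AEMeasurable (Function.uncurry fun (x : α) (s : ℝ) =>
      {s : ℝ | ENNReal.ofReal s < G x}.indicator (fun _ => (1 : ℝ≥0∞)) s)
      (μ.prod (volume.restrict (Ioi (0 : ℝ)))) := by
    have hI : Measurable ({p : ℝ≥0∞ × ℝ | ENNReal.ofReal p.2 < p.1}.indicator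
        (fun _ => (1 : ℝ≥0∞))) := measurable_const.indicator hset
    have hp : AEMeasurable (fun p : α × ℝ => (G p.1, p.2))
        (μ.prod (volume.restrict (Ioi (0 : ℝ)))) :=
      (hG.comp_quasiMeasurePreserving Measure.quasiMeasurePreserving_fst).prodMk
        measurable_snd.aemeasurable
    exact hI.comp_aemeasurable hp
  calc ∫⁻ x, G x ∂μ = ∫⁻ x, (∫⁻ s in Ioi (0 : ℝ),
        ({s : ℝ | ENNReal.ofReal s < G x}.indicator (fun _ => (1 : ℝ≥0∞)) s)) ∂μ :=
        lintegral_congr fun x => h1 (G x)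
    _ = ∫⁻ s in Ioi (0 : ℝ), ∫⁻ x,
        ({s : ℝ | ENNReal.ofReal s < G x}.indicator (fun _ => (1 : ℝ≥0∞)) s) ∂μ :=
        lintegral_lintegral_swap hmeas
    _ = _ := by
        refine lintegral_congr fun s => ?_
        have hn : NullMeasurableSet {x | ENNReal.ofReal s < G x} μ :=
          nullMeasurableSet_lt aemeasurable_const hG
        rw [← lintegral_indicator_one₀ hn]
        rfl

theorem lintegral_rpow_le_of_meas_le {β : Type*} [MeasurableSpace β] {ρ : Measure β}
    {K : β → ℝ≥0∞} [SFinite μ] [SFinite ρ] (hG : AEMeasurable G μ) (hK : AEMeasurable K ρ)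
    {p : ℝ} (hp : 0 < p) (h : ∀ c, μ {x | c < G x} ≤ ρ {x | c < K x}) :
    ∫⁻ x, G x ^ p ∂μ ≤ ∫⁻ x, K x ^ p ∂ρ := by
  rw [lintegral_eq_lintegral_meas_lt (hG.pow_const p),
    lintegral_eq_lintegral_meas_lt (hK.pow_const p)]
  refine lintegral_mono fun s => ?_
  have key : ∀ y : ℝ≥0∞, ENNReal.ofReal s < y ^ p ↔ ENNReal.ofReal s ^ p⁻¹ < y := fun y =>
    (ENNReal.rpow_inv_lt_iff hp).symm
  simp only [key]
  exact h _

/-- A measure `ν ≤ μ` of mass `u` concentrated where `G` is largest. -/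
theorem exists_measure_top_part [IsFiniteMeasure μ] (hG : AEMeasurable G μ) {u : ℝ≥0∞}
    (hu : u ≤ μ univ) :
    ∃ ν : Measure α, ν ≤ μ ∧ ν univ ≤ u ∧ ∀ c, min u (μ {x | c < G x}) ≤ ν {x | c < G x} := by
  have hu' : u ≠ ⊤ := ne_top_of_le_ne_top (measure_ne_top μ univ) hu
  set s := rearr μ G u.toReal with hs
  have hofu : ENNReal.ofReal u.toReal = u := ENNReal.ofReal_toReal hu'
  have hgt : μ {x | s < G x} ≤ u := by
    have := rearr_le_iff.1 (le_refl (rearr μ G u.toReal))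
    rwa [hofu] at this
  have hlt : ∀ c < s, u < μ {x | c < G x} := fun c hc => by
    have := lt_rearr_iff.1 hc
    rwa [hofu] at this
  have hge : u ≤ μ {x | s ≤ G x} := by
    rcases eq_or_ne s 0 with h0 | h0
    · simpa [h0] using hu
    · obtain ⟨v, hv, hv1, hv2⟩ := exists_seq_strictMono_tendsto' (pos_iff_ne_zero.2 h0)
      have hI : {x | s ≤ G x} = ⋂ n, {x | v n < G x} := by
        ext x
        simp only [mem_ofPred_eq, mem_iInter]
        exact ⟨fun hx n => (hv1 n).2.trans_le hx, fun hx => le_of_tendsto' hv2 fun n => (hx n).le⟩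
      have hanti : Antitone fun n => {x | v n < G x} :=
        fun m n hmn x hx => lt_of_le_of_lt (hv.monotone hmn) hx
      rw [hI, hanti.measure_iInter (fun n => nullMeasurableSet_lt aemeasurable_const hG)
        ⟨0, measure_ne_top _ _⟩]
      exact le_iInf fun n => (hlt _ (hv1 n).2).le
  have hnA : NullMeasurableSet {x | s < G x} μ := nullMeasurableSet_lt aemeasurable_const hG
  have hnB : NullMeasurableSet {x | G x = s} μ := nullMeasurableSet_eq_fun hG aemeasurable_const
  have hdisj : Disjoint {x | s < G x} {x | G x = s} :=
    Set.disjoint_left.2 fun x hx hx' => (ne_of_gt hx) hx'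
  have hunion : {x | s < G x} ∪ {x | G x = s} = {x | s ≤ G x} := by
    ext x; simp only [mem_union, mem_ofPred_eq, le_iff_lt_or_eq, eq_comm]
  have hadd : μ {x | s ≤ G x} = μ {x | s < G x} + μ {x | G x = s} := by
    rw [← hunion, measure_union₀ hnB hdisj.aedisjoint]
  set θ := (u - μ {x | s < G x}) / μ {x | G x = s} with hθ
  have hsub : u - μ {x | s < G x} ≤ μ {x | G x = s} := by
    rw [tsub_le_iff_left, ← hadd]; exact hge
  have hθ1 : θ ≤ 1 := ENNReal.div_le_of_le_mul (by simpa using hsub)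
  have hθm : θ * μ {x | G x = s} = u - μ {x | s < G x} := by
    rcases eq_or_ne (μ {x | G x = s}) 0 with h0 | h0
    · rw [h0] at hsub; rw [h0, mul_zero]; exact (nonpos_iff_eq_zero.1 hsub).symm
    · exact ENNReal.div_mul_cancel h0 (measure_ne_top _ _)
  refine ⟨μ.restrict {x | s < G x} + θ • μ.restrict {x | G x = s}, ?_, ?_, ?_⟩
  · calc μ.restrict {x | s < G x} + θ • μ.restrict {x | G x = s}
        ≤ μ.restrict {x | s < G x} + (1 : ℝ≥0∞) • μ.restrict {x | G x = s} := by
          refine Measure.le_iff.2 fun t _ => ?_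
          simp only [Measure.add_apply, Measure.smul_apply, smul_eq_mul]
          gcongr
      _ = μ.restrict {x | s ≤ G x} := by
          rw [one_smul, ← hunion, Measure.restrict_union₀ hdisj.aedisjoint hnB]
      _ ≤ μ := Measure.restrict_le_self
  · simp only [Measure.add_apply, Measure.smul_apply, smul_eq_mul, Measure.restrict_apply_univ]
    rw [hθm, add_tsub_cancel_of_le hgt]
  · intro c
    rcases lt_or_ge c s with hc | hc
    · have i1 : {x | s < G x} ⊆ {x | c < G x} := fun x hx => hc.trans hx
      have i2 : {x | G x = s} ⊆ {x | c < G x} := fun x (hx : G x = s) =>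
        show c < G x from hx ▸ hc
      refine (min_le_left _ _).trans ?_
      simp only [Measure.add_apply, Measure.smul_apply, smul_eq_mul]
      have e1 : μ.restrict {x | s < G x} {x | c < G x} = μ {x | s < G x} := by
        rw [Measure.restrict_apply₀' hnA, inter_eq_right.2 i1]
      have e2 : μ.restrict {x | G x = s} {x | c < G x} = μ {x | G x = s} := by
        rw [Measure.restrict_apply₀' hnB, inter_eq_right.2 i2]
      rw [e1, e2, hθm, add_tsub_cancel_of_le hgt]
    · have i3 : {x | c < G x} ⊆ {x | s < G x} := fun x hx => lt_of_le_of_lt hc hx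
      refine (min_le_right _ _).trans ?_
      rw [Measure.add_apply, Measure.restrict_apply₀' hnA, inter_eq_left.2 i3]
      exact le_self_add

end Rearrangement

section Weighted

variable {α : Type*} [MeasurableSpace α] {μ : Measure α} {F G : α → ℝ≥0∞}

theorem volume_inter_rearr [IsProbabilityMeasure μ] {S : Set ℝ} (hS1 : S ⊆ Ioo 0 1)
    (hS2 : ∀ t ∈ S, ∀ t' ∈ Ioo (0 : ℝ) 1, t' ≤ t → t' ∈ S) (c : ℝ≥0∞) :
    volume ({t | c < rearr μ G t} ∩ S) = min (volume S) (μ {x | c < G x}) := by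
  set d := μ {x | c < G x} with hd
  have hd1 : d ≤ 1 := prob_le_one
  have hdt : d ≠ ⊤ := ne_top_of_le_ne_top ENNReal.one_ne_top hd1
  have hdr : d.toReal ≤ 1 := ENNReal.toReal_le_of_le_ofReal zero_le_one (by simpa using hd1)
  have hset : {t | c < rearr μ G t} ∩ S = S ∩ Ioo 0 d.toReal := by
    ext t
    simp only [mem_inter_iff, mem_ofPred_eq, lt_rearr_iff, mem_Ioo]
    constructor
    · rintro ⟨h, ht⟩
      exact ⟨ht, (hS1 ht).1, (ENNReal.ofReal_lt_iff_lt_toReal (hS1 ht).1.le hdt).1 h⟩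
    · rintro ⟨ht, h0, h⟩
      exact ⟨(ENNReal.ofReal_lt_iff_lt_toReal h0.le hdt).2 h, ht⟩
  have hvol : volume (Ioo 0 d.toReal) = d := by
    rw [Real.volume_Ioo, sub_zero, ENNReal.ofReal_toReal hdt]
  rw [hset]
  by_cases h : S ⊆ Ioo 0 d.toReal
  · rw [inter_eq_left.2 h, min_eq_left]
    exact (measure_mono h).trans hvol.le
  · obtain ⟨t0, ht0, ht0'⟩ := Set.not_subset.1 h
    have h2 : Ioo 0 d.toReal ⊆ S := fun t ht => by
      refine hS2 t0 ht0 t ⟨ht.1, ht.2.trans_le hdr⟩ ?_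
      by_contra! hlt
      exact ht0' ⟨(hS1 ht0).1, hlt.trans ht.2⟩
    rw [inter_eq_right.2 h2, hvol, min_eq_right]
    exact hvol.symm.le.trans (measure_mono h2)

theorem measurable_rearr : Measurable (rearr μ G) := rearr_antitone.measurable

theorem setLIntegral_rearr_add_le [IsProbabilityMeasure μ] (hF : AEMeasurable F μ)
    (hG : AEMeasurable G μ) {p : ℝ} (hp : 1 ≤ p) {S : Set ℝ} (hSm : MeasurableSet S)
    (hS1 : S ⊆ Ioo 0 1) (hS2 : ∀ t ∈ S, ∀ t' ∈ Ioo (0 : ℝ) 1, t' ≤ t → t' ∈ S) :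
    (∫⁻ t in S, rearr μ (fun x => F x + G x) t ^ p) ^ (1 / p) ≤
      (∫⁻ t in S, rearr μ F t ^ p) ^ (1 / p) + (∫⁻ t in S, rearr μ G t ^ p) ^ (1 / p) := by
  have hp0 : 0 < p := by linarith
  have hu : volume S ≤ μ univ := by
    rw [measure_univ]
    exact (measure_mono hS1).trans (by simp)
  obtain ⟨ν, hν1, hν2, hν3⟩ := exists_measure_top_part (μ := μ) (hF.add hG) hu
  have : IsFiniteMeasure ν := ⟨(hν2.trans hu).trans_lt (measure_lt_top μ _)⟩
  have hac : ν ≪ μ := Measure.absolutelyContinuous_of_le hν1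
  have hF' := hF.mono_ac hac
  have hG' := hG.mono_ac hac
  have up : ∀ {H : α → ℝ≥0∞}, AEMeasurable H ν →
      ∫⁻ x, H x ^ p ∂ν ≤ ∫⁻ t in S, rearr μ H t ^ p := fun {H} hH => by
    refine lintegral_rpow_le_of_meas_le hH measurable_rearr.aemeasurable hp0 fun c => ?_
    rw [Measure.restrict_apply' hSm, volume_inter_rearr hS1 hS2]
    exact le_min ((measure_mono (subset_univ _)).trans hν2) (hν1 _)
  have down : ∫⁻ t in S, rearr μ (fun x => F x + G x) t ^ p ≤ ∫⁻ x, (F + G) x ^ p ∂ν := by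
    refine lintegral_rpow_le_of_meas_le measurable_rearr.aemeasurable (hF'.add hG') hp0
      fun c => ?_
    rw [Measure.restrict_apply' hSm, volume_inter_rearr hS1 hS2]
    exact hν3 c
  calc _ ≤ (∫⁻ x, (F + G) x ^ p ∂ν) ^ (1 / p) := by gcongr
    _ ≤ (∫⁻ x, F x ^ p ∂ν) ^ (1 / p) + (∫⁻ x, G x ^ p ∂ν) ^ (1 / p) :=
      ENNReal.lintegral_Lp_add_le hF' hG' hp
    _ ≤ _ := by gcongr <;> first | exact up hF' | exact up hG'

/-- Layer-cake decomposition of an integral against a weight. -/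
theorem lintegral_weight_mul {W : ℝ → ℝ≥0∞} (hW : Measurable W) {H : ℝ → ℝ≥0∞}
    (hH : Measurable H) :
    ∫⁻ t in Ioo (0 : ℝ) 1, W t * H t =
      ∫⁻ s in Ioi (0 : ℝ), ∫⁻ t in Ioo (0 : ℝ) 1 ∩ {t | ENNReal.ofReal s < W t}, H t := by
  have h1 : ∫⁻ t in Ioo (0 : ℝ) 1, W t * H t =
      ∫⁻ t, W t ∂((volume.restrict (Ioo (0 : ℝ) 1)).withDensity H) := by
    rw [lintegral_withDensity_eq_lintegral_mul _ hH hW]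
    simp [mul_comm]
  rw [h1, lintegral_eq_lintegral_meas_lt hW.aemeasurable]
  refine lintegral_congr fun s => ?_
  have hm : MeasurableSet {t | ENNReal.ofReal s < W t} := measurableSet_lt measurable_const hW
  rw [withDensity_apply _ hm, Measure.restrict_restrict hm, inter_comm]

theorem lintegral_weight_rearr_add_le [IsProbabilityMeasure μ] (hF : AEMeasurable F μ)
    (hG : AEMeasurable G μ) {p : ℝ} (hp : 1 ≤ p) {W : ℝ → ℝ≥0∞}
    (hW : AntitoneOn W (Ioo 0 1)) :
    (∫⁻ t in Ioo (0 : ℝ) 1, W t * rearr μ (fun x => F x + G x) t ^ p) ^ (1 / p) ≤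
      (∫⁻ t in Ioo (0 : ℝ) 1, W t * rearr μ F t ^ p) ^ (1 / p) +
        (∫⁻ t in Ioo (0 : ℝ) 1, W t * rearr μ G t ^ p) ^ (1 / p) := by
  classical
  have hp0 : 0 < p := by linarith
  set V : ℝ → ℝ≥0∞ := fun t => if t ≤ 0 then ⊤ else if t < 1 then W t else 0 with hV
  have hVanti : Antitone V := by
    intro a b hab
    simp only [hV]
    split_ifs with h1 h2 h3 h4 h5 h6 <;> first | exact le_top | exact zero_le | skip
    all_goals first
      | exact hW ⟨by linarith, by linarith⟩ ⟨by linarith, by linarith⟩ hab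
      | (exfalso; linarith)
  have hVm : Measurable V := hVanti.measurable
  have hVW : ∀ H : ℝ → ℝ≥0∞, ∫⁻ t in Ioo (0 : ℝ) 1, W t * H t =
      ∫⁻ t in Ioo (0 : ℝ) 1, V t * H t := fun H =>
    setLIntegral_congr_fun measurableSet_Ioo fun t ht => by
      simp [hV, not_le.2 ht.1, ht.2]
  have hm : ∀ K : α → ℝ≥0∞, Measurable fun t => rearr μ K t ^ p := fun K =>
    measurable_rearr.pow_const p
  set S : ℝ → Set ℝ := fun s => Ioo (0 : ℝ) 1 ∩ {t | ENNReal.ofReal s < V t} with hS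
  have hSm : ∀ s, MeasurableSet (S s) := fun s =>
    measurableSet_Ioo.inter (measurableSet_lt measurable_const hVm)
  have hSanti : Antitone S := fun a b hab t ht =>
    ⟨ht.1, lt_of_le_of_lt (ENNReal.ofReal_le_ofReal hab) ht.2⟩
  have hS2 : ∀ s, ∀ t ∈ S s, ∀ t' ∈ Ioo (0 : ℝ) 1, t' ≤ t → t' ∈ S s :=
    fun s t ht t' ht' h => ⟨ht', lt_of_lt_of_le ht.2 (hVanti h)⟩
  have hA : ∀ K : α → ℝ≥0∞, Measurable fun s => (∫⁻ t in S s, rearr μ K t ^ p) ^ (1 / p) :=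
    fun K => Measurable.pow_const (Antitone.measurable fun a b hab =>
      lintegral_mono_set (hSanti hab)) _
  have hrep : ∀ K : α → ℝ≥0∞, ∫⁻ t in Ioo (0 : ℝ) 1, W t * rearr μ K t ^ p =
      ∫⁻ s in Ioi (0 : ℝ), ((∫⁻ t in S s, rearr μ K t ^ p) ^ (1 / p)) ^ p := fun K => by
    rw [hVW, lintegral_weight_mul hVm (hm K)]
    refine lintegral_congr fun s => ?_
    rw [← ENNReal.rpow_mul, one_div_mul_cancel hp0.ne', ENNReal.rpow_one]
  rw [hrep, hrep, hrep]
  refine le_trans ?_ (ENNReal.lintegral_Lp_add_le (hA F).aemeasurable (hA G).aemeasurable hp)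
  gcongr with s
  exact setLIntegral_rearr_add_le hF hG hp (hSm s) inter_subset_left (hS2 s)

end Weighted


/-- Lebesgue measure on `[0,1]`. -/
noncomputable abbrev unitMeasure : Measure ℝ := volume.restrict (Icc (0 : ℝ) 1)

instance : IsProbabilityMeasure unitMeasure := ⟨by simp [unitMeasure]⟩

/-- `‖f‖_{w,p} = (∫_{[0,1]} w(t) f*(t)^p dt)^{1/p}`, as an extended nonnegative real. Only the values
of `w` on `(0,1)` matter. -/
noncomputable def lorentzENorm {𝕜 : Type*} [NormedField 𝕜] (w : ℝ → ℝ) (p : ℝ)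
    (f : ℝ →ₘ[unitMeasure] 𝕜) : ℝ≥0∞ :=
  (∫⁻ t in Ioo (0 : ℝ) 1,
    ENNReal.ofReal (w t) * rearr unitMeasure (fun x => ‖f x‖ₑ) t ^ p) ^ (1 / p)

/-- A Lorentz weight: a positive non-increasing function on `(0,1)`. -/
structure IsLorentzWeight (w : ℝ → ℝ) : Prop where
  pos : ∀ t ∈ Ioo (0 : ℝ) 1, 0 < w t
  antitoneOn : AntitoneOn w (Ioo 0 1)

/-- The regularity of a weight that makes `{f | ‖f‖_{w,p} < ∞}` a linear space. It holds for every
non-increasing weight and for every power weight. -/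
structure IsDoublingWeight (w : ℝ → ℝ) : Prop where
  pos : ∀ t ∈ Ioo (0 : ℝ) 1, 0 < w t
  aemeasurable : AEMeasurable w (volume.restrict (Ioo (0 : ℝ) 1))
  doubling : ∃ C : ℝ, ∀ t ∈ Ioo (0 : ℝ) (1 / 2), w (2 * t) ≤ C * w t

theorem IsLorentzWeight.isDoublingWeight {w : ℝ → ℝ} (hw : IsLorentzWeight w) :
    IsDoublingWeight w where
  pos := hw.pos
  aemeasurable := aemeasurable_restrict_of_antitoneOn measurableSet_Ioo hw.antitoneOn
  doubling := ⟨1, fun t ht => by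
    rw [one_mul]
    exact hw.antitoneOn ⟨ht.1, by linarith [ht.2]⟩ ⟨by linarith [ht.1], by linarith [ht.2]⟩
      (by linarith [ht.1])⟩

/-- The weight `(q/p) t^{q/p-1}` of `L_{p,q}`. -/
noncomputable def lpqWeight (p q : ℝ) (t : ℝ) : ℝ := q / p * t ^ (q / p - 1)

theorem isDoublingWeight_lpqWeight {p q : ℝ} (hp : 1 < p) (hq : 1 < q) :
    IsDoublingWeight (lpqWeight p q) where
  pos := fun t ht => by
    have := ht.1
    unfold lpqWeight
    positivity
  aemeasurable := ((measurable_id.pow_const _).const_mul _).aemeasurable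
  doubling := ⟨2 ^ (q / p - 1), fun t ht => by
    unfold lpqWeight
    rw [Real.mul_rpow zero_le_two ht.1.le]
    exact le_of_eq (by ring)⟩

section Space

variable {𝕜 : Type*} [RCLike 𝕜] {w : ℝ → ℝ} {p : ℝ}

theorem aemeasurable_enorm (f : ℝ →ₘ[unitMeasure] 𝕜) :
    AEMeasurable (fun x => ‖f x‖ₑ) unitMeasure := f.aestronglyMeasurable.enorm

theorem rearr_enorm_add_le (f g : ℝ →ₘ[unitMeasure] 𝕜) (t : ℝ) :
    rearr unitMeasure (fun x => ‖(f + g) x‖ₑ) t ≤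
      rearr unitMeasure (fun x => ‖f x‖ₑ + ‖g x‖ₑ) t :=
  rearr_mono ((AEEqFun.coeFn_add f g).mono fun x hx => by
    simp only [hx, Pi.add_apply]
    exact enorm_add_le _ _) t

theorem lorentzENorm_zero (hp : 0 < p) :
    lorentzENorm w p (0 : ℝ →ₘ[unitMeasure] 𝕜) = 0 := by
  have h0 : ∀ t, rearr unitMeasure (fun x => ‖(0 : ℝ →ₘ[unitMeasure] 𝕜) x‖ₑ) t = 0 := fun t => by
    have h : (fun x => ‖(0 : ℝ →ₘ[unitMeasure] 𝕜) x‖ₑ) =ᵐ[unitMeasure] fun _ => 0 :=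
      (AEEqFun.coeFn_zero (β := 𝕜)).mono fun x hx => by simp [hx]
    rw [rearr_congr h, ← nonpos_iff_eq_zero, rearr_le_iff]
    simp
  have h1 : ∀ t, ENNReal.ofReal (w t) *
      rearr unitMeasure (fun x => ‖(0 : ℝ →ₘ[unitMeasure] 𝕜) x‖ₑ) t ^ p = 0 := fun t => by
    rw [h0, ENNReal.zero_rpow_of_pos hp, mul_zero]
  unfold lorentzENorm
  rw [lintegral_congr h1, lintegral_zero, ENNReal.zero_rpow_of_pos (by positivity)]

theorem lorentzENorm_smul (hp : 0 < p) (c : 𝕜) (f : ℝ →ₘ[unitMeasure] 𝕜) :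
    lorentzENorm w p (c • f) = ‖c‖ₑ * lorentzENorm w p f := by
  rcases eq_or_ne c 0 with rfl | hc
  · have h0 : (0 : 𝕜) • f = 0 := zero_smul 𝕜 f
    rw [h0, lorentzENorm_zero hp, enorm_zero, zero_mul]
  have h : (fun x => ‖(c • f) x‖ₑ) =ᵐ[unitMeasure] fun x => ‖c‖ₑ * ‖f x‖ₑ :=
    (AEEqFun.coeFn_smul c f).mono fun x hx => by
      simp only [hx, Pi.smul_apply, smul_eq_mul, enorm_mul]
  have hct : ‖c‖ₑ ^ p ≠ ⊤ := ENNReal.rpow_ne_top_of_nonneg hp.le enorm_ne_top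
  unfold lorentzENorm
  rw [rearr_congr h]
  simp only [rearr_const_mul (enorm_ne_zero.2 hc) enorm_ne_top, ENNReal.mul_rpow_of_nonneg _ _ hp.le,
    mul_left_comm _ (‖c‖ₑ ^ p)]
  rw [lintegral_const_mul' _ _ hct, ENNReal.mul_rpow_of_nonneg _ _ (by positivity),
    ← ENNReal.rpow_mul, mul_one_div_cancel hp.ne', ENNReal.rpow_one]

theorem lorentzENorm_add_le (hw : IsLorentzWeight w) (hp : 1 ≤ p) (f g : ℝ →ₘ[unitMeasure] 𝕜) :
    lorentzENorm w p (f + g) ≤ lorentzENorm w p f + lorentzENorm w p g := by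
  have hW : AntitoneOn (fun t => ENNReal.ofReal (w t)) (Ioo 0 1) := fun a ha b hb hab =>
    ENNReal.ofReal_le_ofReal (hw.antitoneOn ha hb hab)
  refine le_trans ?_ (lintegral_weight_rearr_add_le (aemeasurable_enorm f) (aemeasurable_enorm g)
    hp hW)
  unfold lorentzENorm
  have : 0 < p := by linarith
  gcongr with t
  exact rearr_enorm_add_le f g t

theorem lorentzENorm_lt_top_iff (hp : 0 < p) (f : ℝ →ₘ[unitMeasure] 𝕜) :
    lorentzENorm w p f < ⊤ ↔ ∫⁻ t in Ioo (0 : ℝ) 1,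
      ENNReal.ofReal (w t) * rearr unitMeasure (fun x => ‖f x‖ₑ) t ^ p < ⊤ :=
  ENNReal.rpow_lt_top_iff_of_pos (by positivity)

theorem lintegral_weight_rearr_half_lt_top (hw : IsDoublingWeight w) (hp : 0 < p)
    {f : ℝ →ₘ[unitMeasure] 𝕜} (hf : lorentzENorm w p f < ⊤) :
    ∫⁻ t in Ioo (0 : ℝ) 1,
      ENNReal.ofReal (w t) * rearr unitMeasure (fun x => ‖f x‖ₑ) (t / 2) ^ p < ⊤ := by
  obtain ⟨C, hC⟩ := hw.doubling
  rw [lorentzENorm_lt_top_iff hp] at hf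
  set R := rearr unitMeasure (fun x => ‖f x‖ₑ) with hR
  have himg : (fun s : ℝ => 2 * s) '' Ioo (0 : ℝ) (1 / 2) = Ioo 0 1 := by
    rw [Set.image_mul_left_Ioo two_pos]; norm_num
  have hd : ∀ x ∈ Ioo (0 : ℝ) (1 / 2),
      HasDerivWithinAt (fun s : ℝ => 2 * s) 2 (Ioo (0 : ℝ) (1 / 2)) x := fun x _ => by
    simpa using ((hasDerivAt_id x).const_mul (2 : ℝ)).hasDerivWithinAt
  have hinj : InjOn (fun s : ℝ => 2 * s) (Ioo (0 : ℝ) (1 / 2)) := fun a _ b _ h => by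
    simpa using h
  rw [← himg, lintegral_image_eq_lintegral_abs_deriv_mul measurableSet_Ioo hd hinj]
  have hfin : ENNReal.ofReal 2 * ENNReal.ofReal C ≠ ⊤ :=
    ENNReal.mul_ne_top ENNReal.ofReal_ne_top ENNReal.ofReal_ne_top
  calc _ ≤ ∫⁻ x in Ioo (0 : ℝ) (1 / 2), (ENNReal.ofReal 2 * ENNReal.ofReal C) *
          (ENNReal.ofReal (w x) * R x ^ p) := by
        refine setLIntegral_mono' measurableSet_Ioo fun x hx => ?_
        have h2 : (2 * x) / 2 = x := by ring
        rw [h2, abs_two, mul_assoc (ENNReal.ofReal 2), ← mul_assoc (ENNReal.ofReal C),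
          ← ENNReal.ofReal_mul' (hw.pos x ⟨hx.1, by linarith [hx.2]⟩).le]
        gcongr
        exact hC x hx
    _ = (ENNReal.ofReal 2 * ENNReal.ofReal C) *
          ∫⁻ x in Ioo (0 : ℝ) (1 / 2), ENNReal.ofReal (w x) * R x ^ p :=
        lintegral_const_mul' _ _ hfin
    _ ≤ (ENNReal.ofReal 2 * ENNReal.ofReal C) *
          ∫⁻ x in Ioo (0 : ℝ) 1, ENNReal.ofReal (w x) * R x ^ p := by
        exact mul_le_mul_right (lintegral_mono_set (Ioo_subset_Ioo_right (by norm_num))) _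
    _ < ⊤ := ENNReal.mul_lt_top hfin.lt_top hf

theorem lorentzENorm_add_lt_top (hw : IsDoublingWeight w) (hp : 0 < p)
    {f g : ℝ →ₘ[unitMeasure] 𝕜} (hf : lorentzENorm w p f < ⊤) (hg : lorentzENorm w p g < ⊤) :
    lorentzENorm w p (f + g) < ⊤ := by
  rw [lorentzENorm_lt_top_iff hp]
  have hf' := lintegral_weight_rearr_half_lt_top hw hp hf
  have hg' := lintegral_weight_rearr_half_lt_top hw hp hg
  set R := rearr unitMeasure (fun x => ‖f x‖ₑ) with hR
  set Q := rearr unitMeasure (fun x => ‖g x‖ₑ) with hQ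
  have h2 : (2 : ℝ≥0∞) ^ p ≠ ⊤ := ENNReal.rpow_ne_top_of_nonneg hp.le (by norm_num)
  have hpow : ∀ a b : ℝ≥0∞, (a + b) ^ p ≤ 2 ^ p * (a ^ p + b ^ p) := fun a b => by
    calc (a + b) ^ p ≤ (2 * max a b) ^ p := by
          gcongr
          rw [two_mul]
          exact add_le_add (le_max_left _ _) (le_max_right _ _)
      _ = 2 ^ p * max a b ^ p := ENNReal.mul_rpow_of_nonneg _ _ hp.le
      _ ≤ 2 ^ p * (a ^ p + b ^ p) := by
          gcongr
          rcases max_choice a b with h | h <;> rw [h]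
          · exact le_self_add
          · exact le_add_self
  have hmeas : AEMeasurable (fun t => ENNReal.ofReal (w t) * R (t / 2) ^ p)
      (volume.restrict (Ioo (0 : ℝ) 1)) :=
    hw.aemeasurable.ennreal_ofReal.mul
      ((measurable_rearr.comp (measurable_id.div_const 2)).pow_const p).aemeasurable
  calc _ ≤ ∫⁻ t in Ioo (0 : ℝ) 1, 2 ^ p * (ENNReal.ofReal (w t) * R (t / 2) ^ p +
          ENNReal.ofReal (w t) * Q (t / 2) ^ p) := by
        refine setLIntegral_mono' measurableSet_Ioo fun t ht => ?_
        rw [← mul_add, mul_left_comm]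
        gcongr
        refine le_trans ?_ (hpow _ _)
        gcongr
        exact (rearr_enorm_add_le f g t).trans (rearr_add_le t ht.1.le)
    _ = 2 ^ p * ((∫⁻ t in Ioo (0 : ℝ) 1, ENNReal.ofReal (w t) * R (t / 2) ^ p) +
          ∫⁻ t in Ioo (0 : ℝ) 1, ENNReal.ofReal (w t) * Q (t / 2) ^ p) := by
        rw [lintegral_const_mul' _ _ h2, lintegral_add_left' hmeas]
    _ < ⊤ := ENNReal.mul_lt_top h2.lt_top (ENNReal.add_lt_top.2 ⟨hf', hg'⟩)

theorem eq_zero_of_lorentzENorm_eq_zero (hw : IsDoublingWeight w) (hp : 0 < p)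
    {f : ℝ →ₘ[unitMeasure] 𝕜} (hf : lorentzENorm w p f = 0) : f = 0 := by
  have hm : AEMeasurable (fun t => ENNReal.ofReal (w t) *
      rearr unitMeasure (fun x => ‖f x‖ₑ) t ^ p) (volume.restrict (Ioo (0 : ℝ) 1)) :=
    hw.aemeasurable.ennreal_ofReal.mul (measurable_rearr.pow_const p).aemeasurable
  rw [lorentzENorm, ENNReal.rpow_eq_zero_iff_of_pos (by positivity), lintegral_eq_zero_iff' hm,
    Filter.EventuallyEq, ae_restrict_iff' measurableSet_Ioo] at hf
  have h0 : unitMeasure {x | 0 < ‖f x‖ₑ} = 0 := by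
    by_contra hne
    set d := unitMeasure {x | 0 < ‖f x‖ₑ} with hd
    have hdt : d ≠ ⊤ := measure_ne_top _ _
    have hd1 : d.toReal ≤ 1 :=
      ENNReal.toReal_le_of_le_ofReal zero_le_one (by simpa using prob_le_one)
    have hd0 : 0 < d.toReal := ENNReal.toReal_pos hne hdt
    have hnull : volume (Ioo 0 d.toReal) = 0 := by
      refine measure_mono_null (fun t ht => ?_) hf
      intro hcon
      have ht1 : t ∈ Ioo (0 : ℝ) 1 := ⟨ht.1, ht.2.trans_le hd1⟩
      have hz := hcon ht1
      have hr : 0 < rearr unitMeasure (fun x => ‖f x‖ₑ) t :=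
        lt_rearr_iff.2 ((ENNReal.ofReal_lt_iff_lt_toReal ht.1.le hdt).2 ht.2)
      simp only [Pi.zero_apply, mul_eq_zero, ENNReal.ofReal_eq_zero,
        ENNReal.rpow_eq_zero_iff_of_pos hp] at hz
      rcases hz with hz | hz
      · exact absurd (hw.pos t ht1) (not_lt.2 hz)
      · exact hr.ne' hz
    rw [Real.volume_Ioo, sub_zero, ENNReal.ofReal_toReal hdt] at hnull
    exact hne hnull
  refine AEEqFun.ext (Filter.EventuallyEq.trans ?_ (AEEqFun.coeFn_zero (β := 𝕜)).symm)
  refine (measure_eq_zero_iff_ae_notMem.1 h0).mono fun x hx => ?_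
  have : ‖f x‖ₑ = 0 := by simpa using hx
  simpa using this

end Space

/-- The linear space of (classes of) measurable functions on `[0,1]` with `‖f‖_{w,p} < ∞`. -/
def lorentzSubmodule (𝕜 : Type*) [RCLike 𝕜] (w : ℝ → ℝ) (p : ℝ) (hw : IsDoublingWeight w)
    (hp : 0 < p) : Submodule 𝕜 (ℝ →ₘ[unitMeasure] 𝕜) where
  carrier := {f | lorentzENorm w p f < ⊤}
  add_mem' := fun hf hg => lorentzENorm_add_lt_top hw hp hf hg
  zero_mem' := by simp [lorentzENorm_zero hp]
  smul_mem' := fun c f hf => by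
    simp only [mem_ofPred_eq, lorentzENorm_smul hp] at hf ⊢
    exact ENNReal.mul_lt_top enorm_lt_top hf

/-- The Lorentz space `L_{w,p}` on `[0,1]`, for a non-increasing weight `w` and `1 ≤ p < ∞`. -/
def LorentzSpace (𝕜 : Type*) [RCLike 𝕜] (w : ℝ → ℝ) (p : ℝ) (hw : IsLorentzWeight w)
    (hp : 1 ≤ p) : Type _ :=
  lorentzSubmodule 𝕜 w p hw.isDoublingWeight (zero_lt_one.trans_le hp)

section Normed

variable {𝕜 : Type*} [RCLike 𝕜] {w : ℝ → ℝ} {p : ℝ} {hw : IsLorentzWeight w} {hp : 1 ≤ p}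

noncomputable instance : AddCommGroup (LorentzSpace 𝕜 w p hw hp) :=
  inferInstanceAs (AddCommGroup
    (lorentzSubmodule 𝕜 w p hw.isDoublingWeight (zero_lt_one.trans_le hp)))

noncomputable instance : Module 𝕜 (LorentzSpace 𝕜 w p hw hp) :=
  inferInstanceAs (Module 𝕜
    (lorentzSubmodule 𝕜 w p hw.isDoublingWeight (zero_lt_one.trans_le hp)))

noncomputable instance : Norm (LorentzSpace 𝕜 w p hw hp) where
  norm f := (lorentzENorm w p f.1).toReal

theorem LorentzSpace.normedSpaceCore : NormedSpace.Core 𝕜 (LorentzSpace 𝕜 w p hw hp) where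
  norm_nonneg _ := ENNReal.toReal_nonneg
  norm_smul c f := by
    have h : lorentzENorm w p (c • f.1) = ‖c‖ₑ * lorentzENorm w p f.1 :=
      lorentzENorm_smul (zero_lt_one.trans_le hp) c f.1
    change (lorentzENorm w p (c • f.1)).toReal = ‖c‖ * (lorentzENorm w p f.1).toReal
    rw [h, ENNReal.toReal_mul, toReal_enorm]
  norm_triangle f g := by
    have h := lorentzENorm_add_le hw hp f.1 g.1
    change (lorentzENorm w p (f.1 + g.1)).toReal ≤
      (lorentzENorm w p f.1).toReal + (lorentzENorm w p g.1).toReal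
    rw [← ENNReal.toReal_add (ne_of_lt f.2) (ne_of_lt g.2)]
    exact ENNReal.toReal_mono (ENNReal.add_ne_top.2 ⟨ne_of_lt f.2, ne_of_lt g.2⟩) h
  norm_eq_zero_iff f := by
    change (lorentzENorm w p f.1).toReal = 0 ↔ f = 0
    rw [ENNReal.toReal_eq_zero_iff, or_iff_left (ne_of_lt f.2)]
    constructor
    · intro h
      exact Subtype.ext (eq_zero_of_lorentzENorm_eq_zero hw.isDoublingWeight
        (zero_lt_one.trans_le hp) h)
    · rintro rfl
      exact lorentzENorm_zero (zero_lt_one.trans_le hp)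

noncomputable instance : NormedAddCommGroup (LorentzSpace 𝕜 w p hw hp) :=
  NormedAddCommGroup.ofCore LorentzSpace.normedSpaceCore

noncomputable instance : NormedSpace 𝕜 (LorentzSpace 𝕜 w p hw hp) :=
  NormedSpace.ofCore LorentzSpace.normedSpaceCore

end Normed

/-- The space `L_{p,q}` on `[0,1]`, `1 < p, q < ∞`: all `f` with
`‖f‖_{p,q} = ((q/p) ∫_0^1 t^{q/p-1} f*(t)^q dt)^{1/q} < ∞`. It carries no topology here, since
`‖·‖_{p,q}` is in general only a quasi-norm. -/
def LpqSpace (𝕜 : Type*) [RCLike 𝕜] (p q : ℝ) (hp : 1 < p) (hq : 1 < q) : Type _ :=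
  lorentzSubmodule 𝕜 (lpqWeight p q) q (isDoublingWeight_lpqWeight hp hq) (zero_lt_one.trans hq)

noncomputable instance {𝕜 : Type*} [RCLike 𝕜] {p q : ℝ} {hp : 1 < p} {hq : 1 < q} :
    AddCommGroup (LpqSpace 𝕜 p q hp hq) :=
  inferInstanceAs (AddCommGroup (lorentzSubmodule 𝕜 (lpqWeight p q) q
    (isDoublingWeight_lpqWeight hp hq) (zero_lt_one.trans hq)))

noncomputable instance {𝕜 : Type*} [RCLike 𝕜] {p q : ℝ} {hp : 1 < p} {hq : 1 < q} :
    Module 𝕜 (LpqSpace 𝕜 p q hp hq) :=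
  inferInstanceAs (Module 𝕜 (lorentzSubmodule 𝕜 (lpqWeight p q) q
    (isDoublingWeight_lpqWeight hp hq) (zero_lt_one.trans hq)))

/-- The functional `‖·‖_{p,q}` on `L_{p,q}`. -/
noncomputable def lpqNorm {𝕜 : Type*} [RCLike 𝕜] {p q : ℝ} {hp : 1 < p} {hq : 1 < q}
    (f : LpqSpace 𝕜 p q hp hq) : ℝ :=
  (lorentzENorm (lpqWeight p q) q f.1).toReal

/-- `ν` is a norm equivalent to `‖·‖_{p,q}` on `L_{p,q}`. -/
def IsEquivalentNorm {𝕜 : Type*} [RCLike 𝕜] {p q : ℝ} {hp : 1 < p} {hq : 1 < q}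
    (ν : Seminorm 𝕜 (LpqSpace 𝕜 p q hp hq)) : Prop :=
  ∃ c C : ℝ, 0 < c ∧ ∀ f, c * lpqNorm f ≤ ν f ∧ ν f ≤ C * lpqNorm f


end Lorentz

/-! Part (1) is a quantitative failure of contractivity in a lattice with a lower `q`-estimate, `q <
2`. Because the weight decreases, `‖f‖_{w,p}^p` is the `L_{w,1}` norm of `|f|^p`, so `L_{w,p}` has
an upper `p`-estimate and its dual a lower `q`-estimate for the conjugate `q` (`lower_estimate`).
Let `e` be a unit vector of `ker P` and `Q = 1 - P`, which has finite rank. On an atomless space a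
Lyapunov argument (`exists_halving`, `exists_small_part`) produces, for `t = 2^{-n}`, a restriction
`y` of `e` to a set with `‖y‖^q ≤ t` and `Q y ≈ t e`. Then `P y ≈ y - t e`, and the lower estimate
on the set and its complement gives `‖y - t e‖ ≥ κ ‖y‖`, where `κ^q = (1 - t)^q + t^q (t^{-1/q} -
1)^q`. The first term loses at most `q t`, the second gains about `t^{q-1}`, so `κ > 1` for small
`t`. As `Q y ≈ t e` keeps `‖y‖` away from zero, the errors vanish in the limit and `‖P‖ ≥ κ`; only
`q` and `n` enter `κ`.

Part (2) is a renorming (`exists_seminorm_le_of_isProj`). Hardy's inequality makes `‖f**‖_{p,q}` an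
equivalent lattice norm on `L_{p,q}`, and the space is separable. Take disjoint multiples `u n` of
dyadic indicators, of norm `1/2`, whose `N`-term sums have norm `O(N^{1/q}) = o(N)`; a finite-rank
operator therefore sends `u n` to `0`, and `P (u n) ≈ u n`. The new norm is the maximum of the old
one and `sup |φ n|`, where `φ n` sees `u n` with value `9/8` and subtracts a functional that norms
the `n`-th term of a dense sequence, cut off to the right of the `n`-th dyadic interval. If that
term is close to a unit vector `e` of `ker P`, then adding `e/4` to `u n` lowers the norm from at
least `9/8` to about `1`, while `P (u n + e/4) = P (u n) ≈ u n`. Hence `‖P‖ ≥ 9/8`. -/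

open Filter Topology

/-! ### Lower estimates and absolute continuity for functionals -/

/-- A Boolean algebra of band projections `M A` (multiplication by the indicator of `A`) on a normed
space, satisfying an upper `p`-estimate and order continuity with respect to `μ`. -/
structure BandProjections {α : Type*} [MeasurableSpace α] (μ : Measure α) (p : ℝ)
    {𝕜 X : Type*} [RCLike 𝕜] [NormedAddCommGroup X] [NormedSpace 𝕜 X]
    (M : Set α → X →L[𝕜] X) : Prop where
  univ : M univ = 1
  inter : ∀ {A B : Set α}, MeasurableSet A → MeasurableSet B → ∀ x, M A (M B x) = M (A ∩ B) x
  union : ∀ {A B : Set α}, MeasurableSet A → MeasurableSet B → Disjoint A B →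
    ∀ x, M (A ∪ B) x = M A x + M B x
  upper : ∀ {A : Set α}, MeasurableSet A → ∀ x y,
    ‖M A x + M Aᶜ y‖ ^ p ≤ ‖x‖ ^ p + ‖y‖ ^ p
  tendsto : ∀ {A : ℕ → Set α}, (∀ n, MeasurableSet (A n)) → Antitone A → μ (⋂ n, A n) = 0 →
    ∀ x, Tendsto (fun n => M (A n) x) atTop (𝓝 0)

namespace BandProjections

variable {α : Type*} [MeasurableSpace α] {μ : Measure α} {p q : ℝ}
  {𝕜 X : Type*} [RCLike 𝕜] [NormedAddCommGroup X] [NormedSpace 𝕜 X]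
  {M : Set α → X →L[𝕜] X} {A B : Set α}

theorem norm_apply_le (hM : BandProjections μ p M) (hp : 0 < p) (hA : MeasurableSet A) (x : X) :
    ‖M A x‖ ≤ ‖x‖ := by
  have h := hM.upper hA x 0
  rw [map_zero, add_zero, norm_zero, Real.zero_rpow hp.ne', add_zero] at h
  exact (Real.rpow_le_rpow_iff (norm_nonneg _) (norm_nonneg _) hp).1 h

theorem comp_union (hM : BandProjections μ p M) (hA : MeasurableSet A) (hB : MeasurableSet B)
    (hd : Disjoint A B) (e : StrongDual 𝕜 X) :
    e.comp (M (A ∪ B)) = e.comp (M A) + e.comp (M B) := by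
  ext x
  simp [hM.union hA hB hd]

theorem comp_empty (hM : BandProjections μ p M) (e : StrongDual 𝕜 X) :
    e.comp (M ∅) = 0 := by
  have := hM.comp_union MeasurableSet.empty MeasurableSet.empty (disjoint_empty ∅) e
  simpa using this

theorem norm_comp_mono (hM : BandProjections μ p M) (hp : 0 < p) (hA : MeasurableSet A)
    (hB : MeasurableSet B) (h : A ⊆ B) (e : StrongDual 𝕜 X) :
    ‖e.comp (M A)‖ ≤ ‖e.comp (M B)‖ := by
  refine ContinuousLinearMap.opNorm_le_bound _ (norm_nonneg _) fun x => ?_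
  have h1 : e.comp (M A) x = e.comp (M B) (M A x) := by
    simp [hM.inter hB hA, inter_eq_right.2 h]
  rw [h1]
  exact (ContinuousLinearMap.le_opNorm _ _).trans
    (mul_le_mul_of_nonneg_left (hM.norm_apply_le hp hA x) (norm_nonneg _))

theorem norm_comp_le (hM : BandProjections μ p M) (hp : 0 < p) (hA : MeasurableSet A)
    (e : StrongDual 𝕜 X) : ‖e.comp (M A)‖ ≤ ‖e‖ := by
  have := hM.norm_comp_mono hp hA MeasurableSet.univ (subset_univ A) e
  rw [hM.univ] at this
  exact this

/-- Duality: `e` is tested on a sum of two vectors carried by `A` and `B`, nearly norming for the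
two restrictions, scaled by `s` and `r` and rotated so that both values are nonnegative. The upper
`p`-estimate bounds the norm of the sum. -/
theorem mul_norm_add_mul_norm_le (hM : BandProjections μ p M) (hp : 0 < p)
    (hA : MeasurableSet A) (hB : MeasurableSet B) (hd : Disjoint A B) (e : StrongDual 𝕜 X)
    {s r : ℝ} (hs : 0 ≤ s) (hr : 0 ≤ r) :
    s * ‖e.comp (M A)‖ + r * ‖e.comp (M B)‖ ≤
      ‖e.comp (M (A ∪ B))‖ * (s ^ p + r ^ p) ^ (1 / p) := by
  have hBA : B ⊆ Aᶜ := fun x hx hx' => disjoint_left.1 hd hx' hx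
  have key : ∀ x y : X, ‖x‖ < 1 → ‖y‖ < 1 → s * ‖e.comp (M A) x‖ + r * ‖e.comp (M B) y‖ ≤
      ‖e.comp (M (A ∪ B))‖ * (s ^ p + r ^ p) ^ (1 / p) := by
    intro x y hx hy
    obtain ⟨σ, hσ, hσx⟩ := RCLike.exists_norm_eq_mul_self (e.comp (M A) x)
    obtain ⟨τ, hτ, hτy⟩ := RCLike.exists_norm_eq_mul_self (e.comp (M B) y)
    set x' : X := ((s : 𝕜) * σ) • x with hx'
    set y' : X := ((r : 𝕜) * τ) • y with hy'
    have nx : ‖x'‖ ≤ s := by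
      rw [hx', norm_smul, norm_mul, hσ, RCLike.norm_ofReal, abs_of_nonneg hs]
      nlinarith
    have ny : ‖M B y'‖ ≤ r := by
      refine (hM.norm_apply_le hp hB _).trans ?_
      rw [hy', norm_smul, norm_mul, hτ, RCLike.norm_ofReal, abs_of_nonneg hr]
      nlinarith
    -- Passing through `Aᶜ` gives the shape required by `upper`; as `B ⊆ Aᶜ`, the second summand is
    -- just `M B y'`.
    set z := M A x' + M Aᶜ (M B y') with hz
    have hz1 : z = M A x' + M B y' := by
      rw [hz, hM.inter hA.compl hB, inter_eq_right.2 hBA]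
    have hz2 : M (A ∪ B) z = z := by
      rw [hz1, map_add, hM.inter (hA.union hB) hA, hM.inter (hA.union hB) hB,
        inter_eq_right.2 subset_union_left, inter_eq_right.2 subset_union_right]
    have nz : ‖z‖ ≤ (s ^ p + r ^ p) ^ (1 / p) := by
      have h1 : ‖z‖ ^ p ≤ s ^ p + r ^ p :=
        (hM.upper hA x' (M B y')).trans (add_le_add
          (Real.rpow_le_rpow (norm_nonneg _) nx hp.le) (Real.rpow_le_rpow (norm_nonneg _) ny hp.le))
      calc ‖z‖ = (‖z‖ ^ p) ^ (1 / p) := by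
            rw [← Real.rpow_mul (norm_nonneg _), mul_one_div_cancel hp.ne', Real.rpow_one]
        _ ≤ _ := Real.rpow_le_rpow (by positivity) h1 (by positivity)
    have he : e.comp (M (A ∪ B)) z =
        ((s * ‖e.comp (M A) x‖ + r * ‖e.comp (M B) y‖ : ℝ) : 𝕜) := by
      rw [RCLike.ofReal_add, RCLike.ofReal_mul, RCLike.ofReal_mul, hσx, hτy,
        ContinuousLinearMap.comp_apply, hz2, hz1, map_add, hx', hy']
      simp only [map_smul, smul_eq_mul, ContinuousLinearMap.comp_apply]
      ring
    calc s * ‖e.comp (M A) x‖ + r * ‖e.comp (M B) y‖ = ‖e.comp (M (A ∪ B)) z‖ := by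
          rw [he, RCLike.norm_ofReal, abs_of_nonneg (by positivity)]
      _ ≤ ‖e.comp (M (A ∪ B))‖ * ‖z‖ := ContinuousLinearMap.le_opNorm _ _
      _ ≤ _ := mul_le_mul_of_nonneg_left nz (norm_nonneg _)
  refine le_of_forall_pos_le_add fun δ hδ => ?_
  have hε : 0 < δ / (s + r + 1) := by positivity
  set ε := δ / (s + r + 1) with hεd
  have hδε : ε * (s + r + 1) = δ := by rw [hεd]; field_simp
  have ex : ∀ f : StrongDual 𝕜 X, ∃ x, ‖x‖ < 1 ∧ ‖f‖ - ε ≤ ‖f x‖ := fun f => by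
    obtain ⟨x, hx, hx'⟩ := f.exists_lt_apply_of_lt_opNorm (sub_lt_self ‖f‖ hε)
    exact ⟨x, hx, hx'.le⟩
  obtain ⟨x, hx, hx'⟩ := ex (e.comp (M A))
  obtain ⟨y, hy, hy'⟩ := ex (e.comp (M B))
  have := key x y hx hy
  nlinarith [mul_le_mul_of_nonneg_left hx' hs, mul_le_mul_of_nonneg_left hy' hr]

/-- The dual of a space with an upper `p`-estimate has a lower estimate for the conjugate exponent. -/
theorem lower_estimate (hM : BandProjections μ p M) (hpq : p.HolderConjugate q)
    (hA : MeasurableSet A) (hB : MeasurableSet B) (hd : Disjoint A B) (e : StrongDual 𝕜 X) :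
    ‖e.comp (M A)‖ ^ q + ‖e.comp (M B)‖ ^ q ≤ ‖e.comp (M (A ∪ B))‖ ^ q := by
  set a := ‖e.comp (M A)‖
  set b := ‖e.comp (M B)‖
  set c := ‖e.comp (M (A ∪ B))‖
  have ha : 0 ≤ a := norm_nonneg _
  have hb : 0 ≤ b := norm_nonneg _
  have hc : 0 ≤ c := norm_nonneg _
  have hp := hpq.pos
  have hq := hpq.symm.pos
  have e1 : ∀ x : ℝ, 0 ≤ x → x ^ (q - 1) * x = x ^ q := fun x hx => by
    rcases hx.eq_or_lt with rfl | h
    · rw [mul_zero, Real.zero_rpow hq.ne']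
    · rw [← Real.rpow_add_one h.ne', sub_add_cancel]
  have e2 : ∀ x : ℝ, 0 ≤ x → (x ^ (q - 1)) ^ p = x ^ q := fun x hx => by
    rw [← Real.rpow_mul hx, hpq.symm.sub_one_mul_conj]
  -- The equality case of Hölder: the left side becomes `S = a^q + b^q` and the right side `c *
  -- S^{1/p}`.
  have h := hM.mul_norm_add_mul_norm_le hp hA hB hd e (s := a ^ (q - 1)) (r := b ^ (q - 1))
    (by positivity) (by positivity)
  rw [e1 a ha, e1 b hb, e2 a ha, e2 b hb] at h
  have hS : 0 ≤ a ^ q + b ^ q := by positivity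
  set S := a ^ q + b ^ q
  rcases hS.eq_or_lt with h0 | h0
  · rw [← h0]; positivity
  have h1 : S ^ (1 / q) ≤ c := by
    have h2 : S = S ^ (1 / q) * S ^ (1 / p) := by
      rw [← Real.rpow_add h0, one_div, one_div, hpq.symm.inv_add_inv_eq_one, Real.rpow_one]
    have h3 : 0 < S ^ (1 / p) := by positivity
    refine le_of_mul_le_mul_right ?_ h3
    rw [← h2]
    exact h
  calc S = (S ^ (1 / q)) ^ q := by
        rw [← Real.rpow_mul hS, one_div_mul_cancel hq.ne', Real.rpow_one]
    _ ≤ c ^ q := Real.rpow_le_rpow (by positivity) h1 hq.le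

/-- A gliding hump: order continuity on vectors only gives pointwise convergence, but if the norms
stayed above `δ` then infinitely many disjoint differences `A n \ A m` would each carry norm at
least `δ`. By the lower `q`-estimate `k` of them force `k δ^q ≤ ‖e‖^q`. -/
theorem tendsto_norm_comp (hM : BandProjections μ p M) (hpq : p.HolderConjugate q)
    {A : ℕ → Set α} (hA : ∀ n, MeasurableSet (A n)) (hanti : Antitone A)
    (h0 : μ (⋂ n, A n) = 0) (e : StrongDual 𝕜 X) {δ : ℝ} (hδ : 0 < δ) :
    ∃ n, ‖e.comp (M (A n))‖ ≤ δ := by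
  by_contra! hcon
  have hp := hpq.pos
  have hq := hpq.symm.pos
  have step : ∀ n, ∃ m, n ≤ m ∧ δ ≤ ‖e.comp (M (A n \ A m))‖ := fun n => by
    obtain ⟨x, hx, hx'⟩ := (e.comp (M (A n))).exists_lt_apply_of_lt_opNorm (hcon n)
    have ht : Tendsto (fun m => ‖e (M (A n) x) - e (M (A m) x)‖) atTop (𝓝 ‖e (M (A n) x)‖) := by
      have := (e.continuous.tendsto 0).comp (hM.tendsto hA hanti h0 x)
      rw [map_zero] at this
      have h := ((tendsto_const_nhds (x := e (M (A n) x))).sub this).norm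
      rw [sub_zero] at h
      exact h
    obtain ⟨m, hm, hnm⟩ := ((ht.eventually_const_lt hx').and (eventually_ge_atTop n)).exists
    refine ⟨m, hnm, ?_⟩
    have hu := hM.union (hA m) ((hA n).diff (hA m)) disjoint_sdiff_right x
    rw [union_sdiff_cancel (hanti hnm)] at hu
    have h1 : e.comp (M (A n \ A m)) x = e (M (A n) x) - e (M (A m) x) := by
      rw [hu, map_add]; simp
    calc δ ≤ ‖e.comp (M (A n \ A m)) x‖ := by rw [h1]; exact hm.le
      _ ≤ ‖e.comp (M (A n \ A m))‖ * ‖x‖ := ContinuousLinearMap.le_opNorm _ _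
      _ ≤ ‖e.comp (M (A n \ A m))‖ * 1 := mul_le_mul_of_nonneg_left hx.le (norm_nonneg _)
      _ = _ := mul_one _
  have iter : ∀ k : ℕ, ∃ m, k * δ ^ q ≤ ‖e.comp (M (A 0 \ A m))‖ ^ q := by
    intro k
    induction k with
    | zero => exact ⟨0, by simp only [Nat.cast_zero, zero_mul]; positivity⟩
    | succ k ih =>
      obtain ⟨m, hm⟩ := ih
      obtain ⟨m', hmm, hm'⟩ := step m
      refine ⟨m', ?_⟩
      have hset : A 0 \ A m' = (A 0 \ A m) ∪ (A m \ A m') := by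
        ext x
        have h1 := @hanti 0 m (Nat.zero_le _) x
        have h2 := @hanti m m' hmm x
        simp only [Set.mem_sdiff, mem_union]
        tauto
      have hdis : Disjoint (A 0 \ A m) (A m \ A m') :=
        disjoint_left.2 fun x hx hx' => hx.2 hx'.1
      rw [hset]
      refine le_trans ?_ (hM.lower_estimate hpq ((hA 0).diff (hA m)) ((hA m).diff (hA m')) hdis e)
      have := Real.rpow_le_rpow hδ.le hm' hq.le
      push_cast
      linarith
  obtain ⟨k, hk⟩ := exists_nat_gt (‖e‖ ^ q / δ ^ q)
  obtain ⟨m, hm⟩ := iter k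
  have h1 := Real.rpow_le_rpow (norm_nonneg _) (hM.norm_comp_le hp ((hA 0).diff (hA m)) e) hq.le
  rw [div_lt_iff₀ (by positivity)] at hk
  linarith

/-- Borel–Cantelli: bad sets of measure below `2^{-n}` have a null limsup, and their tail unions
decrease to it, against `tendsto_norm_comp`. -/
theorem exists_norm_comp_le (hM : BandProjections μ p M) (hpq : p.HolderConjugate q)
    (e : StrongDual 𝕜 X) {δ : ℝ} (hδ : 0 < δ) :
    ∃ η : ℝ≥0∞, 0 < η ∧ ∀ A, MeasurableSet A → μ A < η → ‖e.comp (M A)‖ ≤ δ := by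
  by_contra! hcon
  have hpos : ∀ n : ℕ, (0 : ℝ≥0∞) < 2⁻¹ ^ n := fun n => by
    exact pos_iff_ne_zero.2 (pow_ne_zero _ (by simp))
  choose B hB hBμ hBn using fun n : ℕ => hcon (2⁻¹ ^ n) (hpos n)
  have hlim : μ (limsup B atTop) = 0 := by
    refine measure_limsup_atTop_eq_zero (ne_top_of_le_ne_top ?_
      (ENNReal.tsum_le_tsum fun n => (hBμ n).le))
    rw [ENNReal.tsum_geometric]
    simp
  rw [limsup_eq_iInf_iSup_of_nat] at hlim
  simp only [iInf_eq_iInter, iSup_eq_iUnion] at hlim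
  have hm : ∀ n, MeasurableSet (⋃ i, ⋃ (_ : n ≤ i), B i) := fun n =>
    MeasurableSet.iUnion fun i => MeasurableSet.iUnion fun _ => hB i
  obtain ⟨n, hn⟩ := hM.tendsto_norm_comp hpq hm
    (fun m n hmn => iUnion_mono fun i => iUnion_subset fun h =>
      subset_iUnion_of_subset (hmn.trans h) le_rfl) hlim e hδ
  have := hM.norm_comp_mono hpq.pos (hB n) (hm n)
    (fun x hx => mem_iUnion₂.2 ⟨n, le_rfl, hx⟩) e
  linarith [hBn n]

end BandProjections

/-! ### Approximate Lyapunov splitting -/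

/-- Greedy choice of signs: by the parallelogram law one of `d + v`, `d - v` has squared norm at
most `‖d‖² + ‖v‖²`. -/
theorem exists_subset_norm_sum_sub_sum_sq_le {ι E : Type*} [DecidableEq ι] [NormedAddCommGroup E]
    [InnerProductSpace ℝ E] (v : ι → E) (s : Finset ι) :
    ∃ t ⊆ s, ‖∑ i ∈ t, v i - ∑ i ∈ s \ t, v i‖ ^ 2 ≤ ∑ i ∈ s, ‖v i‖ ^ 2 := by
  induction s using Finset.induction_on with
  | empty => exact ⟨∅, by simp⟩
  | insert a s ha ih =>
    obtain ⟨t, hts, ht⟩ := ih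
    have hat : a ∉ t := fun h => ha (hts h)
    have hast : a ∉ s \ t := fun h => ha (Finset.sdiff_subset h)
    set d := ∑ i ∈ t, v i - ∑ i ∈ s \ t, v i with hd
    have hpar := parallelogram_law_with_norm ℝ d (v a)
    rw [Finset.sum_insert ha]
    rcases le_total ‖d + v a‖ ‖d - v a‖ with h | h
    · refine ⟨insert a t, Finset.insert_subset_insert _ hts, ?_⟩
      have e1 : insert a s \ insert a t = s \ t := by
        rw [Finset.insert_sdiff_insert, Finset.sdiff_insert_of_notMem ha]
      have e2 : ∑ i ∈ insert a t, v i - ∑ i ∈ insert a s \ insert a t, v i = d + v a := by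
        rw [e1, Finset.sum_insert hat, hd]; abel
      rw [e2]
      nlinarith [norm_nonneg (d + v a)]
    · refine ⟨t, hts.trans (Finset.subset_insert _ _), ?_⟩
      have e2 : ∑ i ∈ t, v i - ∑ i ∈ insert a s \ t, v i = d - v a := by
        rw [Finset.insert_sdiff_of_notMem _ hat, Finset.sum_insert hast, hd]; abel
      rw [e2]
      nlinarith [norm_nonneg (d - v a)]

namespace BandProjections

variable {α : Type*} [MeasurableSpace α] {μ : Measure α} {p q : ℝ}
  {𝕜 X : Type*} [RCLike 𝕜] [NormedAddCommGroup X] [NormedSpace 𝕜 X]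
  {M : Set α → X →L[𝕜] X} {A B : Set α}

theorem comp_preimage_eq_sum (hM : BandProjections μ p M) (hB : MeasurableSet B) {c : α → ℕ}
    (hc : Measurable c) (e : StrongDual 𝕜 X) (s : Finset ℕ) :
    e.comp (M (B ∩ c ⁻¹' s)) = ∑ i ∈ s, e.comp (M (B ∩ c ⁻¹' {i})) := by
  induction s using Finset.induction_on with
  | empty => simp [hM.comp_empty]
  | insert a s ha ih =>
    rw [Finset.sum_insert ha, ← ih, ← hM.comp_union (hB.inter (hc (measurableSet_singleton a)))
      (hB.inter (hc s.measurableSet)), ← inter_union_distrib_left, ← preimage_union]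
    · rw [Finset.coe_insert, Set.insert_eq]
    · refine disjoint_left.2 fun x hx hx' => ha ?_
      have h1 : c x = a := hx.2
      have h2 : c x ∈ s := hx'.2
      rwa [← h1]

theorem sum_norm_rpow_le (hM : BandProjections μ p M) (hpq : p.HolderConjugate q)
    (hB : MeasurableSet B) {c : α → ℕ} (hc : Measurable c) (e : StrongDual 𝕜 X) (s : Finset ℕ) :
    ∑ i ∈ s, ‖e.comp (M (B ∩ c ⁻¹' {i}))‖ ^ q ≤ ‖e.comp (M (B ∩ c ⁻¹' s))‖ ^ q := by
  have hq := hpq.symm.pos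
  induction s using Finset.induction_on with
  | empty => simp [hM.comp_empty, Real.zero_rpow hq.ne']
  | insert a s ha ih =>
    have hd : Disjoint (B ∩ c ⁻¹' {a}) (B ∩ c ⁻¹' s) := by
      refine disjoint_left.2 fun x hx hx' => ha ?_
      have h1 : c x = a := hx.2
      have h2 : c x ∈ s := hx'.2
      rwa [← h1]
    have h := hM.lower_estimate hpq (hB.inter (hc (measurableSet_singleton a)))
      (hB.inter (hc s.measurableSet)) hd e
    rw [← inter_union_distrib_left, ← preimage_union] at h
    rw [Finset.sum_insert ha, Finset.coe_insert, Set.insert_eq]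
    linarith

/-- Approximate Lyapunov convexity: a set can be split into two parts on which an operator with
values in a Euclidean space nearly agrees. -/
theorem exists_halving (hM : BandProjections μ p M) (hpq : p.HolderConjugate q) (hq2 : q < 2)
    (hsplit : ∀ η : ℝ≥0∞, 0 < η → ∃ (N : ℕ) (c : α → ℕ), Measurable c ∧ (∀ x, c x < N) ∧
      ∀ i, μ (c ⁻¹' {i}) < η)
    {E : Type*} [NormedAddCommGroup E] [InnerProductSpace ℝ E] (T : StrongDual 𝕜 X →+ E)
    {K : ℝ} (hT : ∀ z, ‖T z‖ ≤ K * ‖z‖) (e : StrongDual 𝕜 X) (hB : MeasurableSet B)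
    {ε : ℝ} (hε : 0 < ε) :
    ∃ B' ⊆ B, MeasurableSet B' ∧ ‖T (e.comp (M B')) - T (e.comp (M (B \ B')))‖ ≤ ε := by
  have hp := hpq.pos
  have hq := hpq.symm.pos
  set C := K ^ 2 * ‖e‖ ^ q + 1 with hC
  have hC0 : 0 < C := by positivity
  -- Chosen so that `K² δ^{2-q} ‖e‖^q ≤ ε²`; the `+ 1` in `C` keeps the denominator positive.
  set δ := (ε ^ 2 / C) ^ (1 / (2 - q)) with hδ
  have hδ0 : 0 < δ := by positivity
  have hδq : δ ^ (2 - q) = ε ^ 2 / C := by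
    rw [hδ, ← Real.rpow_mul (by positivity), one_div_mul_cancel (by linarith), Real.rpow_one]
  obtain ⟨η, hη, hη'⟩ := hM.exists_norm_comp_le hpq e hδ0
  obtain ⟨N, c, hc, hcN, hcμ⟩ := hsplit η hη
  have hpre : ∀ t : Finset ℕ, MeasurableSet (B ∩ c ⁻¹' t) := fun t => hB.inter (hc t.measurableSet)
  set v : ℕ → E := fun i => T (e.comp (M (B ∩ c ⁻¹' {i}))) with hv
  have hsum : ∀ t : Finset ℕ, T (e.comp (M (B ∩ c ⁻¹' t))) = ∑ i ∈ t, v i := fun t => by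
    rw [hM.comp_preimage_eq_sum hB hc, map_sum]
  obtain ⟨t, hts, ht⟩ := exists_subset_norm_sum_sub_sum_sq_le v (Finset.range N)
  refine ⟨B ∩ c ⁻¹' t, inter_subset_left, hpre t, ?_⟩
  have hdiff : B \ (B ∩ c ⁻¹' t) = B ∩ c ⁻¹' ((Finset.range N \ t : Finset ℕ) : Set ℕ) := by
    ext x
    simp [hcN x]
  rw [hdiff, hsum, hsum]
  -- Here `q < 2` is decisive: smallness of each piece turns squares into a small multiple of `q`-th
  -- powers, whose sum the lower estimate controls.
  have hvi : ∀ i, ‖v i‖ ^ 2 ≤ K ^ 2 * δ ^ (2 - q) * ‖e.comp (M (B ∩ c ⁻¹' {i}))‖ ^ q := fun i => by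
    have hm : MeasurableSet (B ∩ c ⁻¹' {i}) := hB.inter (hc (measurableSet_singleton i))
    have h1 := hη' _ hm ((measure_mono inter_subset_right).trans_lt (hcμ i))
    have h2 := hT (e.comp (M (B ∩ c ⁻¹' {i})))
    set a := ‖e.comp (M (B ∩ c ⁻¹' {i}))‖ with ha
    have ha0 : 0 ≤ a := norm_nonneg _
    have h3 : a ^ 2 = a ^ (2 - q) * a ^ q := by
      rw [← Real.rpow_add' ha0 (by norm_num), sub_add_cancel]
      norm_cast
    calc ‖v i‖ ^ 2 ≤ (K * a) ^ 2 := pow_le_pow_left₀ (norm_nonneg _) h2 2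
      _ = K ^ 2 * (a ^ (2 - q) * a ^ q) := by rw [← h3]; ring
      _ ≤ K ^ 2 * (δ ^ (2 - q) * a ^ q) := by
          gcongr
      _ = _ := by ring
  have hfin : ∑ i ∈ Finset.range N, ‖v i‖ ^ 2 ≤ ε ^ 2 := by
    calc ∑ i ∈ Finset.range N, ‖v i‖ ^ 2
        ≤ ∑ i ∈ Finset.range N, K ^ 2 * δ ^ (2 - q) * ‖e.comp (M (B ∩ c ⁻¹' {i}))‖ ^ q :=
          Finset.sum_le_sum fun i _ => hvi i
      _ = K ^ 2 * δ ^ (2 - q) * ∑ i ∈ Finset.range N, ‖e.comp (M (B ∩ c ⁻¹' {i}))‖ ^ q := by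
          rw [Finset.mul_sum]
      _ ≤ K ^ 2 * δ ^ (2 - q) * ‖e‖ ^ q := by
          gcongr
          exact (hM.sum_norm_rpow_le hpq hB hc e _).trans
            (Real.rpow_le_rpow (norm_nonneg _) (hM.norm_comp_le hp (hpre _) e) hq.le)
      _ = ε ^ 2 * ((K ^ 2 * ‖e‖ ^ q) / C) := by rw [hδq]; ring
      _ ≤ ε ^ 2 * 1 := by
          gcongr
          rw [div_le_one hC0]
          linarith
      _ = ε ^ 2 := mul_one _
  exact (sq_le_sq₀ (norm_nonneg _) hε.le).1 (ht.trans hfin)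

/-- Halve `n` times, always keeping the part of smaller norm: by the lower estimate its `q`-th power
is at most half of the previous one, while the image under `T` is nearly halved. -/
theorem exists_small_part (hM : BandProjections μ p M) (hpq : p.HolderConjugate q) (hq2 : q < 2)
    (hsplit : ∀ η : ℝ≥0∞, 0 < η → ∃ (N : ℕ) (c : α → ℕ), Measurable c ∧ (∀ x, c x < N) ∧
      ∀ i, μ (c ⁻¹' {i}) < η)
    {E : Type*} [NormedAddCommGroup E] [InnerProductSpace ℝ E] (T : StrongDual 𝕜 X →+ E)
    {K : ℝ} (hT : ∀ z, ‖T z‖ ≤ K * ‖z‖) (e : StrongDual 𝕜 X) {ε : ℝ} (hε : 0 < ε) (n : ℕ) :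
    ∃ A, MeasurableSet A ∧ ‖e.comp (M A)‖ ^ q ≤ (1 / 2) ^ n * ‖e‖ ^ q ∧
      ‖T (e.comp (M A)) - ((1 / 2 : ℝ) ^ n) • T e‖ ≤ ε := by
  induction n with
  | zero =>
    refine ⟨Set.univ, MeasurableSet.univ, ?_, ?_⟩
    · rw [hM.univ, pow_zero, one_mul]
      exact le_rfl
    · rw [hM.univ, pow_zero, one_smul]
      have : e.comp (1 : X →L[𝕜] X) = e := rfl
      rw [this, sub_self, norm_zero]
      exact hε.le
  | succ n ih =>
    obtain ⟨A, hA, hA1, hA2⟩ := ih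
    obtain ⟨B, hBA, hB, hB'⟩ := hM.exists_halving hpq hq2 hsplit T hT e hA hε
    have hu : B ∪ A \ B = A := union_sdiff_cancel hBA
    have hlow := hM.lower_estimate hpq hB (hA.diff hB) disjoint_sdiff_right e
    have hadd := hM.comp_union hB (hA.diff hB) disjoint_sdiff_right e
    rw [hu] at hlow hadd
    have hTadd : T (e.comp (M A)) = T (e.comp (M B)) + T (e.comp (M (A \ B))) := by
      rw [hadd, map_add]
    -- The error does not accumulate: the new one is half the sum of the old one and of the halving
    -- defect, both at most `ε`.
    have hest : ∀ x y : E, T (e.comp (M A)) = x + y → ‖x - y‖ ≤ ε →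
        ‖x - ((1 / 2 : ℝ) ^ (n + 1)) • T e‖ ≤ ε := by
      intro x y hxy hd
      have h1 : x - ((1 / 2 : ℝ) ^ (n + 1)) • T e =
          (1 / 2 : ℝ) • ((x - y) + (T (e.comp (M A)) - ((1 / 2 : ℝ) ^ n) • T e)) := by
        rw [hxy, pow_succ, mul_comm, mul_smul]
        module
      rw [h1, norm_smul]
      have := norm_add_le (x - y) (T (e.comp (M A)) - ((1 / 2 : ℝ) ^ n) • T e)
      norm_num
      linarith
    rcases le_total ‖e.comp (M B)‖ ‖e.comp (M (A \ B))‖ with h | h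
    · refine ⟨B, hB, ?_, hest _ _ hTadd hB'⟩
      have := Real.rpow_le_rpow (norm_nonneg _) h hpq.symm.pos.le
      rw [pow_succ]
      linarith
    · refine ⟨A \ B, hA.diff hB, ?_, hest _ _ (hTadd.trans (add_comm _ _)) ?_⟩
      · have := Real.rpow_le_rpow (norm_nonneg _) h hpq.symm.pos.le
        rw [pow_succ]
        linarith
      · rwa [norm_sub_rev]

end BandProjections

/-! ### Kernels of projections and Euclidean models -/

/-- The kernel meets `Y` only in `0`, so it embeds into the quotient. -/
theorem finiteDimensional_ker_of_isProj {𝕜 Z : Type*} [Field 𝕜] [AddCommGroup Z] [Module 𝕜 Z]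
    {Y : Submodule 𝕜 Z} [FiniteDimensional 𝕜 (Z ⧸ Y)] {P : Z →ₗ[𝕜] Z} (hP : LinearMap.IsProj Y P) :
    FiniteDimensional 𝕜 (LinearMap.ker P) := by
  refine FiniteDimensional.of_injective (Y.mkQ.comp (LinearMap.ker P).subtype) ?_
  refine (injective_iff_map_eq_zero _).2 fun z hz => ?_
  have h1 : (z : Z) ∈ Y := by simpa using hz
  have h2 : P z = 0 := z.2
  exact Subtype.ext ((hP.map_id _ h1).symm.trans h2)

theorem exists_ne_zero_of_isProj {𝕜 Z : Type*} [Field 𝕜] [AddCommGroup Z] [Module 𝕜 Z]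
    {Y : Submodule 𝕜 Z} (hY : Y ≠ ⊤) {P : Z →ₗ[𝕜] Z} (hP : LinearMap.IsProj Y P) :
    ∃ e, e ≠ 0 ∧ P e = 0 := by
  obtain ⟨z, hz⟩ : ∃ z, z ∉ Y := by
    by_contra! h
    exact hY (eq_top_iff.2 fun z _ => h z)
  refine ⟨z - P z, fun h => hz ?_, ?_⟩
  · rw [sub_eq_zero.1 h]
    exact hP.map_mem z
  · rw [map_sub, hP.map_id _ (hP.map_mem z), sub_self]

theorem exists_euclidean_model (F : Type*) [NormedAddCommGroup F] [NormedSpace ℝ F]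
    [FiniteDimensional ℝ F] : ∃ (d : ℕ) (S : F →ₗ[ℝ] EuclideanSpace ℝ (Fin d)) (C₁ C₂ : ℝ),
      (∀ z, ‖S z‖ ≤ C₁ * ‖z‖) ∧ (∀ z, ‖z‖ ≤ C₂ * ‖S z‖) ∧ 0 ≤ C₁ ∧ 0 ≤ C₂ := by
  set S := toEuclidean (E := F)
  set S₁ := S.toContinuousLinearMap
  set S₂ := S.symm.toContinuousLinearMap
  refine ⟨_, S.toLinearEquiv.toLinearMap, ‖S₁‖, ‖S₂‖, S₁.le_opNorm, fun z => ?_,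
    norm_nonneg _, norm_nonneg _⟩
  have h := S₂.le_opNorm (S z)
  have h1 : S₂ (S z) = z := S.symm_apply_apply z
  rwa [h1] at h

/-- The splitting argument needs a real inner product, so complex spaces are viewed as real ones. An
additive map together with a bound on `z - t w` for real `t` records exactly the real linearity used
later, without exposing a second scalar structure on `F`. -/
theorem exists_euclidean_model_rclike (𝕜 F : Type*) [RCLike 𝕜] [NormedAddCommGroup F]
    [NormedSpace 𝕜 F] [FiniteDimensional 𝕜 F] :
    ∃ (d : ℕ) (S : F →+ EuclideanSpace ℝ (Fin d)) (C₁ C₂ : ℝ), (∀ z, ‖S z‖ ≤ C₁ * ‖z‖) ∧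
      (∀ z w (t : ℝ), ‖z - (t : 𝕜) • w‖ ≤ C₂ * ‖S z - t • S w‖) ∧ 0 ≤ C₁ ∧ 0 ≤ C₂ := by
  let : NormedSpace ℝ F := NormedSpace.restrictScalars ℝ 𝕜 F
  have : IsScalarTower ℝ 𝕜 F := RestrictScalars.isScalarTower ℝ 𝕜 F
  have : FiniteDimensional ℝ F := FiniteDimensional.trans ℝ 𝕜 F
  obtain ⟨d, S, C₁, C₂, h1, h2, h3, h4⟩ := exists_euclidean_model F
  refine ⟨d, S.toAddMonoidHom, C₁, C₂, h1, fun z w t => ?_, h3, h4⟩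
  have h := h2 (z - t • w)
  rw [map_sub, map_smul, RCLike.real_smul_eq_coe_smul (K := 𝕜) t w] at h
  exact h

/-- `T` is `1 - P`, which lands in the finite-dimensional kernel of `P`, followed by a Euclidean
model of that kernel. -/
theorem exists_euclidean_model_of_isProj {𝕜 Z : Type*} [RCLike 𝕜] [NormedAddCommGroup Z]
    [NormedSpace 𝕜 Z] {Y : Submodule 𝕜 Z} [FiniteDimensional 𝕜 (Z ⧸ Y)] {P : Z →L[𝕜] Z}
    (hP : LinearMap.IsProj Y P) :
    ∃ (d : ℕ) (T : Z →+ EuclideanSpace ℝ (Fin d)) (C₁ C₂ : ℝ), (∀ z, ‖T z‖ ≤ C₁ * ‖z‖) ∧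
      (∀ z w (t : ℝ), ‖(z - P z) - (t : 𝕜) • (w - P w)‖ ≤ C₂ * ‖T z - t • T w‖) ∧ 0 ≤ C₂ := by
  have hP' : LinearMap.IsProj Y (P : Z →ₗ[𝕜] Z) := ⟨hP.map_mem, hP.map_id⟩
  set F := LinearMap.ker (P : Z →ₗ[𝕜] Z) with hF
  have hQF : ∀ z, (ContinuousLinearMap.id 𝕜 Z - P) z ∈ F := fun z => by
    rw [hF, LinearMap.mem_ker]
    change P (z - P z) = 0
    rw [map_sub, hP.map_id _ (hP.map_mem z), sub_self]
  set Q : Z →L[𝕜] F := (ContinuousLinearMap.id 𝕜 Z - P).codRestrict F hQF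
  have hFfin : FiniteDimensional 𝕜 F := finiteDimensional_ker_of_isProj hP'
  obtain ⟨d, S, C₁, C₂, hS1, hS2, hC₁, hC₂⟩ := exists_euclidean_model_rclike 𝕜 F
  refine ⟨d, S.comp (Q : Z →+ F), C₁ * ‖Q‖, C₂, fun z => ?_, fun z w t => hS2 (Q z) (Q w) t, hC₂⟩
  rw [mul_assoc]
  exact (hS1 (Q z)).trans (mul_le_mul_of_nonneg_left (Q.le_opNorm z) hC₁)

theorem exists_unit_vector_of_isProj {𝕜 Z : Type*} [RCLike 𝕜] [NormedAddCommGroup Z]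
    [NormedSpace 𝕜 Z] {Y : Submodule 𝕜 Z} (hY : Y ≠ ⊤) {P : Z →ₗ[𝕜] Z}
    (hP : LinearMap.IsProj Y P) : ∃ e, ‖e‖ = 1 ∧ P e = 0 := by
  obtain ⟨e₀, he₀, hPe₀⟩ := exists_ne_zero_of_isProj hY hP
  refine ⟨((‖e₀‖⁻¹ : ℝ) : 𝕜) • e₀, ?_, ?_⟩
  · rw [norm_smul, RCLike.norm_ofReal, abs_of_nonneg (by positivity),
      inv_mul_cancel₀ (norm_ne_zero_iff.2 he₀)]
  · rw [map_smul, hPe₀, smul_zero]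

/-! ### The bound for projections on the dual -/

theorem exists_projection_constant {q : ℝ} (hq : 1 < q) (hq2 : q < 2) :
    ∃ n : ℕ, 1 < (1 - (1 / 2 : ℝ) ^ n) ^ q +
      ((1 / 2 : ℝ) ^ n) ^ q * (1 / ((1 / 2 : ℝ) ^ n) ^ (1 / q) - 1) ^ q := by
  have hq0 : 0 < q := by linarith
  have ht : Tendsto (fun n : ℕ => ((1 / 2 : ℝ) ^ n)) atTop (𝓝 0) :=
    tendsto_pow_atTop_nhds_zero_of_lt_one (by norm_num) (by norm_num)
  have ht1 : Tendsto (fun n : ℕ => ((1 / 2 : ℝ) ^ n) ^ (1 / q)) atTop (𝓝 0) := by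
    have := ht.rpow_const (p := 1 / q) (Or.inr (by positivity))
    rwa [Real.zero_rpow (by positivity)] at this
  have ht2 : Tendsto (fun n : ℕ => ((1 / 2 : ℝ) ^ n) ^ (2 - q)) atTop (𝓝 0) := by
    have := ht.rpow_const (p := 2 - q) (Or.inr (by linarith))
    rwa [Real.zero_rpow (by linarith)] at this
  have hc : 0 < (1 / 2 : ℝ) ^ q / q := by positivity
  -- The first condition gives `1/τ - 1 ≥ 1/(2τ)` for `τ = t^{1/q}`, hence a gain of at least
  -- `2^{-q} t^{q-1}`; the second makes this exceed the Bernoulli loss `q t`.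
  obtain ⟨n, h1, h2⟩ := ((ht1.eventually_lt_const (show (0 : ℝ) < 1 / 2 by norm_num)).and
    (ht2.eventually_lt_const hc)).exists
  refine ⟨n, ?_⟩
  set t := (1 / 2 : ℝ) ^ n with htd
  have t0 : 0 < t := by positivity
  have t1 : t ≤ 1 := pow_le_one₀ (by norm_num) (by norm_num)
  have hb : 1 - q * t ≤ (1 - t) ^ q := by
    have := one_add_mul_self_le_rpow_one_add (s := -t) (by linarith) hq.le
    simpa [sub_eq_add_neg] using this
  set τ := t ^ (1 / q) with hτ
  have τ0 : 0 < τ := by positivity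
  have hτq : τ ^ q = t := by
    rw [hτ, ← Real.rpow_mul t0.le, one_div_mul_cancel hq0.ne', Real.rpow_one]
  have h3 : (1 / 2) / τ ≤ 1 / τ - 1 := by
    rw [div_sub_one τ0.ne']
    exact div_le_div_of_nonneg_right (by linarith) τ0.le
  have h4 : t ^ q * ((1 / 2) ^ q / t) ≤ t ^ q * (1 / τ - 1) ^ q := by
    have := Real.rpow_le_rpow (by positivity) h3 hq0.le
    rw [Real.div_rpow (by norm_num) τ0.le, hτq] at this
    gcongr
  have h5 : q * t < t ^ q * ((1 / 2) ^ q / t) := by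
    have h6 : t ^ (2 - q) * t ^ q = t * t := by
      rw [← Real.rpow_add t0, sub_add_cancel]
      norm_num [sq]
    rw [lt_div_iff₀ hq0] at h2
    have h7 : (0 : ℝ) < t ^ q := by positivity
    rw [mul_div_assoc', lt_div_iff₀ t0]
    nlinarith
  linarith

namespace BandProjections

variable {α : Type*} [MeasurableSpace α] {μ : Measure α} {p q : ℝ}
  {𝕜 X : Type*} [RCLike 𝕜] [NormedAddCommGroup X] [NormedSpace 𝕜 X]
  {M : Set α → X →L[𝕜] X}

/-- With `y` and `z` the parts of `e` on `A` and `Aᶜ`, the functional `y - t e` has parts `(1 - t)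
y` and `-t z`. Since `‖y‖ ≤ t^{1/q}` and `‖y‖ + ‖z‖ ≥ 1`, the part `z` has norm at least `(t^{-1/q}
- 1) ‖y‖`, and the lower `q`-estimate combines the two. -/
theorem mul_norm_comp_le (hM : BandProjections μ p M) (hpq : p.HolderConjugate q) {t : ℝ}
    (t0 : 0 < t) (t1 : t ≤ 1) {A : Set α} (hA : MeasurableSet A) {e : StrongDual 𝕜 X}
    (he : ‖e‖ = 1) (hA1 : ‖e.comp (M A)‖ ^ q ≤ t) :
    ((1 - t) ^ q + t ^ q * (1 / t ^ (1 / q) - 1) ^ q) ^ (1 / q) * ‖e.comp (M A)‖ ≤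
      ‖e.comp (M A) - (t : 𝕜) • e‖ := by
  have hq := hpq.symm.pos
  set τ := t ^ (1 / q) with hτ
  have τ0 : 0 < τ := by positivity
  have τ1 : τ ≤ 1 := Real.rpow_le_one t0.le t1 (by positivity)
  have τ2 : 0 ≤ 1 / τ - 1 := by
    rw [sub_nonneg, le_div_iff₀ τ0]; linarith
  set κ := ((1 - t) ^ q + t ^ q * (1 / τ - 1) ^ q) ^ (1 / q) with hκ
  have hs : 0 ≤ (1 - t) ^ q + t ^ q * (1 / τ - 1) ^ q := by
    have : 0 ≤ 1 - t := by linarith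
    positivity
  have κ0 : 0 ≤ κ := by positivity
  have hκq : κ ^ q = (1 - t) ^ q + t ^ q * (1 / τ - 1) ^ q := by
    rw [hκ, ← Real.rpow_mul hs, one_div_mul_cancel hq.ne', Real.rpow_one]
  set y := e.comp (M A) with hy
  set z := e.comp (M Aᶜ) with hz
  have hyz : y + z = e := by
    rw [hy, hz, ← hM.comp_union hA hA.compl disjoint_compl_right, union_compl_self, hM.univ]
    rfl
  have hyτ : ‖y‖ ≤ τ := by
    calc ‖y‖ = (‖y‖ ^ q) ^ (1 / q) := by
          rw [← Real.rpow_mul (norm_nonneg _), mul_one_div_cancel hq.ne', Real.rpow_one]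
      _ ≤ t ^ (1 / q) := Real.rpow_le_rpow (by positivity) hA1 (by positivity)
  have hzy : ‖y‖ * (1 / τ - 1) ≤ ‖z‖ := by
    have h1 : 1 ≤ ‖y‖ + ‖z‖ := by rw [← he, ← hyz]; exact norm_add_le _ _
    have h2 : ‖y‖ / τ ≤ 1 := (div_le_one τ0).2 hyτ
    have : ‖y‖ * (1 / τ - 1) = ‖y‖ / τ - ‖y‖ := by ring
    linarith
  set g := y - (t : 𝕜) • e with hg
  have hgA : g.comp (M A) = ((1 - t : ℝ) : 𝕜) • y := by
    ext x
    have h1 : M A (M A x) = M A x := by rw [hM.inter hA hA, inter_self]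
    simp only [hg, hy, ContinuousLinearMap.comp_apply, sub_apply,
      smul_apply, h1, smul_eq_mul]
    push_cast
    ring
  have hgB : g.comp (M Aᶜ) = ((-t : ℝ) : 𝕜) • z := by
    ext x
    have h0 : e (M ∅ x) = 0 := by
      have := congrArg (fun f : StrongDual 𝕜 X => f x) (hM.comp_empty e)
      simpa using this
    have h1 : e (M A (M Aᶜ x)) = 0 := by rw [hM.inter hA hA.compl, inter_compl_self, h0]
    simp only [hg, hy, hz, ContinuousLinearMap.comp_apply, sub_apply,
      smul_apply, h1, smul_eq_mul]
    push_cast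
    ring
  have hgg : g.comp (M (A ∪ Aᶜ)) = g := by rw [union_compl_self, hM.univ]; rfl
  have hlow := hM.lower_estimate hpq hA hA.compl disjoint_compl_right g
  rw [hgg, hgA, hgB, norm_smul, norm_smul, RCLike.norm_ofReal, RCLike.norm_ofReal, abs_neg,
    abs_of_nonneg t0.le, abs_of_nonneg (by linarith : (0 : ℝ) ≤ 1 - t),
    Real.mul_rpow (by linarith) (norm_nonneg _), Real.mul_rpow t0.le (norm_nonneg _)] at hlow
  refine (Real.rpow_le_rpow_iff (by positivity) (norm_nonneg _) hq).1 (le_trans ?_ hlow)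
  rw [Real.mul_rpow κ0 (norm_nonneg _), hκq]
  have h1 := Real.rpow_le_rpow (mul_nonneg (norm_nonneg y) τ2) hzy hq.le
  rw [Real.mul_rpow (norm_nonneg _) τ2] at h1
  have h2 : 0 ≤ t ^ q := by positivity
  nlinarith

theorem le_norm_of_isProj (hM : BandProjections μ p M) (hpq : p.HolderConjugate q) (hq2 : q < 2)
    (hsplit : ∀ η : ℝ≥0∞, 0 < η → ∃ (N : ℕ) (c : α → ℕ), Measurable c ∧ (∀ x, c x < N) ∧
      ∀ i, μ (c ⁻¹' {i}) < η) (n : ℕ)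
    (P : StrongDual 𝕜 X →L[𝕜] StrongDual 𝕜 X) (Y : Submodule 𝕜 (StrongDual 𝕜 X)) (hY : Y ≠ ⊤)
    (hfin : FiniteDimensional 𝕜 (StrongDual 𝕜 X ⧸ Y)) (hP : LinearMap.IsProj Y P) :
    ((1 - (1 / 2 : ℝ) ^ n) ^ q +
      ((1 / 2 : ℝ) ^ n) ^ q * (1 / ((1 / 2 : ℝ) ^ n) ^ (1 / q) - 1) ^ q) ^ (1 / q) ≤ ‖P‖ := by
  have hp := hpq.pos
  have hq := hpq.symm.pos
  set t := (1 / 2 : ℝ) ^ n with htd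
  have t0 : 0 < t := by positivity
  have t1 : t ≤ 1 := pow_le_one₀ (by norm_num) (by norm_num)
  set κ := ((1 - t) ^ q + t ^ q * (1 / t ^ (1 / q) - 1) ^ q) ^ (1 / q) with hκ
  have hP' : LinearMap.IsProj Y (P : StrongDual 𝕜 X →ₗ[𝕜] StrongDual 𝕜 X) :=
    ⟨hP.map_mem, hP.map_id⟩
  obtain ⟨e, he, hPe : P e = 0⟩ := exists_unit_vector_of_isProj hY hP'
  obtain ⟨d, T, C₁, C₂, hT, hS2, hC₂⟩ := exists_euclidean_model_of_isProj hP
  set Q : StrongDual 𝕜 X →L[𝕜] StrongDual 𝕜 X := ContinuousLinearMap.id 𝕜 _ - P with hQ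
  have hQz : ∀ z, Q z = z - P z := fun z => rfl
  have hQe : Q e = e := by rw [hQz, hPe, sub_zero]
  by_contra! hlt
  -- If `‖P‖ < κ`, then `κ ‖y‖ ≤ ‖y - t e‖ ≤ ‖P‖ ‖y‖ + C₂ ε` forces `y` to be small, whereas `Q y ≈
  -- t e` forbids it.
  have main : ∀ ε : ℝ, 0 < ε → t ≤ C₂ * ε + ‖Q‖ * (C₂ * ε / (κ - ‖P‖)) := by
    intro ε hε
    obtain ⟨A, hA, hA1, hA2⟩ := hM.exists_small_part hpq hq2 hsplit T hT e hε n
    rw [← htd, he, Real.one_rpow, mul_one] at hA1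
    set y := e.comp (M A) with hy
    have hQy : ‖Q y - (t : 𝕜) • Q e‖ ≤ C₂ * ε :=
      (hS2 _ _ t).trans (mul_le_mul_of_nonneg_left hA2 hC₂)
    rw [hQe] at hQy
    have hPy : ‖y - (t : 𝕜) • e‖ ≤ ‖P‖ * ‖y‖ + C₂ * ε := by
      have h1 : y - (t : 𝕜) • e = P y + (Q y - (t : 𝕜) • e) := by rw [hQz]; abel
      rw [h1]
      exact (norm_add_le _ _).trans (add_le_add (P.le_opNorm y) hQy)
    have hylow : t - C₂ * ε ≤ ‖Q‖ * ‖y‖ := by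
      have h1 : ‖(t : 𝕜) • e‖ = t := by
        rw [norm_smul, he, mul_one, RCLike.norm_ofReal, abs_of_nonneg t0.le]
      have h2 : ‖(t : 𝕜) • e‖ ≤ ‖Q y‖ + ‖Q y - (t : 𝕜) • e‖ := by
        have := norm_sub_le (Q y) (Q y - (t : 𝕜) • e)
        rwa [sub_sub_cancel] at this
      have := Q.le_opNorm y
      linarith
    have hκy := hM.mul_norm_comp_le hpq t0 t1 hA he hA1
    have hd : 0 < κ - ‖P‖ := by linarith
    have hy' : ‖y‖ ≤ C₂ * ε / (κ - ‖P‖) := by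
      rw [le_div_iff₀ hd]
      nlinarith
    have := mul_le_mul_of_nonneg_left hy' (norm_nonneg Q)
    linarith
  have hd : 0 < κ - ‖P‖ := by linarith
  set D := C₂ + ‖Q‖ * (C₂ / (κ - ‖P‖)) with hD
  have hD0 : 0 ≤ D := by positivity
  -- The right side of `main` is `D * ε`; this `ε` makes it less than `t`.
  have h := main (t / (2 * (D + 1))) (by positivity)
  have h1 : C₂ * (t / (2 * (D + 1))) + ‖Q‖ * (C₂ * (t / (2 * (D + 1))) / (κ - ‖P‖)) =
      t * (D / (2 * (D + 1))) := by
    rw [hD]; ring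
  rw [h1] at h
  have h2 : D / (2 * (D + 1)) < 1 := by
    rw [div_lt_one (by positivity)]; linarith
  nlinarith

end BandProjections

/-! ### Renorming a separable space -/

/-- A bounded finite-codimensional projection acts asymptotically as the identity on a sequence
whose long sums are small compared with their length. -/
theorem tendsto_sub_apply_of_isProj {𝕜 X : Type*} [RCLike 𝕜] [NormedAddCommGroup X]
    [NormedSpace 𝕜 X] {Y : Submodule 𝕜 X} [FiniteDimensional 𝕜 (X ⧸ Y)] {P : X →L[𝕜] X}
    (hP : LinearMap.IsProj Y P) {u : ℕ → X} {b : ℝ} (hu : ∀ n, ‖u n‖ ≤ b)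
    (hsum : ∀ δ : ℝ, 0 < δ → ∃ N : ℕ, 0 < N ∧ ∀ S : Finset ℕ, S.card = N →
      ‖∑ i ∈ S, u i‖ ≤ δ * N) :
    Tendsto (fun n => u n - P (u n)) atTop (𝓝 0) := by
  obtain ⟨d, T, C₁, C₂, hT, hT2, hC₂⟩ := exists_euclidean_model_of_isProj hP
  have hC : ∀ z, ‖z - P z‖ ≤ C₂ * ‖T z‖ := fun z => by simpa using hT2 z 0 0
  have hT' : ∀ z, ‖T z‖ ≤ |C₁| * ‖z‖ := fun z =>
    (hT z).trans (mul_le_mul_of_nonneg_right (le_abs_self _) (norm_nonneg _))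
  suffices h : Tendsto (fun n => T (u n)) atTop (𝓝 0) by
    refine squeeze_zero_norm (fun n => hC (u n)) ?_
    simpa using h.norm.const_mul C₂
  -- The images are bounded in a finite-dimensional space, so it suffices that every subsequential
  -- limit `y` vanishes.
  refine tendsto_of_subseq_tendsto fun ns hns => ?_
  obtain ⟨φ₀, -, hφ₀⟩ := strictMono_subseq_of_tendsto_atTop hns
  obtain ⟨y, -, φ₁, hφ₁, hy⟩ := tendsto_subseq_of_bounded
    (Metric.isBounded_closedBall (x := (0 : EuclideanSpace ℝ (Fin d))) (r := |C₁| * b))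
    (x := fun n => T (u (ns (φ₀ n)))) fun n => by
      rw [mem_closedBall_zero_iff]
      exact (hT' _).trans (mul_le_mul_of_nonneg_left (hu _) (abs_nonneg _))
  refine ⟨φ₀ ∘ φ₁, ?_⟩
  suffices hy0 : y = 0 by
    rw [hy0] at hy
    exact hy
  by_contra hne
  set m : ℕ → ℕ := fun k => ns (φ₀ (φ₁ k)) with hm
  have hmmono : StrictMono m := hφ₀.comp hφ₁
  have hr : 0 < ‖y‖ := norm_pos_iff.2 hne
  set r := ‖y‖ with hrd
  -- A sum of `N` late terms has image within `N r / 4` of `N y`, and with this `δ` the image itself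
  -- has norm at most `N r / 4`; but `‖N y‖ = N r`.
  obtain ⟨N, hN, hS⟩ := hsum (r / (4 * (|C₁| + 1))) (by positivity)
  obtain ⟨k₀, hk₀⟩ := Metric.tendsto_atTop.1 hy (r / 4) (by positivity)
  set I := Finset.Ico k₀ (k₀ + N) with hI
  have hcard : (I.image m).card = N := by
    rw [Finset.card_image_of_injective _ hmmono.injective, hI, Nat.card_Ico]
    omega
  have h1 := hS _ hcard
  have h2 : T (∑ i ∈ I.image m, u i) = ∑ k ∈ I, T (u (m k)) := by
    rw [Finset.sum_image hmmono.injective.injOn, map_sum]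
  have h3 : ‖∑ k ∈ I, T (u (m k)) - (N : ℝ) • y‖ ≤ N * (r / 4) := by
    have e1 : (N : ℝ) • y = ∑ k ∈ I, y := by
      rw [Finset.sum_const, hI, Nat.card_Ico, add_tsub_cancel_left, Nat.cast_smul_eq_nsmul]
    rw [e1, ← Finset.sum_sub_distrib]
    refine (norm_sum_le_of_le I (f := fun k => T (u (m k)) - y) (n := fun _ => r / 4)
      fun k hk => ?_).trans ?_
    · have := hk₀ k (Finset.mem_Ico.1 hk).1
      rw [dist_eq_norm] at this
      exact this.le
    · rw [Finset.sum_const, hI, Nat.card_Ico, add_tsub_cancel_left, nsmul_eq_mul]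
  have h4 : ‖∑ k ∈ I, T (u (m k))‖ ≤ N * (r / 4) := by
    rw [← h2]
    refine (hT' _).trans ((mul_le_mul_of_nonneg_left h1 (abs_nonneg _)).trans ?_)
    have h5 : |C₁| / (|C₁| + 1) ≤ 1 := by
      rw [div_le_one (by positivity)]; linarith
    calc |C₁| * (r / (4 * (|C₁| + 1)) * N) = (N * (r / 4)) * (|C₁| / (|C₁| + 1)) := by
          field_simp
      _ ≤ (N * (r / 4)) * 1 := by gcongr
      _ = _ := mul_one _
  have h6 : ‖(N : ℝ) • y‖ = N * r := by
    rw [norm_smul, Real.norm_of_nonneg (Nat.cast_nonneg N)]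
  have h7 : ‖(N : ℝ) • y‖ ≤ ‖∑ k ∈ I, T (u (m k))‖ + ‖∑ k ∈ I, T (u (m k)) - (N : ℝ) • y‖ := by
    have := norm_sub_le (∑ k ∈ I, T (u (m k))) (∑ k ∈ I, T (u (m k)) - (N : ℝ) • y)
    rwa [sub_sub_cancel] at this
  have h8 : (0 : ℝ) < N := Nat.cast_pos.2 hN
  have h9 : 0 < N * r := by positivity
  linarith

/-- The three clauses characterise the maximum of `‖x‖` and `sup |φ n x|`; the uniform bound `K` is
what makes the real supremum a genuine one. -/
theorem exists_seminorm_max_iSup {𝕜 X : Type*} [RCLike 𝕜] [NormedAddCommGroup X]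
    [NormedSpace 𝕜 X] (φ : ℕ → X →ₗ[𝕜] 𝕜) {K : ℝ} (hφ : ∀ n x, ‖φ n x‖ ≤ K * ‖x‖) :
    ∃ ν : Seminorm 𝕜 X, (∀ x, ‖x‖ ≤ ν x) ∧ (∀ n x, ‖φ n x‖ ≤ ν x) ∧
      ∀ x c, ‖x‖ ≤ c → (∀ n, ‖φ n x‖ ≤ c) → ν x ≤ c := by
  set s : ℕ → Seminorm 𝕜 X := fun n => (normSeminorm 𝕜 𝕜).comp (φ n) with hs
  have hsx : ∀ n x, s n x = ‖φ n x‖ := fun n x => rfl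
  have hb : ∀ x, BddAbove (range fun n => s n x) := fun x =>
    ⟨K * ‖x‖, by rintro _ ⟨n, rfl⟩; exact hφ n x⟩
  have hsup : ∀ x, (⨆ n, s n) x = ⨆ n, s n x := fun x => by
    rw [Seminorm.coe_iSup_eq (Seminorm.bddAbove_range_iff.2 hb), iSup_apply]
  refine ⟨normSeminorm 𝕜 X ⊔ ⨆ n, s n, fun x => ?_, fun n x => ?_, fun x c hx hc => ?_⟩
  · exact le_max_left _ _
  · refine le_trans ?_ (le_max_right _ _)
    rw [hsup]
    exact le_ciSup (hb x) n
  · refine max_le hx ?_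
    rw [hsup]
    exact ciSup_le hc

/-- A separable space with a suitable disjoint sequence has an equivalent norm for which all
finite-codimensional projections are uniformly far from being contractive. -/
theorem exists_seminorm_le_of_isProj {𝕜 X : Type*} [RCLike 𝕜] [NormedAddCommGroup X]
    [NormedSpace 𝕜 X] [TopologicalSpace.SeparableSpace X] {R D : ℕ → X →L[𝕜] X} {u : ℕ → X}
    (hR : ∀ n x, ‖R n x‖ ≤ ‖x‖) (hRt : ∀ x, Tendsto (fun n => R n x) atTop (𝓝 x))
    (hD : ∀ n x, ‖D n x‖ ≤ ‖x‖) (hDR : ∀ n x, D n (R n x) = 0)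
    (hDu : ∀ n, D n (u n) = u n) (hDu' : ∀ m n, m ≠ n → D m (u n) = 0)
    (hRu : ∀ m n, m ≤ n → R m (u n) = 0) (hu : ∀ n, ‖u n‖ = 1 / 2)
    (hsum : ∀ δ : ℝ, 0 < δ → ∃ N : ℕ, 0 < N ∧ ∀ S : Finset ℕ, S.card = N →
      ‖∑ i ∈ S, u i‖ ≤ δ * N) :
    ∃ ν : Seminorm 𝕜 X, (∀ x, ‖x‖ ≤ ν x) ∧ (∀ x, ν x ≤ 3 * ‖x‖) ∧
      ∀ (P : X →ₗ[𝕜] X) (Y : Submodule 𝕜 X), Y ≠ ⊤ → FiniteDimensional 𝕜 (X ⧸ Y) →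
        LinearMap.IsProj Y P → ∀ C : ℝ, (∀ x, ν (P x) ≤ C * ν x) → 9 / 8 ≤ C := by
  -- Unpairing repeats every dense point infinitely often, so approximants of a given vector occur
  -- at arbitrarily late indices.
  set d : ℕ → X := fun n => TopologicalSpace.denseSeq X n.unpair.1 with hd
  have hdense : ∀ (x : X) (η : ℝ), 0 < η → ∀ N, ∃ n ≥ N, ‖d n - x‖ < η := by
    intro x η hη N
    obtain ⟨y, hi, i, rfl⟩ :=
      Metric.dense_iff.1 (TopologicalSpace.denseRange_denseSeq X) x η hη
    refine ⟨Nat.pair i N, Nat.right_le_pair i N, ?_⟩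
    rw [hd]
    simpa [Nat.unpair_pair, dist_eq_norm] using hi
  choose ψ hψ hψu using fun n => exists_dual_vector'' 𝕜 (u n)
  choose θ hθ hθd using fun n => exists_dual_vector'' 𝕜 (R n (d n))
  have hle : ∀ (f : StrongDual 𝕜 X), ‖f‖ ≤ 1 → ∀ x, ‖f x‖ ≤ ‖x‖ := fun f hf x =>
    (f.le_opNorm x).trans (by nlinarith [norm_nonneg x])
  -- The weight `9/4` gives `φ n (u n) = 9/8`, as `‖u n‖ = 1/2`; the weight `1/2` lets a quarter of
  -- a unit vector close to `d n` lower this value by about `1/8`. The total `9/4 + 1/2` stays below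
  -- `3`.
  set φ : ℕ → X →ₗ[𝕜] 𝕜 := fun n =>
    (((9 / 4 : ℝ) : 𝕜) • (ψ n).comp (D n) - ((1 / 2 : ℝ) : 𝕜) • (θ n).comp (R n) :
      StrongDual 𝕜 X) with hφ
  have hφx : ∀ n x, φ n x = ((9 / 4 : ℝ) : 𝕜) * ψ n (D n x) - ((1 / 2 : ℝ) : 𝕜) * θ n (R n x) :=
    fun n x => rfl
  have hφn : ∀ n x, ‖φ n x‖ ≤ 9 / 4 * ‖D n x‖ + 1 / 2 * ‖R n x‖ := fun n x => by
    rw [hφx]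
    refine (norm_sub_le _ _).trans ?_
    rw [norm_mul, norm_mul, RCLike.norm_ofReal, RCLike.norm_ofReal,
      abs_of_nonneg (by norm_num : (0 : ℝ) ≤ 9 / 4), abs_of_nonneg (by norm_num : (0 : ℝ) ≤ 1 / 2)]
    have h1 := hle _ (hψ n) (D n x)
    have h2 := hle _ (hθ n) (R n x)
    linarith
  have hφ3 : ∀ n x, ‖φ n x‖ ≤ 3 * ‖x‖ := fun n x => by
    linarith [hφn n x, hD n x, hR n x, norm_nonneg x]
  obtain ⟨ν, hν1, hν2, hν3⟩ := exists_seminorm_max_iSup φ hφ3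
  have hν4 : ∀ x, ν x ≤ 3 * ‖x‖ := fun x =>
    hν3 x _ (by linarith [norm_nonneg x]) fun n => hφ3 n x
  refine ⟨ν, hν1, hν4, fun P Y hY hfin hP C hC => ?_⟩
  have hφu : ∀ n, φ n (u n) = ((9 / 8 : ℝ) : 𝕜) := fun n => by
    rw [hφx, hDu, hRu n n le_rfl, hψu, map_zero, mul_zero, sub_zero, hu]
    norm_cast
    norm_num
  have hC0 : 0 ≤ C := by
    have h1 := (apply_nonneg ν _).trans (hC (u 0))
    have h2 : 0 < ν (u 0) := lt_of_lt_of_le (by rw [hu]; norm_num) (hν1 (u 0))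
    exact nonneg_of_mul_nonneg_left h1 h2
  have hPb : ∀ x, ‖P x‖ ≤ C * 3 * ‖x‖ := fun x => by
    refine (hν1 _).trans ((hC x).trans ?_)
    rw [mul_assoc]
    exact mul_le_mul_of_nonneg_left (hν4 x) hC0
  have hPu : Tendsto (fun n => u n - P (u n)) atTop (𝓝 0) :=
    tendsto_sub_apply_of_isProj (P := P.mkContinuous _ hPb) (Y := Y)
      ⟨hP.map_mem, hP.map_id⟩ (fun n => (hu n).le) hsum
  obtain ⟨e, he, hPe⟩ := exists_unit_vector_of_isProj hY hP
  -- Up to `η`, `ν (u n) ≥ 9/8` is compared with `C * ν (u n + e/4)`, where the second norm is about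
  -- `1`.
  have key : ∀ η : ℝ, 0 < η → 9 / 8 ≤ C + η * (C + 3) := by
    intro η hη
    obtain ⟨N₁, hN₁⟩ := Metric.tendsto_atTop.1 (hRt e) η hη
    obtain ⟨N₂, hN₂⟩ := Metric.tendsto_atTop.1 hPu η hη
    obtain ⟨n, hn, hdn⟩ := hdense e η hη (max N₁ N₂)
    have hn1 : N₁ ≤ n := (le_max_left _ _).trans hn
    have hn2 : N₂ ≤ n := (le_max_right _ _).trans hn
    have hRe : ∀ m ≥ n, ‖R m e - e‖ ≤ η := fun m hm => by
      have := hN₁ m (hn1.trans hm)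
      rw [dist_eq_norm] at this
      exact this.le
    have hDe : ∀ m ≥ n, ‖D m e‖ ≤ η := fun m hm => by
      -- `D m` annihilates the range of `R m`, so it only sees the small remainder.
      have h1 : D m e = D m (e - R m e) := by rw [map_sub, hDR, sub_zero]
      rw [h1]
      refine (hD m _).trans ?_
      rw [norm_sub_rev]
      exact hRe m hm
    have hQu : ‖u n - P (u n)‖ ≤ η := by
      have := hN₂ n hn2
      rw [dist_zero_right] at this
      exact this.le
    set x := u n + ((1 / 4 : ℝ) : 𝕜) • e with hx
    have h14 : ‖((1 / 4 : ℝ) : 𝕜) • e‖ = 1 / 4 := by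
      rw [norm_smul, he, RCLike.norm_ofReal, abs_of_nonneg (by norm_num), mul_one]
    have hxn : ‖x‖ ≤ 3 / 4 := by
      refine (norm_add_le _ _).trans ?_
      rw [hu, h14]
      norm_num
    have hφe : ∀ m, ‖((1 / 4 : ℝ) : 𝕜) * φ m e‖ ≤ 3 / 4 := fun m => by
      rw [norm_mul, RCLike.norm_ofReal, abs_of_nonneg (by norm_num)]
      have := hφ3 m e
      rw [he] at this
      linarith
    have hνx : ν x ≤ 1 + η := by
      refine hν3 x _ (by linarith) fun m => ?_
      -- For `m < n`, `φ m` does not see `u n` and a quarter of `φ m e` is at most `3/4`. At `m = n`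
      -- the cancellation takes place. For `m > n`, `D m x` is negligible and the other term is at
      -- most half of `‖x‖ ≤ 3/4`.
      rcases lt_trichotomy m n with hmn | rfl | hmn
      · have h1 : φ m (u n) = 0 := by
          rw [hφx, hDu' m n hmn.ne, hRu m n hmn.le]
          simp
        have h2 : φ m x = ((1 / 4 : ℝ) : 𝕜) * φ m e := by
          rw [hx, map_add, h1, zero_add, map_smul, smul_eq_mul]
        rw [h2]
        linarith [hφe m]
      · set ρ := ‖R m (d m)‖ with hρ
        have hRd : ‖R m (d m) - R m e‖ ≤ η := by
          rw [← map_sub]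
          exact (hR m _).trans hdn.le
        have hRem := hRe m le_rfl
        have hRe1 := hR m e
        rw [he] at hRe1
        have hρ1 : ρ ≤ 1 + η := by
          have := norm_sub_norm_le (R m (d m)) (R m e)
          linarith
        have hρ2 : 1 - 2 * η ≤ ρ := by
          have h1 := norm_sub_norm_le e (R m e)
          rw [norm_sub_rev, he] at h1
          have h2 := norm_sub_norm_le (R m e) (R m (d m))
          rw [norm_sub_rev] at h2
          linarith
        -- Replacing `R m e` by `R m (d m)`, on which `θ m` takes the value `ρ ≈ 1`, leaves the main
        -- term `9/8 - 1/8 = 1`.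
        have h2 : φ m x = ((9 / 8 - ρ / 8 : ℝ) : 𝕜) + ((9 / 16 : ℝ) : 𝕜) * ψ m (D m e) +
            ((1 / 8 : ℝ) : 𝕜) * θ m (R m (d m) - R m e) := by
          rw [hx, map_add, hφu, map_smul, smul_eq_mul, hφx, map_sub (θ m), hθd]
          push_cast
          ring
        rw [h2]
        refine (norm_add₃_le).trans ?_
        have h3 := (hle _ (hψ m) (D m e)).trans (hDe m le_rfl)
        have h4 := (hle _ (hθ m) (R m (d m) - R m e)).trans hRd
        rw [norm_mul, norm_mul, RCLike.norm_ofReal, RCLike.norm_ofReal, RCLike.norm_ofReal,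
          abs_of_nonneg (by norm_num : (0 : ℝ) ≤ 9 / 16),
          abs_of_nonneg (by norm_num : (0 : ℝ) ≤ 1 / 8)]
        have h5 : |9 / 8 - ρ / 8| ≤ 1 + η / 4 := abs_le.2 ⟨by linarith, by linarith⟩
        linarith
      · have hDx : ‖D m x‖ ≤ 1 / 4 * η := by
          rw [hx, map_add, hDu' m n hmn.ne', zero_add, map_smul, norm_smul, RCLike.norm_ofReal,
            abs_of_nonneg (by norm_num)]
          have := hDe m hmn.le
          linarith
        linarith [hφn m x, (hR m x).trans hxn]
    have hPx : P x = P (u n) := by rw [hx, map_add, map_smul, hPe, smul_zero, add_zero]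
    have h1 : 9 / 8 ≤ ν (u n) := by
      have := hν2 n (u n)
      rw [hφu, RCLike.norm_ofReal, abs_of_nonneg (by norm_num)] at this
      exact this
    have h2 : ν (u n) ≤ ν (u n - P (u n)) + ν (P (u n)) := by
      have := map_add_le_add ν (u n - P (u n)) (P (u n))
      rwa [sub_add_cancel] at this
    have h3 := (hν4 (u n - P (u n))).trans (mul_le_mul_of_nonneg_left hQu (by norm_num))
    have h4 := (hC x).trans (mul_le_mul_of_nonneg_left hνx hC0)
    rw [hPx] at h4
    linarith
  by_contra! hlt
  have h := key ((9 / 8 - C) / (2 * (C + 3))) (by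
    have : 0 < 9 / 8 - C := by linarith
    positivity)
  have h1 : (9 / 8 - C) / (2 * (C + 3)) * (C + 3) = (9 / 8 - C) / 2 := by
    field_simp
  rw [h1] at h
  linarith

/-! ### Restriction operators on Lorentz spaces -/

namespace Lorentz

theorem rearr_rpow {α : Type*} [MeasurableSpace α] {μ : Measure α} (G : α → ℝ≥0∞) {p : ℝ}
    (hp : 0 < p) (t : ℝ) : rearr μ (fun x => G x ^ p) t = rearr μ G t ^ p := by
  refine eq_of_forall_lt_iff fun s => ?_
  have key : ∀ y : ℝ≥0∞, s < y ^ p ↔ s ^ p⁻¹ < y := fun y => (ENNReal.rpow_inv_lt_iff hp).symm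
  simp only [lt_rearr_iff, key]

section Restriction

variable {𝕜 : Type*} [RCLike 𝕜] {w : ℝ → ℝ} {p : ℝ} {A B : Set ℝ}

open Classical in
/-- Multiplication of (the class of) a function by the indicator of a measurable set. -/
noncomputable def restr (A : Set ℝ) (f : ℝ →ₘ[unitMeasure] 𝕜) : ℝ →ₘ[unitMeasure] 𝕜 :=
  if hA : MeasurableSet A then AEEqFun.mk (A.indicator f) (f.aestronglyMeasurable.indicator hA)
  else 0

theorem coeFn_restr (hA : MeasurableSet A) (f : ℝ →ₘ[unitMeasure] 𝕜) :
    restr A f =ᵐ[unitMeasure] A.indicator f := by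
  rw [restr, dif_pos hA]
  exact AEEqFun.coeFn_mk _ _

theorem restr_add (A : Set ℝ) (f g : ℝ →ₘ[unitMeasure] 𝕜) :
    restr A (f + g) = restr A f + restr A g := by
  by_cases hA : MeasurableSet A
  · refine AEEqFun.ext ?_
    filter_upwards [coeFn_restr hA f, coeFn_restr hA g, coeFn_restr hA (f + g),
      AEEqFun.coeFn_add f g, AEEqFun.coeFn_add (restr A f) (restr A g)] with x h1 h2 h3 h4 h5
    by_cases hx : x ∈ A <;> simp [h1, h2, h3, h4, h5, hx]
  · simp [restr, hA]

theorem restr_smul (A : Set ℝ) (c : 𝕜) (f : ℝ →ₘ[unitMeasure] 𝕜) :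
    restr A (c • f) = c • restr A f := by
  by_cases hA : MeasurableSet A
  · refine AEEqFun.ext ?_
    filter_upwards [coeFn_restr hA f, coeFn_restr hA (c • f),
      AEEqFun.coeFn_smul c f, AEEqFun.coeFn_smul c (restr A f)] with x h1 h2 h3 h4
    by_cases hx : x ∈ A <;> simp [h1, h2, h3, h4, hx]
  · simp only [restr, hA, dite_false]
    exact (smul_zero (A := ℝ →ₘ[unitMeasure] 𝕜) c).symm

theorem restr_univ (f : ℝ →ₘ[unitMeasure] 𝕜) : restr univ f = f := by
  refine AEEqFun.ext ?_
  filter_upwards [coeFn_restr MeasurableSet.univ f] with x h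
  simp [h]

theorem restr_restr (hA : MeasurableSet A) (hB : MeasurableSet B) (f : ℝ →ₘ[unitMeasure] 𝕜) :
    restr A (restr B f) = restr (A ∩ B) f := by
  refine AEEqFun.ext ?_
  filter_upwards [coeFn_restr hB f, coeFn_restr hA (restr B f), coeFn_restr (hA.inter hB) f]
    with x h1 h2 h3
  by_cases hx : x ∈ A <;> by_cases hx' : x ∈ B <;> simp [h1, h2, h3, hx, hx']

theorem restr_union (hA : MeasurableSet A) (hB : MeasurableSet B) (hd : Disjoint A B)
    (f : ℝ →ₘ[unitMeasure] 𝕜) : restr (A ∪ B) f = restr A f + restr B f := by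
  refine AEEqFun.ext ?_
  filter_upwards [coeFn_restr hB f, coeFn_restr hA f, coeFn_restr (hA.union hB) f,
    AEEqFun.coeFn_add (restr A f) (restr B f)] with x h1 h2 h3 h4
  by_cases hx : x ∈ A
  · have hx' : x ∉ B := disjoint_left.1 hd hx
    simp [h1, h2, h3, h4, hx, hx']
  · by_cases hx' : x ∈ B <;> simp [h1, h2, h3, h4, hx, hx']

theorem lorentzENorm_mono (hp : 0 < p) {f g : ℝ →ₘ[unitMeasure] 𝕜}
    (h : ∀ᵐ x ∂unitMeasure, ‖f x‖ₑ ≤ ‖g x‖ₑ) : lorentzENorm w p f ≤ lorentzENorm w p g := by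
  unfold lorentzENorm
  gcongr with t
  exact rearr_mono h t

theorem enorm_restr_le (A : Set ℝ) (f : ℝ →ₘ[unitMeasure] 𝕜) :
    ∀ᵐ x ∂unitMeasure, ‖restr A f x‖ₑ ≤ ‖f x‖ₑ := by
  by_cases hA : MeasurableSet A
  · filter_upwards [coeFn_restr hA f] with x h
    by_cases hx : x ∈ A <;> simp [h, hx]
  · simp only [restr, hA, dite_false]
    filter_upwards [AEEqFun.coeFn_zero (μ := unitMeasure) (α := ℝ) (β := 𝕜)] with x h
    simp [h]

theorem lorentzENorm_rpow (hp : 0 < p) (f : ℝ →ₘ[unitMeasure] 𝕜) :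
    lorentzENorm w p f ^ p = ∫⁻ t in Ioo (0 : ℝ) 1,
      ENNReal.ofReal (w t) * rearr unitMeasure (fun x => ‖f x‖ₑ) t ^ p := by
  rw [lorentzENorm, ← ENNReal.rpow_mul, one_div_mul_cancel hp.ne', ENNReal.rpow_one]

/-- Powers commute with rearrangement, so the `p`-th power of the norm is the `L_{w,1}` norm of the
`p`-th power. The triangle inequality there (exponent `1`, decreasing weight) applies because
pointwise only one of the two summands is present. -/
theorem lorentzENorm_restr_add_restr_rpow_le (hw : IsLorentzWeight w) (hp : 1 ≤ p)
    (hA : MeasurableSet A) (f g : ℝ →ₘ[unitMeasure] 𝕜) :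
    lorentzENorm w p (restr A f + restr Aᶜ g) ^ p ≤
      lorentzENorm w p f ^ p + lorentzENorm w p g ^ p := by
  have hp0 : 0 < p := by linarith
  have hW : AntitoneOn (fun t => ENNReal.ofReal (w t)) (Ioo 0 1) := fun a ha b hb hab =>
    ENNReal.ofReal_le_ofReal (hw.antitoneOn ha hb hab)
  have h := lintegral_weight_rearr_add_le ((aemeasurable_enorm f).pow_const p)
    ((aemeasurable_enorm g).pow_const p) le_rfl hW
  simp only [div_one, ENNReal.rpow_one] at h
  simp only [lorentzENorm_rpow hp0, ← rearr_rpow _ hp0]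
  refine le_trans ?_ h
  gcongr with t
  refine rearr_mono ?_ t
  filter_upwards [coeFn_restr hA f, coeFn_restr hA.compl g,
    AEEqFun.coeFn_add (restr A f) (restr Aᶜ g)] with x h1 h2 h3
  by_cases hx : x ∈ A <;> simp [h1, h2, h3, hx]

/-- Dominated convergence: the rearrangement of a function carried by `A n` vanishes at `t` as soon
as `A n` has measure below `t`. -/
theorem tendsto_lorentzENorm_restr (hw : IsDoublingWeight w) (hp : 0 < p)
    {f : ℝ →ₘ[unitMeasure] 𝕜} (hf : lorentzENorm w p f < ⊤) {A : ℕ → Set ℝ}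
    (hA : ∀ n, MeasurableSet (A n)) (hanti : Antitone A) (h0 : unitMeasure (⋂ n, A n) = 0) :
    Tendsto (fun n => lorentzENorm w p (restr (A n) f)) atTop (𝓝 0) := by
  have hmeas : Tendsto (fun n => unitMeasure (A n)) atTop (𝓝 0) := by
    have := tendsto_measure_iInter_atTop (μ := unitMeasure)
      (fun n => (hA n).nullMeasurableSet) hanti ⟨0, measure_ne_top _ _⟩
    rwa [h0] at this
  have hm : ∀ g : ℝ →ₘ[unitMeasure] 𝕜, AEMeasurable (fun t => ENNReal.ofReal (w t) *
      rearr unitMeasure (fun x => ‖g x‖ₑ) t ^ p) (volume.restrict (Ioo (0 : ℝ) 1)) := fun g =>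
    hw.aemeasurable.ennreal_ofReal.mul (measurable_rearr.pow_const p).aemeasurable
  have hlim : Tendsto (fun n => ∫⁻ t in Ioo (0 : ℝ) 1, ENNReal.ofReal (w t) *
      rearr unitMeasure (fun x => ‖restr (A n) f x‖ₑ) t ^ p) atTop
      (𝓝 (∫⁻ _ in Ioo (0 : ℝ) 1, 0)) := by
    refine tendsto_lintegral_of_dominated_convergence'
      (fun t => ENNReal.ofReal (w t) * rearr unitMeasure (fun x => ‖f x‖ₑ) t ^ p)
      (fun n => hm _) (fun n => Eventually.of_forall fun t => ?_)
      ((lorentzENorm_lt_top_iff hp f).1 hf).ne ?_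
    · exact mul_le_mul' le_rfl (ENNReal.rpow_le_rpow (rearr_mono (enorm_restr_le _ f) t) hp.le)
    · refine (ae_restrict_iff' measurableSet_Ioo).2 (Eventually.of_forall fun t ht => ?_)
      refine tendsto_const_nhds.congr' ?_
      filter_upwards [hmeas.eventually_lt_const (ENNReal.ofReal_pos.2 ht.1)] with n hn
      have hz : rearr unitMeasure (fun x => ‖restr (A n) f x‖ₑ) t = 0 := by
        rw [← nonpos_iff_eq_zero, rearr_le_iff]
        refine le_trans (measure_mono_ae ?_) hn.le
        filter_upwards [coeFn_restr (hA n) f] with x hx hx'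
        by_contra hxA
        have hxA' : x ∉ A n := hxA
        have hx'' : 0 < ‖restr (A n) f x‖ₑ := hx'
        simp [hx, hxA'] at hx''
      rw [hz, ENNReal.zero_rpow_of_pos hp, mul_zero]
  rw [lintegral_zero] at hlim
  have := (ENNReal.continuous_rpow_const (y := 1 / p)).tendsto 0
  rw [ENNReal.zero_rpow_of_pos (by positivity)] at this
  exact this.comp hlim

/-- Restriction to `A` on the linear space of functions with `‖f‖_{w,p} < ∞`. -/
noncomputable def restrₗ (hw : IsDoublingWeight w) (hp : 0 < p) (A : Set ℝ) :
    lorentzSubmodule 𝕜 w p hw hp →ₗ[𝕜] lorentzSubmodule 𝕜 w p hw hp where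
  toFun f := ⟨restr A f.1, (lorentzENorm_mono hp (enorm_restr_le A f.1)).trans_lt f.2⟩
  map_add' f g := Subtype.ext (restr_add A f.1 g.1)
  map_smul' c f := Subtype.ext (restr_smul A c f.1)

theorem exists_finite_partition_lt {η : ℝ≥0∞} (hη : 0 < η) :
    ∃ (N : ℕ) (c : ℝ → ℕ), Measurable c ∧ (∀ x, c x < N) ∧
      ∀ i, unitMeasure (c ⁻¹' {i}) < η := by
  obtain ⟨N, hN⟩ := ENNReal.exists_inv_nat_lt hη.ne'
  have hN0 : (0 : ℝ) < N := by
    rcases Nat.eq_zero_or_pos N with rfl | h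
    · simp at hN
    · exact_mod_cast h
  -- The cap bounds the colours off `[0,1]`, where the measure sees nothing; the extra colour `N`
  -- serves `x = 1`.
  refine ⟨N + 1, fun x => min ⌊N * x⌋₊ N, ?_, fun x => ?_, fun i => ?_⟩
  · exact (Nat.measurable_floor.comp (measurable_id.const_mul (N : ℝ))).min measurable_const
  · exact Nat.lt_succ_of_le (min_le_right _ _)
  · refine lt_of_le_of_lt ?_ hN
    have hsub : (fun x : ℝ => min ⌊N * x⌋₊ N) ⁻¹' {i} ∩ Icc 0 1 ⊆
        Icc ((i : ℝ) / N) ((i + 1) / N) := by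
      rintro x ⟨hx, hx0, hx1⟩
      have hx' : min ⌊N * x⌋₊ N = i := hx
      have hfl : ⌊N * x⌋₊ ≤ N := Nat.floor_le_of_le (by nlinarith)
      rw [min_eq_left hfl] at hx'
      have h1 := Nat.floor_le (show 0 ≤ (N : ℝ) * x by positivity)
      have h2 := Nat.lt_floor_add_one ((N : ℝ) * x)
      rw [hx'] at h1 h2
      rw [mem_Icc, div_le_iff₀ hN0, le_div_iff₀ hN0]
      constructor <;> linarith
    rw [unitMeasure, Measure.restrict_apply' measurableSet_Icc]
    refine (measure_mono hsub).trans ?_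
    rw [Real.volume_Icc, ← sub_div, add_sub_cancel_left, one_div, ENNReal.ofReal_inv_of_pos hN0,
      ENNReal.ofReal_natCast]

end Restriction

/-! ### The dual of `L_{w,p}` -/

section Lorentz

variable {𝕜 : Type*} [RCLike 𝕜] {w : ℝ → ℝ} {p : ℝ}

/-- Restriction to `A` as a contraction of a Lorentz space. -/
noncomputable def LorentzSpace.band (hw : IsLorentzWeight w) (hp : 1 ≤ p) (A : Set ℝ) :
    LorentzSpace 𝕜 w p hw hp →L[𝕜] LorentzSpace 𝕜 w p hw hp :=
  LinearMap.mkContinuous (restrₗ hw.isDoublingWeight (zero_lt_one.trans_le hp) A :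
    LorentzSpace 𝕜 w p hw hp →ₗ[𝕜] LorentzSpace 𝕜 w p hw hp) 1 fun f => by
      rw [one_mul]
      exact ENNReal.toReal_mono f.2.ne
        (lorentzENorm_mono (zero_lt_one.trans_le hp) (enorm_restr_le A f.1))

theorem LorentzSpace.bandProjections (hw : IsLorentzWeight w) (hp : 1 ≤ p) :
    BandProjections unitMeasure p (LorentzSpace.band (𝕜 := 𝕜) hw hp) where
  univ := ContinuousLinearMap.ext fun f => Subtype.ext (restr_univ f.1)
  inter hA hB f := Subtype.ext (restr_restr hA hB f.1)
  union hA hB hd f := Subtype.ext (restr_union hA hB hd f.1)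
  upper {A} hA f g := by
    have h := lorentzENorm_restr_add_restr_rpow_le hw hp hA f.1 g.1
    have hp0 : 0 < p := by linarith
    have hfin : ∀ f : LorentzSpace 𝕜 w p hw hp, lorentzENorm w p f.1 ^ p ≠ ⊤ := fun f =>
      ENNReal.rpow_ne_top_of_nonneg hp0.le f.2.ne
    have h1 := ENNReal.toReal_mono (ENNReal.add_ne_top.2 ⟨hfin f, hfin g⟩) h
    rw [ENNReal.toReal_add (hfin f) (hfin g), ← ENNReal.toReal_rpow, ← ENNReal.toReal_rpow,
      ← ENNReal.toReal_rpow] at h1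
    exact h1
  tendsto hA hanti h0 f := by
    rw [tendsto_zero_iff_norm_tendsto_zero]
    have h := tendsto_lorentzENorm_restr hw.isDoublingWeight (zero_lt_one.trans_le hp) f.2 hA
      hanti h0
    exact (ENNReal.tendsto_toReal ENNReal.zero_ne_top).comp h

theorem exists_le_norm_of_isProj_dual {p : ℝ} (hp : 2 < p) :
    ∃ k : ℝ, 1 < k ∧ ∀ (w : ℝ → ℝ) (hw : IsLorentzWeight w)
      (P : StrongDual 𝕜 (LorentzSpace 𝕜 w p hw (one_le_two.trans hp.le)) →L[𝕜]
        StrongDual 𝕜 (LorentzSpace 𝕜 w p hw (one_le_two.trans hp.le)))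
      (Y : Submodule 𝕜 (StrongDual 𝕜 (LorentzSpace 𝕜 w p hw (one_le_two.trans hp.le)))),
      Y ≠ ⊤ → FiniteDimensional 𝕜
        (StrongDual 𝕜 (LorentzSpace 𝕜 w p hw (one_le_two.trans hp.le)) ⧸ Y) →
      LinearMap.IsProj Y P → k ≤ ‖P‖ := by
  have hpq := Real.HolderConjugate.conjExponent (show 1 < p by linarith)
  set q := p.conjExponent with hq
  have hq1 : 1 < q := hpq.symm.lt
  have hq2 : q < 2 := by
    rw [hq, Real.conjExponent, div_lt_iff₀ (by linarith)]
    linarith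
  obtain ⟨n, hn⟩ := exists_projection_constant hq1 hq2
  refine ⟨_, Real.one_lt_rpow hn (show 0 < 1 / q by positivity), fun w hw P Y hY hfin hP => ?_⟩
  exact (LorentzSpace.bandProjections hw (one_le_two.trans hp.le)).le_norm_of_isProj hpq hq2
    (fun η hη => exists_finite_partition_lt hη) n P Y hY hfin hP

end Lorentz

end Lorentz

/-! ### Hardy's inequality and the norm `‖f**‖_{p,q}` -/

namespace Lorentz

theorem setLIntegral_Ioo_rpow {r t : ℝ} (hr : -1 < r) (ht : 0 < t) :
    ∫⁻ s in Ioo 0 t, ENNReal.ofReal (s ^ r) = ENNReal.ofReal (t ^ (r + 1) / (r + 1)) := by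
  have hint : IntegrableOn (fun s : ℝ => s ^ r) (Ioo 0 t) :=
    (intervalIntegral.integrableOn_Ioo_rpow_iff ht).2 hr
  rw [← ofReal_integral_eq_lintegral_ofReal hint, ← integral_Ioc_eq_integral_Ioo,
    ← intervalIntegral.integral_of_le ht.le, integral_rpow (Or.inl hr),
    Real.zero_rpow (by linarith), sub_zero]
  exact (ae_restrict_iff' measurableSet_Ioo).2 (Eventually.of_forall fun s hs =>
    Real.rpow_nonneg hs.1.le _)

theorem setLIntegral_Ioi_rpow {b s : ℝ} (hb : 0 < b) (hs : 0 < s) :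
    ∫⁻ t in Ioi s, ENNReal.ofReal (t ^ (-b - 1)) = ENNReal.ofReal (s ^ (-b) / b) := by
  have hint : IntegrableOn (fun t : ℝ => t ^ (-b - 1)) (Ioi s) :=
    integrableOn_Ioi_rpow_of_lt (by linarith) hs
  rw [← ofReal_integral_eq_lintegral_ofReal hint, integral_Ioi_rpow_of_lt (by linarith) hs]
  · congr 1
    rw [sub_add_cancel, neg_div_neg_eq]
  · exact (ae_restrict_iff' measurableSet_Ioi).2 (Eventually.of_forall fun t ht =>
      Real.rpow_nonneg (hs.trans ht).le _)

/-- Tonelli's theorem on the triangle `0 < s < t < 1`. -/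
theorem lintegral_triangle_le {g h : ℝ → ℝ≥0∞} (hg : Measurable g) (hh : Measurable h) :
    ∫⁻ t in Ioo (0 : ℝ) 1, g t * ∫⁻ s in Ioo 0 t, h s ≤
      ∫⁻ s in Ioo (0 : ℝ) 1, h s * ∫⁻ t in Ioi s, g t := by
  set k : ℝ → ℝ → ℝ≥0∞ := fun t s =>
    {z : ℝ × ℝ | z.2 < z.1}.indicator (fun z => g z.1 * h z.2) (t, s) with hk
  have hkm : Measurable (Function.uncurry k) :=
    ((hg.comp measurable_fst).mul (hh.comp measurable_snd)).indicator
      (measurableSet_lt measurable_snd measurable_fst)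
  have h1 : ∀ t ∈ Ioo (0 : ℝ) 1, g t * ∫⁻ s in Ioo 0 t, h s ≤ ∫⁻ s in Ioo (0 : ℝ) 1, k t s := by
    intro t ht
    rw [← lintegral_const_mul _ hh]
    calc ∫⁻ s in Ioo 0 t, g t * h s = ∫⁻ s in Ioo 0 t, k t s :=
          setLIntegral_congr_fun measurableSet_Ioo fun s hs => by simp [hk, hs.2]
      _ ≤ _ := lintegral_mono_set (Ioo_subset_Ioo_right ht.2.le)
  calc ∫⁻ t in Ioo (0 : ℝ) 1, g t * ∫⁻ s in Ioo 0 t, h s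
      ≤ ∫⁻ t in Ioo (0 : ℝ) 1, ∫⁻ s in Ioo (0 : ℝ) 1, k t s :=
        setLIntegral_mono' measurableSet_Ioo h1
    _ = ∫⁻ s in Ioo (0 : ℝ) 1, ∫⁻ t in Ioo (0 : ℝ) 1, k t s :=
        lintegral_lintegral_swap hkm.aemeasurable
    _ ≤ ∫⁻ s in Ioo (0 : ℝ) 1, h s * ∫⁻ t in Ioi s, g t := by
        refine lintegral_mono fun s => ?_
        have e1 : ∀ t, k t s = (Ioi s).indicator (fun t => h s * g t) t := fun t => by
          by_cases hst : s < t <;> simp [hk, hst, mul_comm]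
        simp only [e1]
        refine (setLIntegral_le_lintegral _ _).trans ?_
        rw [lintegral_indicator measurableSet_Ioi, lintegral_const_mul _ hg]

theorem ofReal_rpow_mul_ofReal_rpow {s : ℝ} (hs : 0 < s) (a b : ℝ) :
    ENNReal.ofReal (s ^ a) * ENNReal.ofReal (s ^ b) = ENNReal.ofReal (s ^ (a + b)) := by
  rw [← ENNReal.ofReal_mul (by positivity), Real.rpow_add hs]

/-- Hölder applied to `F = (s^a F) s^{-a}`; the condition on `a` makes `s^{-a q'}` integrable at
`0`. -/
theorem rpow_setLIntegral_le {q q' a : ℝ} (hq : q.HolderConjugate q') (ha : a * q' < 1)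
    {F : ℝ → ℝ≥0∞} (hF : Measurable F) {t : ℝ} (ht : 0 < t) :
    (∫⁻ s in Ioo 0 t, F s) ^ q ≤
      ENNReal.ofReal ((1 / (1 - a * q')) ^ (q - 1) * t ^ (q - 1 - a * q)) *
        ∫⁻ s in Ioo 0 t, ENNReal.ofReal (s ^ (a * q)) * F s ^ q := by
  have hq0 := hq.pos
  have hq0' := hq.symm.pos
  have hm : ∀ r : ℝ, Measurable fun s : ℝ => ENNReal.ofReal (s ^ r) := fun r =>
    (measurable_id.pow_const r).ennreal_ofReal
  have h1 : ∫⁻ s in Ioo 0 t, F s =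
      ∫⁻ s in Ioo 0 t, ((fun s => ENNReal.ofReal (s ^ a) * F s) *
        fun s => ENNReal.ofReal (s ^ (-a))) s :=
    setLIntegral_congr_fun measurableSet_Ioo fun s hs => by
      change F s = (ENNReal.ofReal (s ^ a) * F s) * ENNReal.ofReal (s ^ (-a))
      rw [mul_right_comm, ofReal_rpow_mul_ofReal_rpow hs.1, add_neg_cancel, Real.rpow_zero,
        ENNReal.ofReal_one, one_mul]
  have h2 := ENNReal.lintegral_mul_le_Lp_mul_Lq (volume.restrict (Ioo 0 t)) hq
    ((hm a).mul hF).aemeasurable (hm (-a)).aemeasurable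
  replace h2 : ∫⁻ s in Ioo 0 t, F s ≤ (∫⁻ s in Ioo 0 t, (ENNReal.ofReal (s ^ a) * F s) ^ q) ^
      (1 / q) * (∫⁻ s in Ioo 0 t, ENNReal.ofReal (s ^ (-a)) ^ q') ^ (1 / q') := h1.le.trans h2
  have h3 : ∫⁻ s in Ioo 0 t, (ENNReal.ofReal (s ^ a) * F s) ^ q =
      ∫⁻ s in Ioo 0 t, ENNReal.ofReal (s ^ (a * q)) * F s ^ q :=
    setLIntegral_congr_fun measurableSet_Ioo fun s hs => by
      have := hs.1
      change (ENNReal.ofReal (s ^ a) * F s) ^ q = _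
      rw [ENNReal.mul_rpow_of_nonneg _ _ hq0.le,
        ENNReal.ofReal_rpow_of_nonneg (by positivity) hq0.le, ← Real.rpow_mul this.le]
  have h4 : ∫⁻ s in Ioo 0 t, ENNReal.ofReal (s ^ (-a)) ^ q' =
      ENNReal.ofReal (t ^ (1 - a * q') / (1 - a * q')) := by
    rw [← show -(a * q') + 1 = 1 - a * q' by ring, ← setLIntegral_Ioo_rpow (by linarith) ht]
    refine setLIntegral_congr_fun measurableSet_Ioo fun s hs => ?_
    have := hs.1
    change ENNReal.ofReal (s ^ (-a)) ^ q' = _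
    rw [ENNReal.ofReal_rpow_of_nonneg (by positivity) hq0'.le, ← Real.rpow_mul this.le, neg_mul]
  have h5 : (1 : ℝ) / q' * q = q - 1 := by
    have := hq.mul_eq_add
    field_simp
    linarith
  have h6 : 0 < 1 - a * q' := by linarith
  have h7 : (∫⁻ s in Ioo 0 t, F s) ^ q ≤ ((∫⁻ s in Ioo 0 t, (ENNReal.ofReal (s ^ a) * F s) ^ q) ^
      (1 / q) * (∫⁻ s in Ioo 0 t, ENNReal.ofReal (s ^ (-a)) ^ q') ^ (1 / q')) ^ q :=
    ENNReal.rpow_le_rpow h2 hq0.le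
  rw [ENNReal.mul_rpow_of_nonneg _ _ hq0.le, ← ENNReal.rpow_mul, ← ENNReal.rpow_mul,
    one_div_mul_cancel hq0.ne', ENNReal.rpow_one, h5, h3, h4,
    ENNReal.ofReal_rpow_of_nonneg (by positivity) (by linarith [hq.lt]), mul_comm] at h7
  have h8 : (t ^ (1 - a * q') / (1 - a * q')) ^ (q - 1) =
      (1 / (1 - a * q')) ^ (q - 1) * t ^ (q - 1 - a * q) := by
    have h9 : (1 - a * q') * (q - 1) = q - 1 - a * q := by
      have := hq.mul_eq_add
      linear_combination (-a) * this
    rw [div_eq_mul_one_div, Real.mul_rpow (by positivity) (by positivity), ← Real.rpow_mul ht.le,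
      h9, mul_comm]
  rwa [h8] at h7

/-- Hardy's inequality for the weight of `L_{p,q}`. -/
theorem exists_hardy {p q : ℝ} (hp : 1 < p) (hq : 1 < q) : ∃ C : ℝ, ∀ F : ℝ → ℝ≥0∞,
    Measurable F → ∫⁻ t in Ioo (0 : ℝ) 1, ENNReal.ofReal (lpqWeight p q t) *
      (ENNReal.ofReal t⁻¹ * ∫⁻ s in Ioo 0 t, F s) ^ q ≤
    ENNReal.ofReal C * ∫⁻ t in Ioo (0 : ℝ) 1, ENNReal.ofReal (lpqWeight p q t) * F t ^ q := by
  have hpq := Real.HolderConjugate.conjExponent hq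
  set q' := q.conjExponent with hq'
  have hq0 : 0 < q := by linarith
  have hp0 : 0 < p := by linarith
  have hmul := hpq.mul_eq_add
  have hq0' := hpq.symm.pos
  -- The midpoint of the admissible interval: `a < 1 - 1/q` is needed for Hölder near `0`, and `a >
  -- 1/p - 1/q`, that is `b > 0`, for the tail integral after Tonelli. It is nonempty because `p >
  -- 1`.
  set a := (1 / p + 1) / 2 - 1 / q with ha
  have hp1 : 1 / p < 1 := by rw [div_lt_one hp0]; exact hp
  have hq1 : 1 / q * q' = q' - 1 := by
    field_simp; linarith
  have haq' : a * q' < 1 := by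
    have h1 : a * q' = (1 / p + 1) / 2 * q' - (q' - 1) := by rw [ha, sub_mul, hq1]
    rw [h1]
    nlinarith
  set b := a * q + 1 - q / p with hb
  have hb0 : 0 < b := by
    have h1 : b = (1 - 1 / p) / 2 * q := by
      rw [hb, ha]; field_simp; ring
    rw [h1]
    have : 0 < 1 - 1 / p := by linarith
    positivity
  set K := (1 / (1 - a * q')) ^ (q - 1) with hK
  have hK0 : 0 ≤ K := Real.rpow_nonneg (by rw [one_div_nonneg]; linarith) _
  have hm : ∀ r : ℝ, Measurable fun s : ℝ => ENNReal.ofReal (s ^ r) := fun r =>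
    (measurable_id.pow_const r).ennreal_ofReal
  refine ⟨K / b, fun F hF => ?_⟩
  have hqp : 0 < q / p := by positivity
  calc ∫⁻ t in Ioo (0 : ℝ) 1, ENNReal.ofReal (lpqWeight p q t) *
        (ENNReal.ofReal t⁻¹ * ∫⁻ s in Ioo 0 t, F s) ^ q
      ≤ ∫⁻ t in Ioo (0 : ℝ) 1, (ENNReal.ofReal (q / p * K) * ENNReal.ofReal (t ^ (-b - 1))) *
          ∫⁻ s in Ioo 0 t, ENNReal.ofReal (s ^ (a * q)) * F s ^ q := by
        refine setLIntegral_mono' measurableSet_Ioo fun t ht => ?_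
        have ht0 := ht.1
        rw [ENNReal.mul_rpow_of_nonneg _ _ hq0.le]
        refine (mul_le_mul' le_rfl (mul_le_mul' le_rfl
          (rpow_setLIntegral_le hpq haq' hF ht0))).trans (le_of_eq ?_)
        rw [← mul_assoc, ← mul_assoc]
        congr 1
        rw [ENNReal.ofReal_rpow_of_nonneg (by positivity) hq0.le, lpqWeight,
          ← ENNReal.ofReal_mul (by positivity), ← ENNReal.ofReal_mul (by positivity),
          ← ENNReal.ofReal_mul (by positivity)]
        congr 1
        have h1 : t ^ (q / p - 1) * (t⁻¹) ^ q * t ^ (q - 1 - a * q) = t ^ (-b - 1) := by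
          rw [← Real.rpow_neg_one t, ← Real.rpow_mul ht0.le, ← Real.rpow_add ht0,
            ← Real.rpow_add ht0]
          congr 1
          rw [hb]; ring
        rw [← h1]
        ring
    _ ≤ ∫⁻ s in Ioo (0 : ℝ) 1, (ENNReal.ofReal (s ^ (a * q)) * F s ^ q) *
          ∫⁻ t in Ioi s, ENNReal.ofReal (q / p * K) * ENNReal.ofReal (t ^ (-b - 1)) :=
        lintegral_triangle_le ((hm _).const_mul _) ((hm _).mul (hF.pow_const q))
    _ = ∫⁻ s in Ioo (0 : ℝ) 1, ENNReal.ofReal (K / b) *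
          (ENNReal.ofReal (lpqWeight p q s) * F s ^ q) := by
        refine setLIntegral_congr_fun measurableSet_Ioo fun s hs => ?_
        have hs0 := hs.1
        change (ENNReal.ofReal (s ^ (a * q)) * F s ^ q) * ∫⁻ t in Ioi s,
          ENNReal.ofReal (q / p * K) * ENNReal.ofReal (t ^ (-b - 1)) = _
        rw [lintegral_const_mul _ (hm _), setLIntegral_Ioi_rpow hb0 hs0, mul_right_comm,
          ← ENNReal.ofReal_mul (by positivity), ← ENNReal.ofReal_mul (by positivity),
          ← mul_assoc (ENNReal.ofReal (K / b)), ← ENNReal.ofReal_mul (by positivity), lpqWeight]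
        congr 2
        have h1 : s ^ (q / p - 1) = s ^ (a * q) * s ^ (-b) := by
          rw [← Real.rpow_add hs0]
          congr 1
          rw [hb]; ring
        rw [h1]
        ring
    _ = _ := lintegral_const_mul' _ _ ENNReal.ofReal_ne_top

section Averaged

variable {𝕜 : Type*} [RCLike 𝕜] {p q : ℝ}

/-- The functional `‖f**‖_{p,q}`, where `f**(t) = t⁻¹ ∫_0^t f*`. -/
noncomputable def averagedENorm (p q : ℝ) (f : ℝ →ₘ[unitMeasure] 𝕜) : ℝ≥0∞ :=
  (∫⁻ t in Ioo (0 : ℝ) 1, ENNReal.ofReal (lpqWeight p q t) *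
    (ENNReal.ofReal t⁻¹ * ∫⁻ s in Ioo 0 t, rearr unitMeasure (fun x => ‖f x‖ₑ) s) ^ q) ^ (1 / q)

theorem averagedENorm_mono (hq : 0 < q) {f g : ℝ →ₘ[unitMeasure] 𝕜}
    (h : ∀ᵐ x ∂unitMeasure, ‖f x‖ₑ ≤ ‖g x‖ₑ) : averagedENorm p q f ≤ averagedENorm p q g := by
  unfold averagedENorm
  gcongr with t s
  exact rearr_mono h s

theorem lorentzENorm_le_averagedENorm (hq : 0 < q) (f : ℝ →ₘ[unitMeasure] 𝕜) :
    lorentzENorm (lpqWeight p q) q f ≤ averagedENorm p q f := by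
  unfold lorentzENorm averagedENorm
  refine ENNReal.rpow_le_rpow (setLIntegral_mono' measurableSet_Ioo fun t ht => ?_) (by positivity)
  refine mul_le_mul' le_rfl (ENNReal.rpow_le_rpow ?_ hq.le)
  set r := rearr unitMeasure (fun x => ‖f x‖ₑ) t
  calc r = ENNReal.ofReal t⁻¹ * (r * volume (Ioo 0 t)) := by
        rw [Real.volume_Ioo, sub_zero, mul_comm r, ← mul_assoc,
          ← ENNReal.ofReal_mul (inv_nonneg.2 ht.1.le), inv_mul_cancel₀ ht.1.ne',
          ENNReal.ofReal_one, one_mul]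
    _ = ENNReal.ofReal t⁻¹ * ∫⁻ _ in Ioo 0 t, r := by rw [setLIntegral_const]
    _ ≤ _ := mul_le_mul' le_rfl (setLIntegral_mono' measurableSet_Ioo fun s hs =>
        rearr_antitone hs.2.le)

theorem exists_averagedENorm_le (𝕜 : Type*) [RCLike 𝕜] (hp : 1 < p) (hq : 1 < q) :
    ∃ C : ℝ, ∀ f : ℝ →ₘ[unitMeasure] 𝕜,
      averagedENorm p q f ≤ ENNReal.ofReal C * lorentzENorm (lpqWeight p q) q f := by
  obtain ⟨C, hC⟩ := exists_hardy hp hq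
  have hq0 : 0 < 1 / q := by positivity
  refine ⟨(max C 0) ^ (1 / q), fun f => ?_⟩
  unfold lorentzENorm averagedENorm
  rw [← ENNReal.ofReal_rpow_of_nonneg (le_max_right _ _) hq0.le,
    ← ENNReal.mul_rpow_of_nonneg _ _ hq0.le]
  refine ENNReal.rpow_le_rpow ((hC _ measurable_rearr).trans (mul_le_mul' ?_ le_rfl)) hq0.le
  exact ENNReal.ofReal_le_ofReal (le_max_left _ _)

/-- Unlike `f*`, the average `f**` is subadditive in `f`, whatever the monotonicity of the weight;
Minkowski in `L_q` finishes, with the weight absorbed as its `q`-th root `V`. -/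
theorem averagedENorm_add_le (hq : 1 ≤ q) (f g : ℝ →ₘ[unitMeasure] 𝕜) :
    averagedENorm p q (f + g) ≤ averagedENorm p q f + averagedENorm p q g := by
  have hq0 : 0 < q := by linarith
  set V : ℝ → ℝ≥0∞ := fun t => ENNReal.ofReal (lpqWeight p q t) ^ (1 / q) with hV
  set A : (ℝ →ₘ[unitMeasure] 𝕜) → ℝ → ℝ≥0∞ := fun f t =>
    V t * (ENNReal.ofReal t⁻¹ * ∫⁻ s in Ioo 0 t, rearr unitMeasure (fun x => ‖f x‖ₑ) s) with hA
  have hAf : ∀ f, averagedENorm p q f = (∫⁻ t in Ioo (0 : ℝ) 1, A f t ^ q) ^ (1 / q) := fun f => by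
    unfold averagedENorm
    congr 1
    refine lintegral_congr fun t => ?_
    rw [hA, hV]
    simp only
    rw [ENNReal.mul_rpow_of_nonneg (ENNReal.ofReal (lpqWeight p q t) ^ (1 / q)) _ hq0.le,
      ← ENNReal.rpow_mul, one_div_mul_cancel hq0.ne', ENNReal.rpow_one]
  have hVm : Measurable V :=
    (((measurable_id.pow_const _).const_mul _).ennreal_ofReal).pow_const _
  have hAm : ∀ f, Measurable (A f) := fun f => by
    refine hVm.mul ((measurable_id.inv.ennreal_ofReal).mul (Monotone.measurable ?_))
    exact fun a b hab => lintegral_mono_set (Ioo_subset_Ioo_right hab)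
  have hAadd : ∀ t ∈ Ioo (0 : ℝ) 1, A (f + g) t ≤ (A f + A g) t := fun t ht => by
    have h := setLIntegral_rearr_add_le (aemeasurable_enorm f) (aemeasurable_enorm g) le_rfl
      (measurableSet_Ioo (a := (0 : ℝ)) (b := t)) (Ioo_subset_Ioo_right ht.2.le)
      (fun s hs s' hs' hle => ⟨hs'.1, hle.trans_lt hs.2⟩)
    simp only [div_one, ENNReal.rpow_one] at h
    rw [Pi.add_apply, hA]
    simp only
    rw [← mul_add, ← mul_add]
    gcongr
    refine le_trans ?_ h
    gcongr with s
    exact rearr_enorm_add_le f g s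
  rw [hAf, hAf, hAf]
  refine le_trans ?_ (ENNReal.lintegral_Lp_add_le (hAm f).aemeasurable (hAm g).aemeasurable hq)
  exact ENNReal.rpow_le_rpow (setLIntegral_mono' measurableSet_Ioo fun t ht =>
    ENNReal.rpow_le_rpow (hAadd t ht) hq0.le) (by positivity)

theorem averagedENorm_smul (hq : 0 < q) (c : 𝕜) (f : ℝ →ₘ[unitMeasure] 𝕜) :
    averagedENorm p q (c • f) = ‖c‖ₑ * averagedENorm p q f := by
  rcases eq_or_ne c 0 with rfl | hc
  · have h0 : (0 : 𝕜) • f = 0 := zero_smul 𝕜 f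
    have h1 : ∀ s, rearr unitMeasure (fun x => ‖(0 : ℝ →ₘ[unitMeasure] 𝕜) x‖ₑ) s = 0 := fun s => by
      have h : (fun x => ‖(0 : ℝ →ₘ[unitMeasure] 𝕜) x‖ₑ) =ᵐ[unitMeasure] fun _ => 0 :=
        (AEEqFun.coeFn_zero (β := 𝕜)).mono fun x hx => by simp [hx]
      rw [rearr_congr h, ← nonpos_iff_eq_zero, rearr_le_iff]
      simp
    rw [h0, enorm_zero, zero_mul]
    unfold averagedENorm
    simp only [h1, lintegral_zero, mul_zero]
    simp [ENNReal.zero_rpow_of_pos hq, hq]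
  have h : (fun x => ‖(c • f) x‖ₑ) =ᵐ[unitMeasure] fun x => ‖c‖ₑ * ‖f x‖ₑ :=
    (AEEqFun.coeFn_smul c f).mono fun x hx => by
      simp only [hx, Pi.smul_apply, smul_eq_mul, enorm_mul]
  have hct : ‖c‖ₑ ^ q ≠ ⊤ := ENNReal.rpow_ne_top_of_nonneg hq.le enorm_ne_top
  unfold averagedENorm
  rw [rearr_congr h]
  simp only [rearr_const_mul (enorm_ne_zero.2 hc) enorm_ne_top,
    lintegral_const_mul' _ _ enorm_ne_top, mul_left_comm _ ‖c‖ₑ,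
    ENNReal.mul_rpow_of_nonneg _ _ hq.le, mul_left_comm _ (‖c‖ₑ ^ q)]
  rw [lintegral_const_mul' _ _ hct, ENNReal.mul_rpow_of_nonneg _ _ (by positivity),
    ← ENNReal.rpow_mul, mul_one_div_cancel hq.ne', ENNReal.rpow_one]

end Averaged

end Lorentz

/-! ### `L_{p,q}` as a separable normed space -/

namespace Lorentz

variable {𝕜 : Type*} [RCLike 𝕜] {p q : ℝ} {hp : 1 < p} {hq : 1 < q}

theorem lintegral_lpqWeight_Ioo (hp : 0 < p) (hq : 0 < q) {t : ℝ} (ht : 0 < t) :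
    ∫⁻ s in Ioo 0 t, ENNReal.ofReal (lpqWeight p q s) = ENNReal.ofReal (t ^ (q / p)) := by
  have hqp : 0 < q / p := by positivity
  simp only [lpqWeight, ENNReal.ofReal_mul hqp.le]
  rw [lintegral_const_mul' _ _ ENNReal.ofReal_ne_top,
    setLIntegral_Ioo_rpow (by linarith) ht, ← ENNReal.ofReal_mul hqp.le, sub_add_cancel,
    mul_div_cancel₀ _ hqp.ne']

theorem averagedENorm_lt_top (hp : 1 < p) (hq : 1 < q) {f : ℝ →ₘ[unitMeasure] 𝕜}
    (hf : lorentzENorm (lpqWeight p q) q f < ⊤) : averagedENorm p q f < ⊤ := by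
  obtain ⟨C, hC⟩ := exists_averagedENorm_le 𝕜 hp hq
  exact (hC f).trans_lt (ENNReal.mul_lt_top ENNReal.ofReal_lt_top hf)

/-- The space `L_{p,q}`, normed by `‖f**‖_{p,q}`. -/
def AveragedLpq (𝕜 : Type*) [RCLike 𝕜] (p q : ℝ) (hp : 1 < p) (hq : 1 < q) : Type _ :=
  LpqSpace 𝕜 p q hp hq

namespace AveragedLpq

noncomputable instance : AddCommGroup (AveragedLpq 𝕜 p q hp hq) :=
  inferInstanceAs (AddCommGroup (LpqSpace 𝕜 p q hp hq))

noncomputable instance : Module 𝕜 (AveragedLpq 𝕜 p q hp hq) :=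
  inferInstanceAs (Module 𝕜 (LpqSpace 𝕜 p q hp hq))

noncomputable instance : Norm (AveragedLpq 𝕜 p q hp hq) where
  norm f := (averagedENorm p q f.1).toReal

theorem norm_def (f : AveragedLpq 𝕜 p q hp hq) : ‖f‖ = (averagedENorm p q f.1).toReal := rfl

theorem averagedENorm_ne_top (f : AveragedLpq 𝕜 p q hp hq) : averagedENorm p q f.1 ≠ ⊤ :=
  (averagedENorm_lt_top hp hq f.2).ne

theorem lpqNorm_le_norm (f : AveragedLpq 𝕜 p q hp hq) :
    lpqNorm (𝕜 := 𝕜) (p := p) (q := q) (hp := hp) (hq := hq) f ≤ ‖f‖ :=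
  ENNReal.toReal_mono f.averagedENorm_ne_top (lorentzENorm_le_averagedENorm (by linarith) f.1)

theorem normedSpaceCore : NormedSpace.Core 𝕜 (AveragedLpq 𝕜 p q hp hq) where
  norm_nonneg _ := ENNReal.toReal_nonneg
  norm_smul c f := by
    have h : averagedENorm p q (c • f.1) = ‖c‖ₑ * averagedENorm p q f.1 :=
      averagedENorm_smul (by linarith) c f.1
    change (averagedENorm p q (c • f.1)).toReal = ‖c‖ * (averagedENorm p q f.1).toReal
    rw [h, ENNReal.toReal_mul, toReal_enorm]
  norm_triangle f g := by
    have h := averagedENorm_add_le (p := p) hq.le f.1 g.1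
    change (averagedENorm p q (f.1 + g.1)).toReal ≤
      (averagedENorm p q f.1).toReal + (averagedENorm p q g.1).toReal
    rw [← ENNReal.toReal_add f.averagedENorm_ne_top g.averagedENorm_ne_top]
    exact ENNReal.toReal_mono
      (ENNReal.add_ne_top.2 ⟨f.averagedENorm_ne_top, g.averagedENorm_ne_top⟩) h
  norm_eq_zero_iff f := by
    have hq0 : 0 < q := by linarith
    rw [norm_def, ENNReal.toReal_eq_zero_iff, or_iff_left f.averagedENorm_ne_top]
    constructor
    · intro h
      refine Subtype.ext (eq_zero_of_lorentzENorm_eq_zero (isDoublingWeight_lpqWeight hp hq) hq0 ?_)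
      exact le_antisymm ((lorentzENorm_le_averagedENorm hq0 f.1).trans h.le) zero_le
    · rintro rfl
      have h := averagedENorm_smul (p := p) hq0 (0 : 𝕜) (0 : ℝ →ₘ[unitMeasure] 𝕜)
      rw [enorm_zero, zero_mul, zero_smul 𝕜 (0 : ℝ →ₘ[unitMeasure] 𝕜)] at h
      exact h

noncomputable instance : NormedAddCommGroup (AveragedLpq 𝕜 p q hp hq) :=
  NormedAddCommGroup.ofCore normedSpaceCore

noncomputable instance : NormedSpace 𝕜 (AveragedLpq 𝕜 p q hp hq) :=
  NormedSpace.ofCore normedSpaceCore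

theorem exists_norm_le (𝕜 : Type*) [RCLike 𝕜] (hp : 1 < p) (hq : 1 < q) :
    ∃ C : ℝ, 0 ≤ C ∧ ∀ f : AveragedLpq 𝕜 p q hp hq,
      ‖f‖ ≤ C * (lorentzENorm (lpqWeight p q) q f.1).toReal := by
  obtain ⟨C, hC⟩ := exists_averagedENorm_le 𝕜 hp hq
  refine ⟨max C 0, le_max_right _ _, fun f => ?_⟩
  have h := ENNReal.toReal_mono (ENNReal.mul_ne_top ENNReal.ofReal_ne_top f.2.ne) (hC f.1)
  rwa [ENNReal.toReal_mul, ENNReal.toReal_ofReal'] at h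

/-- Restriction to `A` as a contraction. -/
noncomputable def band (A : Set ℝ) : AveragedLpq 𝕜 p q hp hq →L[𝕜] AveragedLpq 𝕜 p q hp hq :=
  LinearMap.mkContinuous (restrₗ (isDoublingWeight_lpqWeight hp hq) (zero_lt_one.trans hq) A :
    AveragedLpq 𝕜 p q hp hq →ₗ[𝕜] AveragedLpq 𝕜 p q hp hq) 1 fun f => by
      rw [one_mul]
      exact ENNReal.toReal_mono f.averagedENorm_ne_top
        (averagedENorm_mono (by linarith) (enorm_restr_le A f.1))

theorem norm_band_le (A : Set ℝ) (f : AveragedLpq 𝕜 p q hp hq) : ‖band A f‖ ≤ ‖f‖ :=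
  ENNReal.toReal_mono f.averagedENorm_ne_top
    (averagedENorm_mono (by linarith) (enorm_restr_le A f.1))

theorem band_band {A B : Set ℝ} (hA : MeasurableSet A) (hB : MeasurableSet B)
    (f : AveragedLpq 𝕜 p q hp hq) : band A (band B f) = band (A ∩ B) f :=
  Subtype.ext (restr_restr hA hB f.1)

theorem band_add_band_compl {A : Set ℝ} (hA : MeasurableSet A) (f : AveragedLpq 𝕜 p q hp hq) :
    band A f + band Aᶜ f = f :=
  Subtype.ext <| by
    have h := restr_union hA hA.compl disjoint_compl_right f.1
    rw [union_compl_self, restr_univ] at h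
    exact h.symm

theorem band_empty (f : AveragedLpq 𝕜 p q hp hq) : band ∅ f = 0 := by
  have h := band_add_band_compl MeasurableSet.empty f
  have h1 : band (∅ : Set ℝ)ᶜ f = f := by
    rw [compl_empty]
    exact Subtype.ext (restr_univ f.1)
  rw [h1] at h
  simpa using h

theorem tendsto_band {A : ℕ → Set ℝ} (hA : ∀ n, MeasurableSet (A n)) (hanti : Antitone A)
    (h0 : unitMeasure (⋂ n, A n) = 0) (f : AveragedLpq 𝕜 p q hp hq) :
    Tendsto (fun n => band (A n) f) atTop (𝓝 0) := by
  obtain ⟨C, hC0, hC⟩ := exists_norm_le 𝕜 hp hq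
  refine squeeze_zero_norm (fun n => hC _) ?_
  have h := tendsto_lorentzENorm_restr (isDoublingWeight_lpqWeight hp hq) (zero_lt_one.trans hq)
    f.2 hA hanti h0
  have h1 := ((ENNReal.tendsto_toReal ENNReal.zero_ne_top).comp h).const_mul C
  rw [ENNReal.toReal_zero, mul_zero] at h1
  exact h1

end AveragedLpq

theorem rearr_rpow_le {μ : Measure ℝ} {F : ℝ → ℝ≥0∞} (hF : AEMeasurable F μ) {r t : ℝ}
    (hr : 0 < r) (ht : 0 < t) :
    rearr μ F t ^ r ≤ ENNReal.ofReal t⁻¹ * ∫⁻ x, F x ^ r ∂μ := by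
  rw [← rearr_rpow F hr t]
  refine le_of_forall_lt fun s hs => ?_
  obtain ⟨s', hss', hs'⟩ := exists_between hs
  refine hss'.trans_le ?_
  have h1 := lt_rearr_iff.1 hs'
  have h2 := mul_meas_ge_le_lintegral₀ (hF.pow_const r) s'
  have h3 : s' * ENNReal.ofReal t ≤ ∫⁻ x, F x ^ r ∂μ := by
    refine le_trans (mul_le_mul' le_rfl (h1.le.trans (measure_mono fun x hx => ?_))) h2
    exact le_of_lt (show s' < F x ^ r from hx)
  calc s' = ENNReal.ofReal t⁻¹ * (s' * ENNReal.ofReal t) := by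
        rw [mul_left_comm, ← ENNReal.ofReal_mul (by positivity), inv_mul_cancel₀ ht.ne',
          ENNReal.ofReal_one, mul_one]
    _ ≤ _ := mul_le_mul' le_rfl h3

/-- Chebyshev gives `f*(t) ≤ t^{-1/r} ‖f‖_r`, and `t^{q/p - 1 - q/r}` is integrable on `(0,1)` since
`r > p`. -/
theorem exists_lorentzENorm_le_eLpNorm (𝕜 : Type*) [RCLike 𝕜] {r : ℝ} (hp : 0 < p) (hq : 0 < q)
    (hr : p < r) : ∃ K : ℝ, ∀ f : ℝ →ₘ[unitMeasure] 𝕜,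
      lorentzENorm (lpqWeight p q) q f ≤
        ENNReal.ofReal K * eLpNorm f (ENNReal.ofReal r) unitMeasure := by
  have hr0 : 0 < r := hp.trans hr
  have hrt : ENNReal.ofReal r ≠ 0 := (ENNReal.ofReal_pos.2 hr0).ne'
  have hqp : 0 < q / p := by positivity
  set b := q / p - 1 - q / r with hb
  have hb1 : 0 < b + 1 := by
    have : q / r < q / p := div_lt_div_of_pos_left hq hp hr
    linarith
  set K := q / p * (1 / (b + 1)) with hK
  refine ⟨K ^ (1 / q), fun f => ?_⟩
  set N := eLpNorm f (ENNReal.ofReal r) unitMeasure with hN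
  have hNr : N ^ r = ∫⁻ x, ‖f x‖ₑ ^ r ∂unitMeasure := by
    rw [hN, eLpNorm_eq_lintegral_rpow_enorm_toReal hrt ENNReal.ofReal_ne_top,
      ENNReal.toReal_ofReal hr0.le, ← ENNReal.rpow_mul, one_div_mul_cancel hr0.ne',
      ENNReal.rpow_one]
  have hpt : ∀ t ∈ Ioo (0 : ℝ) 1, ENNReal.ofReal (lpqWeight p q t) *
      rearr unitMeasure (fun x => ‖f x‖ₑ) t ^ q ≤
      (ENNReal.ofReal (q / p) * N ^ q) * ENNReal.ofReal (t ^ b) := by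
    intro t ht
    have ht0 := ht.1
    have h1 := ENNReal.rpow_le_rpow (rearr_rpow_le (aemeasurable_enorm f) hr0 ht0)
      (show 0 ≤ q / r by positivity)
    rw [← hNr, ENNReal.mul_rpow_of_nonneg _ _ (by positivity), ← ENNReal.rpow_mul,
      ← ENNReal.rpow_mul, mul_div_cancel₀ _ hr0.ne',
      ENNReal.ofReal_rpow_of_nonneg (by positivity) (by positivity)] at h1
    refine (mul_le_mul' le_rfl h1).trans (le_of_eq ?_)
    rw [lpqWeight, ENNReal.ofReal_mul hqp.le, ← mul_assoc, mul_assoc (ENNReal.ofReal (q / p)),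
      ← ENNReal.ofReal_mul (by positivity), mul_right_comm]
    congr 2
    rw [← Real.rpow_neg_one t, ← Real.rpow_mul ht0.le, ← Real.rpow_add ht0]
    congr 1
    rw [hb]; ring
  have hI : ∫⁻ t in Ioo (0 : ℝ) 1, ENNReal.ofReal (t ^ b) = ENNReal.ofReal (1 / (b + 1)) := by
    rw [setLIntegral_Ioo_rpow (by linarith) one_pos, Real.one_rpow]
  have h2 : lorentzENorm (lpqWeight p q) q f ^ q ≤ ENNReal.ofReal K * N ^ q := by
    rw [lorentzENorm_rpow hq]
    refine (setLIntegral_mono' measurableSet_Ioo hpt).trans (le_of_eq ?_)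
    have hm : Measurable fun t : ℝ => ENNReal.ofReal (t ^ b) :=
      (measurable_id.pow_const b).ennreal_ofReal
    rw [lintegral_const_mul _ hm, hI, mul_right_comm, ← ENNReal.ofReal_mul hqp.le]
  rw [← ENNReal.ofReal_rpow_of_nonneg (by positivity) (by positivity)]
  rw [← ENNReal.rpow_le_rpow_iff hq, ENNReal.mul_rpow_of_nonneg _ _ hq.le, ← ENNReal.rpow_mul,
    one_div_mul_cancel hq.ne', ENNReal.rpow_one]
  exact h2

namespace AveragedLpq

/-- Separability is inherited from `L^{p+1}`, which maps continuously into the space; its image is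
dense because the restrictions of `f` to `{|f| ≤ n}` are bounded and converge to `f`. -/
instance separableSpace : TopologicalSpace.SeparableSpace (AveragedLpq 𝕜 p q hp hq) := by
  have hp0 : 0 < p := by linarith
  have hq0 : 0 < q := by linarith
  obtain ⟨K, hK⟩ := exists_lorentzENorm_le_eLpNorm 𝕜 hp0 hq0 (lt_add_one p)
  obtain ⟨C, hC0, hC⟩ := exists_norm_le 𝕜 hp hq
  set r := ENNReal.ofReal (p + 1) with hr
  have : Fact (1 ≤ r) := ⟨by rw [hr, ENNReal.one_le_ofReal]; linarith⟩
  have : Fact (r ≠ ⊤) := ⟨ENNReal.ofReal_ne_top⟩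
  have hmem : ∀ g : Lp 𝕜 r unitMeasure, lorentzENorm (lpqWeight p q) q g.1 < ⊤ := fun g =>
    (hK g.1).trans_lt (ENNReal.mul_lt_top ENNReal.ofReal_lt_top (Lp.mem_Lp_iff_eLpNorm_lt_top.1 g.2))
  set ι₀ : Lp 𝕜 r unitMeasure →+ AveragedLpq 𝕜 p q hp hq :=
    { toFun := fun g => ⟨g.1, hmem g⟩
      map_zero' := rfl
      map_add' := fun _ _ => rfl } with hι₀
  have hι : ∀ g, ‖ι₀ g‖ ≤ (C * max K 0) * ‖g‖ := fun g => by
    refine (hC _).trans ?_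
    rw [mul_assoc]
    refine mul_le_mul_of_nonneg_left ?_ hC0
    have h := ENNReal.toReal_mono (ENNReal.mul_ne_top ENNReal.ofReal_ne_top
      (Lp.mem_Lp_iff_eLpNorm_lt_top.1 g.2).ne) (hK g.1)
    rwa [ENNReal.toReal_mul, ENNReal.toReal_ofReal'] at h
  have hcont : Continuous ι₀ := AddMonoidHomClass.continuous_of_bound ι₀ _ hι
  have hdense : DenseRange ι₀ := by
    intro f
    set A : ℕ → Set ℝ := fun n => {x | (n : ℝ) < ‖f.1 x‖} with hA
    have hAm : ∀ n, MeasurableSet (A n) := fun n =>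
      measurableSet_lt measurable_const f.1.stronglyMeasurable.norm.measurable
    have hanti : Antitone A := fun m n hmn x hx =>
      lt_of_le_of_lt (Nat.cast_le.2 hmn) (show (n : ℝ) < ‖f.1 x‖ from hx)
    have hempty : ⋂ n, A n = ∅ := by
      refine eq_empty_of_forall_notMem fun x hx => ?_
      obtain ⟨n, hn⟩ := exists_nat_gt ‖f.1 x‖
      exact absurd (mem_iInter.1 hx n) (not_lt.2 hn.le)
    have ht := tendsto_band hAm hanti (by rw [hempty, measure_empty]) f
    have ht' : Tendsto (fun n => band (A n)ᶜ f) atTop (𝓝 f) := by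
      have h1 : ∀ n, band (A n)ᶜ f = f - band (A n) f := fun n =>
        eq_sub_of_add_eq' (band_add_band_compl (hAm n) f)
      simp only [h1]
      simpa using tendsto_const_nhds.sub ht
    refine mem_closure_of_tendsto ht' (Eventually.of_forall fun n => ?_)
    have hb : restr (A n)ᶜ f.1 ∈ Lp 𝕜 r unitMeasure := by
      rw [Lp.mem_Lp_iff_memLp]
      refine MemLp.of_bound (restr (A n)ᶜ f.1).aestronglyMeasurable n ?_
      filter_upwards [coeFn_restr (hAm n).compl f.1] with x hx
      rw [hx]
      by_cases hxA : x ∈ A n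
      · simp [hxA]
      · simpa [hxA] using not_lt.1 hxA
    exact ⟨⟨_, hb⟩, rfl⟩
  exact hdense.separableSpace hcont

end AveragedLpq

end Lorentz

/-! ### Normalised dyadic indicators -/

namespace Lorentz

/-- The dyadic interval `(2^{-n-1}, 2^{-n}]`. -/
def dyadicIoc (n : ℕ) : Set ℝ := Ioc ((1 / 2) ^ (n + 1)) ((1 / 2) ^ n)

theorem measurableSet_dyadicIoc (n : ℕ) : MeasurableSet (dyadicIoc n) := measurableSet_Ioc

theorem dyadicIoc_disjoint {m n : ℕ} (h : m ≠ n) : Disjoint (dyadicIoc m) (dyadicIoc n) := by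
  wlog hmn : m < n generalizing m n
  · exact (this h.symm (lt_of_le_of_ne (not_lt.1 hmn) h.symm)).symm
  refine disjoint_left.2 fun x hx hx' => ?_
  have : (1 / 2 : ℝ) ^ n ≤ (1 / 2) ^ (m + 1) :=
    pow_le_pow_of_le_one (by norm_num) (by norm_num) hmn
  exact absurd (hx.1.trans_le (hx'.2.trans this)) (lt_irrefl _)

theorem unitMeasure_dyadicIoc (n : ℕ) :
    unitMeasure (dyadicIoc n) = ENNReal.ofReal ((1 / 2) ^ (n + 1)) := by
  have hsub : dyadicIoc n ⊆ Icc 0 1 := fun x hx =>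
    ⟨le_trans (by positivity) hx.1.le,
      hx.2.trans (pow_le_one₀ (by norm_num) (by norm_num))⟩
  rw [unitMeasure, Measure.restrict_apply' measurableSet_Icc, inter_eq_left.2 hsub, dyadicIoc,
    Real.volume_Ioc]
  congr 1
  rw [pow_succ]
  ring

/-- The height making the indicator of `dyadicIoc n` of norm one in `L_{p,q}`. -/
noncomputable def dyadicHeight (p : ℝ) (n : ℕ) : ℝ := ((1 / 2) ^ (n + 1)) ^ (-(1 / p))

theorem dyadicHeight_pos (p : ℝ) (n : ℕ) : 0 < dyadicHeight p n := by
  unfold dyadicHeight; positivity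

theorem dyadicHeight_rpow {p q : ℝ} (n : ℕ) :
    dyadicHeight p n ^ q * ((1 / 2) ^ (n + 1)) ^ (q / p) = 1 := by
  have h : (0 : ℝ) < (1 / 2) ^ (n + 1) := by positivity
  rw [dyadicHeight, ← Real.rpow_mul h.le, ← Real.rpow_add h]
  have : -(1 / p) * q + q / p = 0 := by ring
  rw [this, Real.rpow_zero]

theorem dyadicHeight_rpow' {p q : ℝ} (n : ℕ) :
    dyadicHeight p n ^ q * ((1 / 2) ^ n) ^ (q / p) = 2 ^ (q / p) := by
  have h : ((1 / 2 : ℝ) ^ n) = 2 * (1 / 2) ^ (n + 1) := by rw [pow_succ]; ring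
  rw [h, Real.mul_rpow (by norm_num) (by positivity), mul_left_comm, dyadicHeight_rpow, mul_one]

/-- The sum over `S` of the normalised indicators of dyadic intervals. -/
noncomputable def dyadicSum (p : ℝ) (S : Finset ℕ) (x : ℝ) : ℝ≥0∞ :=
  ∑ n ∈ S, (dyadicIoc n).indicator (fun _ => ENNReal.ofReal (dyadicHeight p n)) x

/-- A point `x > t` of the `n`-th interval forces `t < 2^{-n}`, so its height already occurs on the
right. The right side can thus be exceeded only on `[0, t]`, a set of measure at most `t`. -/
theorem rearr_dyadicSum_le {p q : ℝ} (hq : 0 < q) (S : Finset ℕ) (t : ℝ) :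
    rearr unitMeasure (dyadicSum p S) t ^ q ≤
      ∑ n ∈ S, (Iio ((1 / 2 : ℝ) ^ n)).indicator
        (fun _ => ENNReal.ofReal (dyadicHeight p n ^ q)) t := by
  set G := ∑ n ∈ S, (Iio ((1 / 2 : ℝ) ^ n)).indicator
        (fun _ => ENNReal.ofReal (dyadicHeight p n ^ q)) t with hG
  rw [← rearr_rpow _ hq, rearr_le_iff]
  have hsub : {x | G < dyadicSum p S x ^ q} ∩ Icc 0 1 ⊆ Icc 0 t := by
    rintro x ⟨hx, hx0, -⟩
    refine ⟨hx0, ?_⟩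
    by_contra! hxt
    refine absurd (show G < dyadicSum p S x ^ q from hx) (not_lt.2 ?_)
    by_cases hex : ∃ n ∈ S, x ∈ dyadicIoc n
    · obtain ⟨n, hn, hxn⟩ := hex
      have h1 : dyadicSum p S x = ENNReal.ofReal (dyadicHeight p n) := by
        rw [dyadicSum, Finset.sum_eq_single_of_mem n hn, indicator_of_mem hxn]
        intro m _ hmn
        exact indicator_of_notMem (fun hxm => disjoint_left.1 (dyadicIoc_disjoint hmn) hxm hxn) _
      rw [h1, ENNReal.ofReal_rpow_of_nonneg (dyadicHeight_pos p n).le hq.le, hG]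
      refine le_trans (le_of_eq ?_) (Finset.single_le_sum (f := fun n =>
        (Iio ((1 / 2 : ℝ) ^ n)).indicator (fun _ => ENNReal.ofReal (dyadicHeight p n ^ q)) t)
        (fun _ _ => zero_le) hn)
      have : t ∈ Iio ((1 / 2 : ℝ) ^ n) := hxt.trans_le hxn.2
      simp only [indicator_of_mem this]
    · push Not at hex
      have h1 : dyadicSum p S x = 0 :=
        Finset.sum_eq_zero fun n hn => indicator_of_notMem (hex n hn) _
      rw [h1, ENNReal.zero_rpow_of_pos hq]
      exact zero_le
  rw [unitMeasure, Measure.restrict_apply' measurableSet_Icc]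
  refine (measure_mono hsub).trans ?_
  rw [Real.volume_Icc, sub_zero]

theorem measurable_lpqWeight (p q : ℝ) : Measurable fun t => ENNReal.ofReal (lpqWeight p q t) :=
  ((measurable_id.pow_const _).const_mul _).ennreal_ofReal

theorem lintegral_rearr_dyadicSum_le {p q : ℝ} (hp : 0 < p) (hq : 0 < q) (S : Finset ℕ) :
    ∫⁻ t in Ioo (0 : ℝ) 1, ENNReal.ofReal (lpqWeight p q t) *
      rearr unitMeasure (dyadicSum p S) t ^ q ≤ ENNReal.ofReal (2 ^ (q / p)) * S.card := by
  have hm := measurable_lpqWeight p q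
  calc ∫⁻ t in Ioo (0 : ℝ) 1, ENNReal.ofReal (lpqWeight p q t) *
        rearr unitMeasure (dyadicSum p S) t ^ q
      ≤ ∫⁻ t in Ioo (0 : ℝ) 1, ∑ n ∈ S, ENNReal.ofReal (lpqWeight p q t) *
          (Iio ((1 / 2 : ℝ) ^ n)).indicator
            (fun _ => ENNReal.ofReal (dyadicHeight p n ^ q)) t := by
        refine setLIntegral_mono' measurableSet_Ioo fun t _ => ?_
        rw [← Finset.mul_sum]
        exact mul_le_mul' le_rfl (rearr_dyadicSum_le hq S t)
    _ = ∑ n ∈ S, ∫⁻ t in Ioo (0 : ℝ) 1, ENNReal.ofReal (lpqWeight p q t) *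
          (Iio ((1 / 2 : ℝ) ^ n)).indicator
            (fun _ => ENNReal.ofReal (dyadicHeight p n ^ q)) t :=
        lintegral_finsetSum _ fun n _ =>
          hm.mul (measurable_const.indicator measurableSet_Iio)
    _ ≤ ∑ n ∈ S, ENNReal.ofReal (2 ^ (q / p)) := by
        refine Finset.sum_le_sum fun n _ => ?_
        have h1 : ∀ t, ENNReal.ofReal (lpqWeight p q t) * (Iio ((1 / 2 : ℝ) ^ n)).indicator
            (fun _ => ENNReal.ofReal (dyadicHeight p n ^ q)) t =
            (Iio ((1 / 2 : ℝ) ^ n)).indicator (fun t => ENNReal.ofReal (lpqWeight p q t) *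
              ENNReal.ofReal (dyadicHeight p n ^ q)) t := fun t => by
          by_cases ht : t ∈ Iio ((1 / 2 : ℝ) ^ n)
          · rw [indicator_of_mem ht, indicator_of_mem ht]
          · rw [indicator_of_notMem ht, indicator_of_notMem ht, mul_zero]
        simp only [h1]
        have hset : Iio ((1 / 2 : ℝ) ^ n) ∩ Ioo 0 1 ⊆ Ioo 0 ((1 / 2) ^ n) :=
          fun t ht => ⟨ht.2.1, ht.1⟩
        rw [lintegral_indicator measurableSet_Iio, Measure.restrict_restrict measurableSet_Iio]
        refine (lintegral_mono_set hset).trans (le_of_eq ?_)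
        rw [lintegral_mul_const _ hm, lintegral_lpqWeight_Ioo hp hq (by positivity),
          ← ENNReal.ofReal_mul (by positivity), mul_comm, dyadicHeight_rpow']
    _ = _ := by rw [Finset.sum_const, nsmul_eq_mul, mul_comm]

section Dyadic

variable {𝕜 : Type*} [RCLike 𝕜] {p q : ℝ}

/-- The class of the normalised indicator of a dyadic interval. -/
noncomputable def dyadicFun (𝕜 : Type*) [RCLike 𝕜] (p : ℝ) (n : ℕ) : ℝ →ₘ[unitMeasure] 𝕜 :=
  restr (dyadicIoc n) (AEEqFun.const ℝ ((dyadicHeight p n : ℝ) : 𝕜))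

theorem enorm_dyadicFun (p : ℝ) (n : ℕ) : ∀ᵐ x ∂unitMeasure, ‖dyadicFun 𝕜 p n x‖ₑ =
    (dyadicIoc n).indicator (fun _ => ENNReal.ofReal (dyadicHeight p n)) x := by
  filter_upwards [coeFn_restr (measurableSet_dyadicIoc n)
    (AEEqFun.const ℝ ((dyadicHeight p n : ℝ) : 𝕜) : ℝ →ₘ[unitMeasure] 𝕜),
    AEEqFun.coeFn_const (α := ℝ) (μ := unitMeasure) ((dyadicHeight p n : ℝ) : 𝕜)] with x h1 h2
  rw [dyadicFun, h1]
  by_cases hx : x ∈ dyadicIoc n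
  · rw [indicator_of_mem hx, indicator_of_mem hx, h2, Function.const_apply, ← ofReal_norm,
      RCLike.norm_ofReal, abs_of_pos (dyadicHeight_pos p n)]
  · rw [indicator_of_notMem hx, indicator_of_notMem hx, enorm_zero]

theorem enorm_sum_smul_dyadicFun_le (p : ℝ) {a : ℕ → 𝕜} (ha : ∀ n, ‖a n‖ ≤ 1) (S : Finset ℕ) :
    ∀ᵐ x ∂unitMeasure, ‖(∑ n ∈ S, a n • dyadicFun 𝕜 p n : ℝ →ₘ[unitMeasure] 𝕜) x‖ₑ ≤
      dyadicSum p S x := by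
  induction S using Finset.induction_on with
  | empty =>
    filter_upwards [AEEqFun.coeFn_zero (μ := unitMeasure) (α := ℝ) (β := 𝕜)] with x h
    simp [h]
  | insert m S hm ih =>
    rw [Finset.sum_insert hm]
    filter_upwards [ih, enorm_dyadicFun (𝕜 := 𝕜) p m, AEEqFun.coeFn_smul (a m) (dyadicFun 𝕜 p m),
      AEEqFun.coeFn_add (a m • dyadicFun 𝕜 p m) (∑ n ∈ S, a n • dyadicFun 𝕜 p n)]
      with x h1 h2 h3 h4
    rw [h4, Pi.add_apply, h3, Pi.smul_apply, dyadicSum, Finset.sum_insert hm]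
    refine (enorm_add_le _ _).trans (add_le_add ?_ h1)
    rw [smul_eq_mul, enorm_mul, ← h2]
    refine mul_le_of_le_one_left' ?_
    rw [← ofReal_norm, ← ENNReal.ofReal_one]
    exact ENNReal.ofReal_le_ofReal (ha m)

theorem lorentzENorm_sum_smul_dyadicFun_le (hp : 0 < p) (hq : 0 < q) {a : ℕ → 𝕜}
    (ha : ∀ n, ‖a n‖ ≤ 1) (S : Finset ℕ) :
    lorentzENorm (lpqWeight p q) q (∑ n ∈ S, a n • dyadicFun 𝕜 p n) ≤
      (ENNReal.ofReal (2 ^ (q / p)) * S.card) ^ (1 / q) := by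
  unfold lorentzENorm
  refine ENNReal.rpow_le_rpow (le_trans ?_ (lintegral_rearr_dyadicSum_le hp hq S)) (by positivity)
  gcongr with t
  exact rearr_mono (enorm_sum_smul_dyadicFun_le p ha S) t

theorem lorentzENorm_dyadicFun_lt_top (hp : 0 < p) (hq : 0 < q) (n : ℕ) :
    lorentzENorm (lpqWeight p q) q (dyadicFun 𝕜 p n) < ⊤ := by
  have h := lorentzENorm_sum_smul_dyadicFun_le (q := q) hp hq (a := fun _ => (1 : 𝕜))
    (fun _ => by simp) {n}
  rw [Finset.sum_singleton, one_smul 𝕜 (dyadicFun 𝕜 p n)] at h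
  refine h.trans_lt (ENNReal.rpow_lt_top_of_nonneg (by positivity) ?_)
  exact ENNReal.mul_ne_top ENNReal.ofReal_ne_top (ENNReal.natCast_ne_top _)

theorem one_le_lorentzENorm_dyadicFun (hp : 0 < p) (hq : 0 < q) (n : ℕ) :
    1 ≤ lorentzENorm (lpqWeight p q) q (dyadicFun 𝕜 p n) := by
  have h0 : (0 : ℝ) < (1 / 2) ^ (n + 1) := by positivity
  have h1 : (1 / 2 : ℝ) ^ (n + 1) ≤ 1 := pow_le_one₀ (by norm_num) (by norm_num)
  have hr : ∀ t ∈ Ioo (0 : ℝ) ((1 / 2) ^ (n + 1)), ENNReal.ofReal (dyadicHeight p n) ≤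
      rearr unitMeasure (fun x => ‖dyadicFun 𝕜 p n x‖ₑ) t := fun t ht => by
    refine le_of_forall_lt fun s hs => ?_
    rw [rearr_congr (enorm_dyadicFun p n), lt_rearr_iff]
    refine lt_of_lt_of_le ?_ (measure_mono (s := dyadicIoc n) fun x hx => ?_)
    · rw [unitMeasure_dyadicIoc]
      exact (ENNReal.ofReal_lt_ofReal_iff h0).2 ht.2
    · change s < (dyadicIoc n).indicator (fun _ => ENNReal.ofReal (dyadicHeight p n)) x
      rwa [indicator_of_mem hx]
  rw [← ENNReal.one_rpow (1 / q)]
  unfold lorentzENorm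
  refine ENNReal.rpow_le_rpow ?_ (by positivity)
  calc (1 : ℝ≥0∞) = ∫⁻ t in Ioo (0 : ℝ) ((1 / 2) ^ (n + 1)), ENNReal.ofReal (lpqWeight p q t) *
        ENNReal.ofReal (dyadicHeight p n ^ q) := by
        rw [lintegral_mul_const _ (measurable_lpqWeight p q), lintegral_lpqWeight_Ioo hp hq h0,
          ← ENNReal.ofReal_mul (by positivity), mul_comm, dyadicHeight_rpow, ENNReal.ofReal_one]
    _ ≤ ∫⁻ t in Ioo (0 : ℝ) ((1 / 2) ^ (n + 1)), ENNReal.ofReal (lpqWeight p q t) *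
          rearr unitMeasure (fun x => ‖dyadicFun 𝕜 p n x‖ₑ) t ^ q := by
        refine setLIntegral_mono' measurableSet_Ioo fun t ht => mul_le_mul' le_rfl ?_
        rw [← ENNReal.ofReal_rpow_of_nonneg (dyadicHeight_pos p n).le hq.le]
        exact ENNReal.rpow_le_rpow (hr t ht) hq.le
    _ ≤ _ := lintegral_mono_set (Ioo_subset_Ioo_right h1)

theorem restr_dyadicFun {A : Set ℝ} (hA : MeasurableSet A) (n : ℕ) :
    restr A (dyadicFun 𝕜 p n) = restr (A ∩ dyadicIoc n)
      (AEEqFun.const ℝ ((dyadicHeight p n : ℝ) : 𝕜)) :=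
  restr_restr hA (measurableSet_dyadicIoc n) _

end Dyadic

/-! ### The renorming of `L_{p,q}` -/

namespace AveragedLpq

variable {𝕜 : Type*} [RCLike 𝕜] {p q : ℝ} {hp : 1 < p} {hq : 1 < q}

/-- The normalised indicator of a dyadic interval, as an element of `L_{p,q}`. -/
noncomputable def dyadic (n : ℕ) : AveragedLpq 𝕜 p q hp hq :=
  ⟨dyadicFun 𝕜 p n, lorentzENorm_dyadicFun_lt_top (by linarith) (by linarith) n⟩

theorem band_dyadic_self (n : ℕ) : band (dyadicIoc n) (dyadic n) =
    (dyadic n : AveragedLpq 𝕜 p q hp hq) :=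
  Subtype.ext <| by
    change restr (dyadicIoc n) (dyadicFun 𝕜 p n) = dyadicFun 𝕜 p n
    rw [restr_dyadicFun (measurableSet_dyadicIoc n), inter_self, dyadicFun]

theorem band_dyadic_of_disjoint {A : Set ℝ} (hA : MeasurableSet A) {n : ℕ}
    (h : Disjoint A (dyadicIoc n)) : band A (dyadic n : AveragedLpq 𝕜 p q hp hq) = 0 := by
  rw [← band_dyadic_self, band_band hA (measurableSet_dyadicIoc n), disjoint_iff_inter_eq_empty.1 h,
    band_empty]

theorem one_le_norm_dyadic (n : ℕ) : 1 ≤ ‖(dyadic n : AveragedLpq 𝕜 p q hp hq)‖ := by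
  refine le_trans ?_ (lpqNorm_le_norm _)
  have h := ENNReal.toReal_mono
    (lorentzENorm_dyadicFun_lt_top (𝕜 := 𝕜) (p := p) (q := q) (by linarith) (by linarith) n).ne
    (one_le_lorentzENorm_dyadicFun (𝕜 := 𝕜) (p := p) (q := q) (by linarith) (by linarith) n)
  rwa [ENNReal.toReal_one] at h

/-- An upper `ℓ_q` bound for bounded coefficients. As `1/q < 1`, sums of `N` terms are `o(N)`, which
is what makes finite-rank operators vanish along the sequence. -/
theorem exists_norm_sum_smul_dyadic_le (𝕜 : Type*) [RCLike 𝕜] (hp : 1 < p) (hq : 1 < q) :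
    ∃ K : ℝ, 0 ≤ K ∧ ∀ (a : ℕ → 𝕜), (∀ n, ‖a n‖ ≤ 1) → ∀ S : Finset ℕ,
      ‖∑ n ∈ S, a n • (dyadic n : AveragedLpq 𝕜 p q hp hq)‖ ≤ K * (S.card : ℝ) ^ (1 / q) := by
  obtain ⟨C, hC0, hC⟩ := exists_norm_le 𝕜 hp hq
  refine ⟨C * (2 ^ (q / p)) ^ (1 / q), by positivity, fun a ha S => (hC _).trans ?_⟩
  have hq0 : 0 < 1 / q := by positivity
  have hcoe : (∑ n ∈ S, a n • (dyadic n : AveragedLpq 𝕜 p q hp hq)).1 =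
      ∑ n ∈ S, a n • dyadicFun 𝕜 p n :=
    map_sum (lorentzSubmodule 𝕜 (lpqWeight p q) q (isDoublingWeight_lpqWeight hp hq)
      (zero_lt_one.trans hq)).subtype (fun n => a n • (dyadic n : AveragedLpq 𝕜 p q hp hq)) S
  rw [hcoe, mul_assoc]
  refine mul_le_mul_of_nonneg_left ?_ hC0
  have h := lorentzENorm_sum_smul_dyadicFun_le (p := p) (q := q) (by linarith) (by linarith) ha S
  have h1 := ENNReal.toReal_mono (ENNReal.rpow_ne_top_of_nonneg hq0.le
    (ENNReal.mul_ne_top ENNReal.ofReal_ne_top (ENNReal.natCast_ne_top _))) h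
  rw [← ENNReal.toReal_rpow, ENNReal.toReal_mul, ENNReal.toReal_ofReal (by positivity),
    ENNReal.toReal_natCast, Real.mul_rpow (by positivity) (by positivity)] at h1
  exact h1

theorem exists_seminorm (𝕜 : Type*) [RCLike 𝕜] (hp : 1 < p) (hq : 1 < q) :
    ∃ ν : Seminorm 𝕜 (AveragedLpq 𝕜 p q hp hq), (∀ x, ‖x‖ ≤ ν x) ∧ (∀ x, ν x ≤ 3 * ‖x‖) ∧
      ∀ (P : AveragedLpq 𝕜 p q hp hq →ₗ[𝕜] AveragedLpq 𝕜 p q hp hq)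
        (Y : Submodule 𝕜 (AveragedLpq 𝕜 p q hp hq)), Y ≠ ⊤ →
        FiniteDimensional 𝕜 (AveragedLpq 𝕜 p q hp hq ⧸ Y) →
        LinearMap.IsProj Y P → ∀ C : ℝ, (∀ x, ν (P x) ≤ C * ν x) → 9 / 8 ≤ C := by
  set v : ℕ → AveragedLpq 𝕜 p q hp hq := dyadic with hv
  have hv0 : ∀ n, 0 < ‖v n‖ := fun n => zero_lt_one.trans_le (one_le_norm_dyadic n)
  -- Scales the indicators to norm exactly `1/2`; the bound `‖v n‖ ≥ 1` keeps the coefficients at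
  -- most `1`.
  set a : ℕ → 𝕜 := fun n => (((2 * ‖v n‖)⁻¹ : ℝ) : 𝕜) with ha
  have han : ∀ n, ‖a n‖ = (2 * ‖v n‖)⁻¹ := fun n => by
    rw [ha, RCLike.norm_ofReal, abs_of_nonneg (by have := hv0 n; positivity)]
  have ha1 : ∀ n, ‖a n‖ ≤ 1 := fun n => by
    rw [han]
    exact inv_le_one_of_one_le₀ (by linarith [one_le_norm_dyadic (hp := hp) (hq := hq) (𝕜 := 𝕜) n])
  have hanti : Antitone fun n : ℕ => Iic ((1 / 2 : ℝ) ^ n) := fun m n hmn =>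
    Iic_subset_Iic.2 (pow_le_pow_of_le_one (by norm_num) (by norm_num) hmn)
  have hnull : unitMeasure (⋂ n : ℕ, Iic ((1 / 2 : ℝ) ^ n)) = 0 := by
    have hsub : (⋂ n : ℕ, Iic ((1 / 2 : ℝ) ^ n)) ∩ Icc 0 1 ⊆ {0} := by
      rintro x ⟨hx, hx0, -⟩
      have ht : Tendsto (fun n : ℕ => ((1 / 2 : ℝ) ^ n)) atTop (𝓝 0) :=
        tendsto_pow_atTop_nhds_zero_of_lt_one (by norm_num) (by norm_num)
      exact le_antisymm (ge_of_tendsto' ht fun n => mem_iInter.1 hx n) hx0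
    rw [unitMeasure, Measure.restrict_apply' measurableSet_Icc]
    exact measure_mono_null hsub (by simp)
  obtain ⟨K, hK0, hK⟩ := exists_norm_sum_smul_dyadic_le 𝕜 hp hq
  -- `R n` keeps what lies to the right of the `n`-th dyadic interval and `D n` the interval itself,
  -- so `R m` kills `u n` for `m ≤ n`.
  refine exists_seminorm_le_of_isProj (R := fun n => band (Iic ((1 / 2 : ℝ) ^ n))ᶜ)
    (D := fun n => band (dyadicIoc n)) (u := fun n => a n • v n)
    (fun n => norm_band_le _) (fun x => ?_) (fun n => norm_band_le _) (fun n x => ?_)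
    (fun n => ?_) (fun m n hmn => ?_) (fun m n hmn => ?_) (fun n => ?_) (fun δ hδ => ?_)
  · have h1 : ∀ n : ℕ, band (Iic ((1 / 2 : ℝ) ^ n))ᶜ x = x - band (Iic ((1 / 2 : ℝ) ^ n)) x :=
      fun n => eq_sub_of_add_eq' (band_add_band_compl measurableSet_Iic x)
    simp only [h1]
    simpa using tendsto_const_nhds.sub (tendsto_band (fun n => measurableSet_Iic) hanti hnull x)
  · have h1 : dyadicIoc n ∩ (Iic ((1 / 2 : ℝ) ^ n))ᶜ = ∅ :=
      eq_empty_of_forall_notMem fun x hx => hx.2 hx.1.2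
    rw [band_band (measurableSet_dyadicIoc n) measurableSet_Iic.compl, h1, band_empty]
  · rw [map_smul, hv, band_dyadic_self]
  · rw [map_smul, hv, band_dyadic_of_disjoint (measurableSet_dyadicIoc m) (dyadicIoc_disjoint hmn),
      smul_zero]
  · rw [map_smul, hv, band_dyadic_of_disjoint measurableSet_Iic.compl, smul_zero]
    refine disjoint_left.2 fun x hx hx' => hx (hx'.2.trans ?_)
    exact pow_le_pow_of_le_one (by norm_num) (by norm_num) hmn
  · have := hv0 n
    rw [norm_smul, han]
    field_simp
  · have ht : Tendsto (fun N : ℕ => K * (N : ℝ) ^ (-(1 - 1 / q))) atTop (𝓝 0) := by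
      have h1 : 0 < 1 - 1 / q := by
        rw [sub_pos, div_lt_one (by linarith)]; exact hq
      simpa using ((tendsto_rpow_neg_atTop h1).comp tendsto_natCast_atTop_atTop).const_mul K
    obtain ⟨N, hN, hN0⟩ := ((ht.eventually_lt_const hδ).and (eventually_gt_atTop 0)).exists
    refine ⟨N, hN0, fun S hS => (hK a ha1 S).trans ?_⟩
    have hNpos : (0 : ℝ) < N := Nat.cast_pos.2 hN0
    have h2 : (N : ℝ) ^ (1 / q) = (N : ℝ) ^ (-(1 - 1 / q)) * N := by
      rw [← Real.rpow_add_one hNpos.ne']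
      congr 1
      ring
    rw [hS, h2, ← mul_assoc]
    exact mul_le_mul_of_nonneg_right hN.le hNpos.le

end AveragedLpq

end Lorentz

theorem mainTheorem8 {𝕜 : Type*} [RCLike 𝕜] :
    (∀ p : ℝ, ∀ hp : 2 < p, ∃ k : ℝ, 1 < k ∧
      ∀ (w : ℝ → ℝ) (hw : Lorentz.IsLorentzWeight w)
        (P : StrongDual 𝕜 (Lorentz.LorentzSpace 𝕜 w p hw (one_le_two.trans hp.le)) →L[𝕜]
          StrongDual 𝕜 (Lorentz.LorentzSpace 𝕜 w p hw (one_le_two.trans hp.le)))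
        (Y : Submodule 𝕜
          (StrongDual 𝕜 (Lorentz.LorentzSpace 𝕜 w p hw (one_le_two.trans hp.le)))),
        Y ≠ ⊤ →
        FiniteDimensional 𝕜 (StrongDual 𝕜
          (Lorentz.LorentzSpace 𝕜 w p hw (one_le_two.trans hp.le)) ⧸ Y) →
        LinearMap.IsProj Y P → k ≤ ‖P‖) ∧
    (∀ q : ℝ, ∀ hq : 1 < q, q < 2 → ∃ k : ℝ, 1 < k ∧
      ∀ p : ℝ, ∀ hp : 1 < p, ∃ ν : Seminorm 𝕜 (Lorentz.LpqSpace 𝕜 p q hp hq),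
        Lorentz.IsEquivalentNorm ν ∧
        ∀ (P : Lorentz.LpqSpace 𝕜 p q hp hq →ₗ[𝕜] Lorentz.LpqSpace 𝕜 p q hp hq)
          (Y : Submodule 𝕜 (Lorentz.LpqSpace 𝕜 p q hp hq)),
          Y ≠ ⊤ → FiniteDimensional 𝕜 (Lorentz.LpqSpace 𝕜 p q hp hq ⧸ Y) →
          LinearMap.IsProj Y P →
            ∀ C : ℝ, (∀ f, ν (P f) ≤ C * ν f) → k ≤ C) := by
  refine ⟨fun p hp => Lorentz.exists_le_norm_of_isProj_dual hp, fun q hq _ => ⟨9 / 8, by norm_num,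
    fun p hp => ?_⟩⟩
  obtain ⟨ν, hν1, hν2, hν3⟩ := Lorentz.AveragedLpq.exists_seminorm 𝕜 hp hq
  obtain ⟨C, hC0, hC⟩ := Lorentz.AveragedLpq.exists_norm_le 𝕜 hp hq
  -- The averaged space has the same underlying module, so `ν` and its projection bound carry over
  -- as they stand; `3 * C` combines the renorming constant with Hardy's.
  refine ⟨ν, ⟨1, 3 * C, one_pos, fun f => ⟨?_, ?_⟩⟩, hν3⟩
  · rw [one_mul]
    exact (Lorentz.AveragedLpq.lpqNorm_le_norm f).trans (hν1 f)
  · refine (hν2 f).trans ?_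
    rw [mul_assoc]
    exact mul_le_mul_of_nonneg_left (hC f) (by norm_num)
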